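/- Let $d\ge 1$ and let $H_\omega=-\Delta+V_\omega$ on $\ell^2(\mathbb Z^d)$, where $(-\Delta\psi)(x)=\sum_{|y-x|=1}(\psi(x)-\psi(y))$ and the values $V_\omega(x)$, $x\in\mathbb Z^d$, are independent and identically distributed with a bounded density of compact support. For finite $\Lambda\subset\mathbb Z^d$ let $H_{\Lambda;\omega}$ be the restriction of $H_\omega$ to $\Lambda$ (the matrix $(\langle x|H_\omega|y\rangle)_{x,y\in\Lambda}$). Write $\|y\|=\sum_j|y_j|$ and $\Lambda_L=[-L,L]^d\cap\mathbb Z^d$, and let $s\in(0,1)$. Then there are $L_0<\infty$ and $B_1,B_2\in(0,\infty)$, depending only on $d$, $s$ and the distribution of the potential, such that the following holds. Suppose that for some $E\in\mathbb R$ and some finite $L\ge L_0$ either $$\sup_{L/2\le\|y\|\le L}\mathbb E\Big(\big|\langle 0|(H_{\Lambda_L;\omega}-E)^{-1}|y\rangle\big|^s\Big)\le\frac{B_1}{L^{3(d-1)}}$$ or $$\sup_{L/2\le\|y\|\le L}\ \limsup_{\eta\searrow 0}\ \mathbb E\Big(\big|\langle 0|(H_\omega-E-i\eta)^{-1}|y\rangle\big|^s\Big)\le\frac{B_2}{L^{4(d-1)}}.$$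 Then there are an open interval $(a,b)$ containing $E$ and constants $A<\infty$, $\mu>0$ such that $$\mathbb E\Big(\big|\langle x|(H_\omega-E'-i\eta)^{-1}|y\rangle\big|^s\Big)\le A\,e^{-\mu\|x-y\|}$$ for all $E'\in(a,b)$, all $\eta\in\mathbb R$ and all $x,y\in\mathbb Z^d$, where at $\eta=0$ the left side is understood as the $\limsup$ of its values at $\eta>0$ as $\eta\searrow0$. -/

import Mathlib

open MeasureTheory Filter Topology
open scoped ENNReal lp

noncomputable section

/-- The lattice `ℤ^d`. -/
abbrev Site (d : ℕ) : Type := Fin d → ℤ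

/-- The norm `‖x‖ = ∑ j, |x j|` on the lattice. -/
def latNorm {d : ℕ} (x : Site d) : ℝ := ∑ j, |(x j : ℝ)|

/-- The lattice points of the box `[-L, L]^d`. -/
def latBox (d : ℕ) (L : ℝ) : Finset (Site d) :=
  Fintype.piFinset fun _ => Finset.Icc ⌈-L⌉ ⌊L⌋

/-- The lattice points `y` with `L / 2 ≤ ‖y‖ ≤ L`. -/
def annulus (d : ℕ) (L : ℝ) : Set (Site d) :=
  {y | L / 2 ≤ latNorm y ∧ latNorm y ≤ L}

/-! ### Finite volume -/

/-- Matrix elements `⟨x| -Δ + v |y⟩`, where `-Δ` is the nearest neighbour difference operator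
`(-Δ ψ)(x) = ∑_{y ∼ x} (ψ x - ψ y)` on `ℤ^d`. -/
def hamEntry {d : ℕ} (v : Site d → ℝ) (x y : Site d) : ℂ :=
  open Classical in
  if x = y then ((2 * d + v x : ℝ) : ℂ) else if latNorm (x - y) = 1 then -1 else 0

/-- The restriction of `-Δ + v` to the finite region `Λ`, as a matrix. -/
def finHam {d : ℕ} (Λ : Finset (Site d)) (v : Site d → ℝ) : Matrix Λ Λ ℂ :=
  Matrix.of fun x y => hamEntry v x y

/-- The finite volume Green function `⟨x| (H_Λ - z)⁻¹ |y⟩`, for `x` and `y` in `Λ`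
(and zero otherwise). -/
def finGreen {d : ℕ} (Λ : Finset (Site d)) (v : Site d → ℝ) (z : ℂ) (x y : Site d) : ℂ :=
  open Classical in
  if h : x ∈ Λ ∧ y ∈ Λ then (finHam Λ v - z • (1 : Matrix Λ Λ ℂ))⁻¹ ⟨x, h.1⟩ ⟨y, h.2⟩ else 0

/-! ### Infinite volume -/

theorem memℓp_shift {d : ℕ} (a : Site d) (f : ℓ²(Site d, ℂ)) :
    Memℓp (fun x => f (x + a)) 2 :=
  memℓp_gen <| (Equiv.addRight a).summable_iff.2 ((lp.memℓp f).summable (by norm_num))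

/-- The translation `(T_a ψ)(x) = ψ (x + a)` on `ℓ²(ℤ^d)`. -/
def latShift {d : ℕ} (a : Site d) : ℓ²(Site d, ℂ) →L[ℂ] ℓ²(Site d, ℂ) :=
  LinearMap.mkContinuous
    { toFun := fun f => ⟨fun x => f (x + a), memℓp_shift a f⟩
      map_add' := fun _ _ => rfl
      map_smul' := fun _ _ => rfl }
    1
    (fun f => by
      rw [one_mul]
      refine lp.norm_le_of_tsum_le (by norm_num) (norm_nonneg f) (le_of_eq ?_)
      rw [lp.norm_rpow_eq_tsum (by norm_num)]
      exact (Equiv.addRight a).tsum_eq fun x => ‖f x‖ ^ (2 : ℝ≥0∞).toReal)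

/-- `-Δ = 2d - ∑_j (T_{e_j} + T_{-e_j})` on `ℓ²(ℤ^d)`. -/
def negLaplacian (d : ℕ) : ℓ²(Site d, ℂ) →L[ℂ] ℓ²(Site d, ℂ) :=
  ((2 * d : ℝ) : ℂ) • ContinuousLinearMap.id ℂ _
    - ∑ j : Fin d, (latShift (Pi.single j 1 : Site d) + latShift (-Pi.single j 1 : Site d))

/-- Multiplication by a bounded potential `v` on `ℓ²(ℤ^d)`. For an unbounded `v`, which has
probability zero for the random potentials considered below, the value is `0`. -/
def potentialOp {d : ℕ} (v : Site d → ℝ) : ℓ²(Site d, ℂ) →L[ℂ] ℓ²(Site d, ℂ) :=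
  open Classical in
  if h : ∃ K : ℝ, 0 ≤ K ∧ ∀ x, |v x| ≤ K then
    lp.mapCLM 2 (fun x => (v x : ℂ) • ContinuousLinearMap.id ℂ ℂ) h.choose_spec.1
      (fun x => by simpa [norm_smul] using h.choose_spec.2 x)
  else 0

/-- The Schrödinger operator `H = -Δ + v` on `ℓ²(ℤ^d)`. -/
def ham {d : ℕ} (v : Site d → ℝ) : ℓ²(Site d, ℂ) →L[ℂ] ℓ²(Site d, ℂ) :=
  negLaplacian d + potentialOp v

/-- The resolvent `(H - z)⁻¹`. -/
def resolventOp {d : ℕ} (v : Site d → ℝ) (z : ℂ) : ℓ²(Site d, ℂ) →L[ℂ] ℓ²(Site d, ℂ) :=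
  Ring.inverse (ham v - z • (1 : ℓ²(Site d, ℂ) →L[ℂ] ℓ²(Site d, ℂ)))

/-- The Green function `⟨x| (H - z)⁻¹ |y⟩`. -/
def green {d : ℕ} (v : Site d → ℝ) (z : ℂ) (x y : Site d) : ℂ :=
  inner ℂ (lp.single 2 x (1 : ℂ) : ℓ²(Site d, ℂ))
    (resolventOp v z (lp.single 2 y (1 : ℂ)))

/-! ### The random potential and fractional moments -/

/-- A single-site distribution with a bounded density of compact support. -/
def IsRegularLaw (ν : Measure ℝ) : Prop :=
  ∃ ρ : ℝ → ℝ≥0∞, Measurable ρ ∧ HasCompactSupport ρ ∧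
    (∃ M : ℝ≥0∞, M ≠ ∞ ∧ ∀ t, ρ t ≤ M) ∧ ν = volume.withDensity ρ

/-- The law of a potential whose values at the sites are independent with distribution `ν`. -/
def potentialLaw (d : ℕ) (ν : Measure ℝ) : Measure (Site d → ℝ) :=
  Measure.infinitePi fun _ => ν

/-- The finite volume fractional moment `𝔼 (|⟨x| (H_Λ - z)⁻¹ |y⟩|^s)`. -/
def finMoment {d : ℕ} (ν : Measure ℝ) (s : ℝ) (Λ : Finset (Site d)) (z : ℂ) (x y : Site d) :
    ℝ≥0∞ :=
  ∫⁻ v, ‖finGreen Λ v z x y‖ₑ ^ s ∂(potentialLaw d ν)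

/-- The fractional moment `𝔼 (|⟨x| (H - z)⁻¹ |y⟩|^s)` for `z` off the real axis. -/
def offAxisMoment {d : ℕ} (ν : Measure ℝ) (s : ℝ) (z : ℂ) (x y : Site d) : ℝ≥0∞ :=
  ∫⁻ v, ‖green v z x y‖ₑ ^ s ∂(potentialLaw d ν)

/-- The fractional moment `𝔼 (|⟨x| (H - E - iη)⁻¹ |y⟩|^s)`. At `η = 0` it is the boundary value
`𝔼_{+i0}` as `ε ↘ 0`; an upper limit is taken, so that its existence need not be presupposed. -/
def moment {d : ℕ} (ν : Measure ℝ) (s E η : ℝ) (x y : Site d) : ℝ≥0∞ :=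
  open Classical in
  if η = 0 then
    limsup (fun ε : ℝ => offAxisMoment ν s (E + ε * Complex.I) x y) (𝓝[>] 0)
  else offAxisMoment ν s (E + η * Complex.I) x y

/-- Exponential decay of the fractional moments on the energy interval `(a, b)`, uniformly in
the energy and in `η ∈ ℝ`. -/
def ExpDecayOn (d : ℕ) (ν : Measure ℝ) (s a b : ℝ) : Prop :=
  ∃ A m : ℝ, 0 < m ∧ ∀ E ∈ Set.Ioo a b, ∀ (η : ℝ) (x y : Site d),
    moment ν s E η x y ≤ ENNReal.ofReal (A * Real.exp (-m * latNorm (x - y)))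

end

/-! The core is a recursive inequality at non-real energies `z`. Let `Λ` contain a ball of radius
`r` about the origin. Then the moment of `|G(x,y)|^s`, for `y` outside a slightly larger ball about
`x`, is at most a constant times a double sum of products of two moments. One is that of the Green
function of the translate of `Λ` centred at `x`, from `x` to a shell of radius about `r`; the other
is that of `G` itself, from a neighbouring shell to `y` (`GreenFamily.fracMoment_le`). With `r` of
order `L` the sum has `O(L^{2(d-1)})` terms, so finite volume moments of size `B₁ / L^{3(d-1)}` with
`B₁` small make the inequality a contraction by `1/2`. Iteration gives exponential decay.

The inequality comes from Green's identity applied on two concentric balls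
(`IsGreen.rpow_le_of_inner`, `IsGreen.rpow_le_of_outer`), with independence produced by resampling.
Three independent copies of the potential are glued: `V₁` near `x`, `V₂` far away, `V₀` on the
intermediate shell. The glued potential has the original law. The inner factor can be taken for `V₁`
alone and the outer one for `V₂` alone: the mismatch of potentials only adds terms supported on the
shells, of the same form as the boundary terms. The middle factor is averaged over `V₀` first, with
`V₁` and `V₂` frozen; the other two factors are then independent. No decoupling inequality is
needed, and every `s < 1` is allowed.

The average over `V₀` is bounded by the a priori estimate. As a function of the potentials at `a`
and `b`, the entry `G(a,b)` is dominated by one of three simple poles (`two_site_bound`), and a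
bounded density integrates `|t + ζ|^{-s}` uniformly in `ζ`.

Three transfers complete the argument. Smallness of finite volume moments at `E` persists at nearby
non-real `z`, because `E` is almost surely not an eigenvalue of the finite matrix and a moment of
order `t ∈ (s,1)` controls the tails. For `|η|` bounded below, a truncated Neumann series gives
deterministic decay. Finally, smallness of infinite volume moments is reduced to the finite volume
case by a single expansion, at the cost of one factor `L^{d-1}`.

Potentials are truncated to the support of the law throughout, so that operator statements hold for
every potential; almost surely this changes nothing. -/

/-! ### The geometry of the lattice -/

/-- The integer-valued version of `latNorm`. -/
def siteNorm {d : ℕ} (a : Site d) : ℕ := ∑ j, (a j).natAbs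

theorem latNorm_eq_siteNorm {d : ℕ} (a : Site d) : latNorm a = siteNorm a := by
  simp [latNorm, siteNorm, Nat.cast_natAbs]

theorem siteNorm_add_le {d : ℕ} (a b : Site d) : siteNorm (a + b) ≤ siteNorm a + siteNorm b := by
  unfold siteNorm
  rw [← Finset.sum_add_distrib]
  exact Finset.sum_le_sum fun j _ => Int.natAbs_add_le _ _

theorem siteNorm_neg {d : ℕ} (a : Site d) : siteNorm (-a) = siteNorm a := by
  simp [siteNorm]

theorem siteNorm_sub_comm {d : ℕ} (a b : Site d) : siteNorm (a - b) = siteNorm (b - a) := by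
  rw [← siteNorm_neg, neg_sub]

theorem siteNorm_zero {d : ℕ} : siteNorm (0 : Site d) = 0 := by simp [siteNorm]

theorem siteNorm_sub_le {d : ℕ} (a b c : Site d) :
    siteNorm (a - c) ≤ siteNorm (a - b) + siteNorm (b - c) := by
  simpa using siteNorm_add_le (a - b) (b - c)

/-- The `2 d` directions of the lattice. -/
abbrev Dir (d : ℕ) : Type := Fin d × ℤˣ

/-- The unit vector in the direction `i`. -/
def unitVec {d : ℕ} (i : Dir d) : Site d := Pi.single i.1 (i.2 : ℤ)

/-- The opposite direction. -/
def Dir.opp {d : ℕ} (i : Dir d) : Dir d := (i.1, -i.2)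

theorem Dir.opp_opp {d : ℕ} (i : Dir d) : i.opp.opp = i := by simp [Dir.opp]

theorem unitVec_opp {d : ℕ} (i : Dir d) : unitVec i.opp = -unitVec i := by
  simp [Dir.opp, unitVec, Pi.single_neg]

theorem siteNorm_unitVec {d : ℕ} (i : Dir d) : siteNorm (unitVec i) = 1 := by
  unfold siteNorm unitVec
  rw [Finset.sum_eq_single i.1]
  · simp
  · intro j _ hj
    simp [hj]
  · simp

theorem unitVec_ne_zero {d : ℕ} (i : Dir d) : unitVec i ≠ 0 := fun h => by
  have := siteNorm_unitVec i
  rw [h, siteNorm_zero] at this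
  omega

theorem unitVec_injective {d : ℕ} : Function.Injective (unitVec (d := d)) := by
  rintro ⟨j, u⟩ ⟨k, w⟩ h
  have h1 : unitVec (j, u) j = unitVec (k, w) j := by rw [h]
  by_cases hjk : j = k
  · subst hjk
    simp only [unitVec, Pi.single_eq_same] at h1
    rw [Units.ext h1]
  · simp only [unitVec, Pi.single_eq_same, Pi.single_eq_of_ne hjk] at h1
    exact absurd h1 u.ne_zero

theorem siteNorm_add_unitVec_le {d : ℕ} (a : Site d) (i : Dir d) :
    siteNorm (a + unitVec i) ≤ siteNorm a + 1 := by
  simpa [siteNorm_unitVec] using siteNorm_add_le a (unitVec i)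

theorem eq_zero_of_siteNorm_eq_zero {d : ℕ} {a : Site d} (h : siteNorm a = 0) : a = 0 := by
  funext j
  have := (Finset.sum_eq_zero_iff.1 h) j (Finset.mem_univ j)
  simpa using this

theorem exists_unitVec_of_siteNorm_eq_one {d : ℕ} {a : Site d} (h : siteNorm a = 1) :
    ∃ i, a = unitVec i := by
  obtain ⟨j, hj⟩ : ∃ j, a j ≠ 0 := by
    by_contra hcon
    push Not at hcon
    have : a = 0 := funext hcon
    rw [this, siteNorm_zero] at h
    omega
  have h1 : (a j).natAbs + ∑ k ∈ Finset.univ.erase j, (a k).natAbs = 1 := by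
    rw [Finset.add_sum_erase _ (fun k => (a k).natAbs) (Finset.mem_univ j)]
    exact h
  have h2 : 0 < (a j).natAbs := Int.natAbs_pos.2 hj
  have h3 : ∑ k ∈ Finset.univ.erase j, (a k).natAbs = 0 := by omega
  have h4 : (a j).natAbs = 1 := by omega
  obtain ⟨u, hu⟩ := Int.isUnit_iff_natAbs_eq.2 h4
  refine ⟨(j, u), ?_⟩
  funext k
  by_cases hk : k = j
  · subst hk
    simp [unitVec, hu]
  · have := (Finset.sum_eq_zero_iff.1 h3) k (by simp [hk])
    simp only [unitVec, Pi.single_eq_of_ne hk]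
    simpa using this

/-- The closed ball with center `x` and radius `r` for the norm `siteNorm`. -/
noncomputable def siteBall {d : ℕ} (x : Site d) (r : ℕ) : Finset (Site d) :=
  (Fintype.piFinset fun j => Finset.Icc (x j - r) (x j + r)).filter fun a => siteNorm (a - x) ≤ r

theorem mem_siteBall {d : ℕ} {x a : Site d} {r : ℕ} :
    a ∈ siteBall x r ↔ siteNorm (a - x) ≤ r := by
  simp only [siteBall, Finset.mem_filter, Fintype.mem_piFinset, Finset.mem_Icc,
    and_iff_right_iff_imp]
  intro h j
  have : (a j - x j).natAbs ≤ siteNorm (a - x) :=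
    Finset.single_le_sum (f := fun j => ((a - x) j).natAbs) (fun _ _ => Nat.zero_le _)
      (Finset.mem_univ j)
  omega

/-- The sites at distance `r` or `r + 1` from `x`. -/
noncomputable def shell {d : ℕ} (x : Site d) (r : ℕ) : Finset (Site d) :=
  (siteBall x (r + 1)).filter fun a => r ≤ siteNorm (a - x)

theorem mem_shell {d : ℕ} {x a : Site d} {r : ℕ} :
    a ∈ shell x r ↔ r ≤ siteNorm (a - x) ∧ siteNorm (a - x) ≤ r + 1 := by
  simp [shell, mem_siteBall, and_comm]

/-- The pairs of sites of `shell x r` at distance at most one. -/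
noncomputable def shellPairs {d : ℕ} (x : Site d) (r : ℕ) : Finset (Site d × Site d) :=
  (shell x r ×ˢ shell x r).filter fun p => siteNorm (p.2 - p.1) ≤ 1

theorem mem_shellPairs {d : ℕ} {x : Site d} {r : ℕ} {p : Site d × Site d} :
    p ∈ shellPairs x r ↔ (p.1 ∈ shell x r ∧ p.2 ∈ shell x r) ∧ siteNorm (p.2 - p.1) ≤ 1 := by
  simp [shellPairs]

theorem card_shell_le {n : ℕ} (x : Site (n + 1)) (r : ℕ) :
    (shell x r).card ≤ 4 * (2 * r + 3) ^ n := by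
  classical
  -- A site of the shell is determined by its last `n` relative coordinates, by which of the two
  -- radii it has, and by the sign of the first coordinate. This gives the surface-order count, with
  -- 4 = 2 · 2.
  let T : Finset ((Fin n → ℤ) × ℕ × Bool) :=
    (Fintype.piFinset fun _ : Fin n => Finset.Icc (-((r : ℤ) + 1)) (r + 1)) ×ˢ
      (Finset.range 2 ×ˢ Finset.univ)
  have hT : T.card = 4 * (2 * r + 3) ^ n := by
    simp only [T, Finset.card_product, Fintype.card_piFinset, Int.card_Icc, Finset.prod_const,
      Finset.card_univ, Fintype.card_fin, Finset.card_range, Fintype.card_bool]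
    have : ((r : ℤ) + 1 + 1 - -((r : ℤ) + 1)).toNat = 2 * r + 3 := by omega
    rw [this]
    ring
  rw [← hT]
  refine Finset.card_le_card_of_injOn
    (fun a => (fun j => (a - x) j.succ, siteNorm (a - x) - r, decide (0 ≤ (a - x) 0))) ?_ ?_
  · intro a ha
    obtain ⟨h1, h2⟩ := mem_shell.1 ha
    simp only [T, Finset.coe_product, Set.mem_prod, Finset.mem_coe, Fintype.mem_piFinset,
      Finset.mem_Icc, Finset.mem_range, Finset.mem_univ, and_true]
    refine ⟨fun j => ?_, by omega⟩
    have : ((a - x) j.succ).natAbs ≤ siteNorm (a - x) :=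
      Finset.single_le_sum (f := fun j => ((a - x) j).natAbs) (fun _ _ => Nat.zero_le _)
        (Finset.mem_univ j.succ)
    omega
  · intro a ha b hb hab
    obtain ⟨ha1, ha2⟩ := mem_shell.1 ha
    obtain ⟨hb1, hb2⟩ := mem_shell.1 hb
    simp only [Prod.mk.injEq, decide_eq_decide] at hab
    obtain ⟨h1, h2, h3⟩ := hab
    have hs : ∀ j : Fin n, (a - x) j.succ = (b - x) j.succ := fun j => congrFun h1 j
    have hn : siteNorm (a - x) = siteNorm (b - x) := by omega
    have h0 : (a - x) 0 = (b - x) 0 := by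
      unfold siteNorm at hn
      rw [Fin.sum_univ_succ, Fin.sum_univ_succ] at hn
      simp only [hs] at hn
      omega
    have : a - x = b - x := funext fun j => Fin.cases h0 hs j
    simpa using this

theorem card_shellPairs_le {n : ℕ} (x : Site (n + 1)) (r : ℕ) :
    (shellPairs x r).card ≤ (2 * n + 3) * (4 * (2 * r + 3) ^ n) := by
  classical
  let e : Option (Dir (n + 1)) → Site (n + 1) := fun o => o.elim 0 unitVec
  have hsub : shellPairs x r ⊆
      (Finset.univ ×ˢ shell x r).image
        fun q : Option (Dir (n + 1)) × Site (n + 1) => (q.2, q.2 + e q.1) := by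
    intro p hp
    obtain ⟨⟨h1, -⟩, h3⟩ := mem_shellPairs.1 hp
    rw [Finset.mem_image]
    obtain h | h : siteNorm (p.2 - p.1) = 0 ∨ siteNorm (p.2 - p.1) = 1 := by omega
    · refine ⟨(none, p.1), by simp [h1], ?_⟩
      have := eq_zero_of_siteNorm_eq_zero h
      ext1
      · rfl
      · simpa [e] using (sub_eq_zero.1 this).symm
    · obtain ⟨i, hi⟩ := exists_unitVec_of_siteNorm_eq_one h
      refine ⟨(some i, p.1), by simp [h1], ?_⟩
      ext1
      · rfl
      · simp [e, ← hi]
  calc (shellPairs x r).card ≤ _ := Finset.card_le_card hsub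
    _ ≤ _ := Finset.card_image_le
    _ = (2 * n + 3) * (shell x r).card := by
        rw [Finset.card_product, Finset.card_univ, Fintype.card_option, Fintype.card_prod,
          Fintype.card_fin, Fintype.card_units_int]
        ring
    _ ≤ _ := Nat.mul_le_mul_left _ (card_shell_le x r)

/-! ### Green's identity -/

/-- The discrete Green identity on a finite set of sites. -/
theorem sum_green_identity {d : ℕ} (B : Finset (Site d)) (g u : Site d → ℂ) :
    ∑ a ∈ B, ∑ i : Dir d, (g a * u (a + unitVec i) - g (a + unitVec i) * u a) =
      ∑ a ∈ B, ∑ i : Dir d, if a + unitVec i ∈ B then 0 else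
        (g a * u (a + unitVec i) - g (a + unitVec i) * u a) := by
  rw [← sub_eq_zero, ← Finset.sum_sub_distrib]
  simp_rw [← Finset.sum_sub_distrib]
  rw [← Finset.sum_product']
  have h1 : ∀ p : Site d × Dir d,
      ((g p.1 * u (p.1 + unitVec p.2) - g (p.1 + unitVec p.2) * u p.1) -
        if p.1 + unitVec p.2 ∈ B then 0 else
          (g p.1 * u (p.1 + unitVec p.2) - g (p.1 + unitVec p.2) * u p.1)) =
      if p.1 + unitVec p.2 ∈ B then
        (g p.1 * u (p.1 + unitVec p.2) - g (p.1 + unitVec p.2) * u p.1) else 0 := by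
    intro p
    split_ifs <;> ring
  simp_rw [h1]
  rw [← Finset.sum_filter]
  -- Reversing an interior bond changes the sign of its antisymmetric contribution.
  refine Finset.sum_involution (fun p _ => (p.1 + unitVec p.2, p.2.opp)) ?_ ?_ ?_ ?_
  · intro p _
    simp only [unitVec_opp, add_neg_cancel_right]
    ring
  · intro p _ _ h
    have := congrArg Prod.fst h
    simp only [add_eq_left] at this
    exact unitVec_ne_zero _ this
  · intro p hp
    simp only [Finset.mem_filter, Finset.mem_product, Finset.mem_univ, and_true] at hp ⊢
    exact ⟨hp.2, by simpa [unitVec_opp] using hp.1⟩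
  · intro p _
    simp [unitVec_opp, Dir.opp_opp]

/-- The finite difference expression `((-Δ + v - z) u)(a)`. -/
noncomputable def hamAt {d : ℕ} (v : Site d → ℝ) (z : ℂ) (u : Site d → ℂ) (a : Site d) : ℂ :=
  ((2 * d + v a : ℝ) - z) * u a - ∑ i : Dir d, u (a + unitVec i)

/-- The energy and the diagonal of the Laplacian cancel in the antisymmetric pairing, leaving the
difference of the potentials and the bonds leaving `B`. -/
theorem sum_hamAt_sub {d : ℕ} (B : Finset (Site d)) (v w : Site d → ℝ) (z : ℂ)
    (g u : Site d → ℂ) :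
    ∑ a ∈ B, (g a * hamAt v z u a - hamAt w z g a * u a) =
      ∑ a ∈ B, ((v a - w a : ℝ) : ℂ) * (g a * u a) -
        ∑ a ∈ B, ∑ i : Dir d, if a + unitVec i ∈ B then 0 else
          (g a * u (a + unitVec i) - g (a + unitVec i) * u a) := by
  rw [← sum_green_identity, ← Finset.sum_sub_distrib]
  refine Finset.sum_congr rfl fun a _ => ?_
  simp only [hamAt, Finset.sum_sub_distrib, ← Finset.mul_sum, ← Finset.sum_mul]
  push_cast
  ring

/-! ### Green functions and the geometric resolvent bounds -/

/-- `G` is the (symmetric) Green function of the restriction of `-Δ + v` to `Ω` at energy `z`. -/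
structure IsGreen {d : ℕ} (Ω : Set (Site d)) (v : Site d → ℝ) (z : ℂ)
    (G : Site d → Site d → ℂ) : Prop where
  zero : ∀ x y, x ∉ Ω → G x y = 0
  symm : ∀ x y, G x y = G y x
  eq : ∀ x y, x ∈ Ω → hamAt v z (fun a => G a y) x = if x = y then 1 else 0

theorem ENNReal.sum_rpow_le_of_le_one {ι : Type*} (t : Finset ι) (f : ι → ℝ≥0∞) {s : ℝ}
    (hs : 0 < s) (hs1 : s ≤ 1) : (∑ i ∈ t, f i) ^ s ≤ ∑ i ∈ t, f i ^ s := by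
  classical
  induction t using Finset.induction_on with
  | empty => simp [hs]
  | insert i t hi ih =>
    rw [Finset.sum_insert hi, Finset.sum_insert hi]
    exact (ENNReal.rpow_add_le_add_rpow _ _ hs.le hs1).trans (by gcongr)

/-- The boundary term of Green's identity on the ball `siteBall x r`. -/
noncomputable def bdryTerm {d : ℕ} (x : Site d) (r : ℕ) (g u : Site d → ℂ) : ℂ :=
  ∑ a ∈ siteBall x r, ∑ i : Dir d, if a + unitVec i ∈ siteBall x r then 0 else
    (g a * u (a + unitVec i) - g (a + unitVec i) * u a)

theorem shellPairs_of_boundary {d : ℕ} {x a : Site d} {r : ℕ} {i : Dir d}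
    (ha : a ∈ siteBall x r) (hi : a + unitVec i ∉ siteBall x r) :
    (a, a + unitVec i) ∈ shellPairs x r ∧ (a + unitVec i, a) ∈ shellPairs x r := by
  rw [mem_siteBall] at ha hi
  have h1 : siteNorm (a + unitVec i - x) ≤ siteNorm (a - x) + 1 := by
    have := siteNorm_add_unitVec_le (a - x) i
    rwa [sub_add_eq_add_sub] at this
  have h2 : a ∈ shell x r := mem_shell.2 ⟨by omega, by omega⟩
  have h3 : a + unitVec i ∈ shell x r := mem_shell.2 ⟨by omega, by omega⟩
  simp [mem_shellPairs, h2, h3, siteNorm_unitVec, siteNorm_neg]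

theorem enorm_bdryTerm_le {d : ℕ} (x : Site d) (r : ℕ) (g u : Site d → ℂ) :
    ‖bdryTerm x r g u‖ₑ ≤ 2 * ∑ p ∈ shellPairs x r, ‖g p.1‖ₑ * ‖u p.2‖ₑ := by
  classical
  let Q : Finset (Site d × Dir d) :=
    (siteBall x r ×ˢ Finset.univ).filter fun q => q.1 + unitVec q.2 ∉ siteBall x r
  have hQ : ∀ q ∈ Q, q.1 ∈ siteBall x r ∧ q.1 + unitVec q.2 ∉ siteBall x r := by
    intro q hq
    simpa [Q] using hq
  have h0 : bdryTerm x r g u =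
      ∑ q ∈ Q, (g q.1 * u (q.1 + unitVec q.2) - g (q.1 + unitVec q.2) * u q.1) := by
    unfold bdryTerm
    rw [← Finset.sum_product', Finset.sum_filter]
    refine Finset.sum_congr rfl fun q _ => ?_
    by_cases h : q.1 + unitVec q.2 ∈ siteBall x r <;> simp [h]
  have h1 : ∑ q ∈ Q, ‖g q.1‖ₑ * ‖u (q.1 + unitVec q.2)‖ₑ ≤
      ∑ p ∈ shellPairs x r, ‖g p.1‖ₑ * ‖u p.2‖ₑ := by
    rw [← Finset.sum_image (s := Q) (g := fun q : Site d × Dir d => (q.1, q.1 + unitVec q.2))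
      (f := fun p => ‖g p.1‖ₑ * ‖u p.2‖ₑ)]
    · refine Finset.sum_le_sum_of_subset fun p hp => ?_
      obtain ⟨q, hq, rfl⟩ := Finset.mem_image.1 hp
      exact (shellPairs_of_boundary (hQ q hq).1 (hQ q hq).2).1
    · rintro ⟨a, i⟩ _ ⟨b, j⟩ _ h
      simp only [Prod.mk.injEq] at h
      obtain ⟨rfl, h⟩ := h
      rw [unitVec_injective (add_left_cancel h)]
  have h2 : ∑ q ∈ Q, ‖g (q.1 + unitVec q.2)‖ₑ * ‖u q.1‖ₑ ≤
      ∑ p ∈ shellPairs x r, ‖g p.1‖ₑ * ‖u p.2‖ₑ := by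
    rw [← Finset.sum_image (s := Q) (g := fun q : Site d × Dir d => (q.1 + unitVec q.2, q.1))
      (f := fun p => ‖g p.1‖ₑ * ‖u p.2‖ₑ)]
    · refine Finset.sum_le_sum_of_subset fun p hp => ?_
      obtain ⟨q, hq, rfl⟩ := Finset.mem_image.1 hp
      exact (shellPairs_of_boundary (hQ q hq).1 (hQ q hq).2).2
    · rintro ⟨a, i⟩ _ ⟨b, j⟩ _ h
      simp only [Prod.mk.injEq] at h
      obtain ⟨h, rfl⟩ := h
      rw [unitVec_injective (add_left_cancel h)]
  calc ‖bdryTerm x r g u‖ₑ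
      ≤ ∑ q ∈ Q, (‖g q.1‖ₑ * ‖u (q.1 + unitVec q.2)‖ₑ +
          ‖g (q.1 + unitVec q.2)‖ₑ * ‖u q.1‖ₑ) := by
        rw [h0]
        refine (enorm_sum_le _ _).trans (Finset.sum_le_sum fun q _ => ?_)
        refine enorm_sub_le.trans ?_
        rw [enorm_mul, enorm_mul]
    _ ≤ _ := by
        rw [Finset.sum_add_distrib, two_mul]
        exact add_le_add h1 h2

/-- The common estimate behind the geometric resolvent bounds. -/
theorem enorm_bdryTerm_add_rpow_le {d : ℕ} (x : Site d) (r : ℕ) (g u : Site d → ℂ)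
    (c : Site d → ℝ) {K : ℝ} (hc : ∀ a, |c a| ≤ K) {s : ℝ} (hs : 0 < s) (hs1 : s ≤ 1) :
    ‖bdryTerm x r g u + ∑ a ∈ shell x r, (c a : ℂ) * (g a * u a)‖ₑ ^ s ≤
      (2 + ENNReal.ofReal K) ^ s *
        ∑ p ∈ shellPairs x r, ‖g p.1‖ₑ ^ s * ‖u p.2‖ₑ ^ s := by
  classical
  have h1 : ‖∑ a ∈ shell x r, (c a : ℂ) * (g a * u a)‖ₑ ≤
      ENNReal.ofReal K * ∑ p ∈ shellPairs x r, ‖g p.1‖ₑ * ‖u p.2‖ₑ := by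
    calc _ ≤ ∑ a ∈ shell x r, ENNReal.ofReal K * (‖g a‖ₑ * ‖u a‖ₑ) := by
          refine (enorm_sum_le _ _).trans (Finset.sum_le_sum fun a _ => ?_)
          rw [enorm_mul, enorm_mul]
          gcongr
          rw [← ofReal_norm]
          exact ENNReal.ofReal_le_ofReal (by simpa using hc a)
      _ ≤ _ := by
          rw [← Finset.mul_sum]
          gcongr
          -- Mismatch terms sit on the diagonal pairs `(a, a)`, which is why `shellPairs` allows
          -- distance zero: one sum then absorbs both kinds of terms.
          rw [← Finset.sum_image (s := shell x r) (g := fun a : Site d => (a, a))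
            (f := fun p => ‖g p.1‖ₑ * ‖u p.2‖ₑ)]
          · refine Finset.sum_le_sum_of_subset fun p hp => ?_
            obtain ⟨a, ha, rfl⟩ := Finset.mem_image.1 hp
            simp [mem_shellPairs, ha, siteNorm_zero]
          · intro a _ b _ h
            exact (Prod.mk.inj h).1
  calc _ ≤ ((2 + ENNReal.ofReal K) * ∑ p ∈ shellPairs x r, ‖g p.1‖ₑ * ‖u p.2‖ₑ) ^ s := by
        gcongr
        refine (enorm_add_le _ _).trans ?_
        rw [add_mul]
        exact add_le_add (enorm_bdryTerm_le x r g u) h1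
    _ ≤ _ := by
        rw [ENNReal.mul_rpow_of_nonneg _ _ hs.le]
        gcongr
        refine (ENNReal.sum_rpow_le_of_le_one _ _ hs hs1).trans_eq ?_
        exact Finset.sum_congr rfl fun p _ => ENNReal.mul_rpow_of_nonneg _ _ hs.le

/-- Green's identity for two Green functions on a ball contained in both domains. -/
theorem IsGreen.sum_siteBall {d : ℕ} {Ω Ω₁ : Set (Site d)} {v v₁ : Site d → ℝ} {z : ℂ}
    {G G₁ : Site d → Site d → ℂ} (h : IsGreen Ω v z G) (h₁ : IsGreen Ω₁ v₁ z G₁)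
    {x x' y : Site d} {r : ℕ} (hΩ : ↑(siteBall x r) ⊆ Ω) (hΩ₁ : ↑(siteBall x r) ⊆ Ω₁)
    (hx : x' ∈ siteBall x r) (hy : y ∉ siteBall x r) :
    ∑ a ∈ siteBall x r, ((v a - v₁ a : ℝ) : ℂ) * (G₁ x' a * G a y) -
      bdryTerm x r (fun a => G₁ x' a) (fun a => G a y) = -G x' y := by
  have h0 := sum_hamAt_sub (siteBall x r) v v₁ z (fun a => G₁ a x') (fun a => G a y)
  have h1 : ∑ a ∈ siteBall x r, (G₁ a x' * hamAt v z (fun a => G a y) a -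
      hamAt v₁ z (fun a => G₁ a x') a * G a y) = -G x' y := by
    rw [Finset.sum_congr rfl fun a ha => by
      rw [h.eq a y (hΩ ha), h₁.eq a x' (hΩ₁ ha),
        if_neg (fun hay : a = y => hy (hay ▸ ha)), mul_zero, zero_sub]]
    rw [Finset.sum_neg_distrib]
    simp [hx]
  rw [h1] at h0
  rw [h0]
  simp only [bdryTerm, h₁.symm _ x']

/-- Green's identity for `G₁(x,·)` and `G(·,y)` on the ball: the potentials agree at distance less
than `r`, so inside the ball they can differ only at distance exactly `r`, which belongs to the
shell. Thus `G₁` may be computed from a potential independent of the one beyond its ball. -/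
theorem IsGreen.rpow_le_of_inner {d : ℕ} {Ω Ω₁ : Set (Site d)} {v v₁ : Site d → ℝ} {z : ℂ}
    {G G₁ : Site d → Site d → ℂ} (h : IsGreen Ω v z G) (h₁ : IsGreen Ω₁ v₁ z G₁)
    {x y : Site d} {r : ℕ} (hΩ : ↑(siteBall x r) ⊆ Ω) (hΩ₁ : ↑(siteBall x r) ⊆ Ω₁)
    (hy : y ∉ siteBall x r) {K : ℝ} (hK : ∀ a, |v a - v₁ a| ≤ K)
    (hv : ∀ a, siteNorm (a - x) < r → v a = v₁ a) {s : ℝ} (hs : 0 < s) (hs1 : s ≤ 1) :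
    ‖G x y‖ₑ ^ s ≤ (2 + ENNReal.ofReal K) ^ s *
      ∑ p ∈ shellPairs x r, ‖G₁ x p.1‖ₑ ^ s * ‖G p.2 y‖ₑ ^ s := by
  classical
  have hx : x ∈ siteBall x r := by simp [mem_siteBall, siteNorm_zero]
  have h0 := h.sum_siteBall h₁ hΩ hΩ₁ hx hy
  set c : Site d → ℝ := fun a => if a ∈ siteBall x r then v₁ a - v a else 0 with hc
  have h1 : ∑ a ∈ siteBall x r, ((v a - v₁ a : ℝ) : ℂ) * (G₁ x a * G a y) =
      -∑ a ∈ shell x r, (c a : ℂ) * (G₁ x a * G a y) := by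
    rw [← Finset.sum_neg_distrib]
    have e1 : ∑ a ∈ siteBall x r, ((v a - v₁ a : ℝ) : ℂ) * (G₁ x a * G a y) =
        ∑ a ∈ siteBall x r ∩ shell x r, ((v a - v₁ a : ℝ) : ℂ) * (G₁ x a * G a y) := by
      symm
      refine Finset.sum_subset Finset.inter_subset_left fun a ha ha' => ?_
      rw [Finset.mem_inter, mem_shell] at ha'
      have hb := mem_siteBall.1 ha
      rw [hv a (by by_contra hcon; exact ha' ⟨ha, by omega, by omega⟩)]
      simp
    have e2 : ∑ a ∈ shell x r, -((c a : ℂ) * (G₁ x a * G a y)) =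
        ∑ a ∈ siteBall x r ∩ shell x r, -((c a : ℂ) * (G₁ x a * G a y)) := by
      symm
      refine Finset.sum_subset Finset.inter_subset_right fun a ha ha' => ?_
      have : a ∉ siteBall x r := fun hb => ha' (Finset.mem_inter.2 ⟨hb, ha⟩)
      simp [hc, this]
    rw [e1, e2]
    refine Finset.sum_congr rfl fun a ha => ?_
    simp only [hc, (Finset.mem_inter.1 ha).1, if_true]
    push_cast
    ring
  have h2 : G x y = bdryTerm x r (fun a => G₁ x a) (fun a => G a y) +
      ∑ a ∈ shell x r, (c a : ℂ) * (G₁ x a * G a y) := by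
    rw [h1] at h0
    linear_combination h0
  rw [h2]
  refine enorm_bdryTerm_add_rpow_le x r _ _ c (fun a => ?_) hs hs1
  simp only [hc]
  split_ifs
  · rw [abs_sub_comm]
    exact hK a
  · simpa using (abs_nonneg _).trans (hK a)

/-- The potentials may differ arbitrarily inside the ball. The resolvent identity `hres` produces
`G₂ x' y` and a sum over all of `siteBall x (r + 1)`; Green's identity on `siteBall x r` cancels `G₂
x' y` and replaces the part of the sum over the smaller ball by a boundary term. Only contributions
from the shell survive. -/
theorem IsGreen.rpow_le_of_outer {d : ℕ} {Ω : Set (Site d)} {v v₂ : Site d → ℝ} {z : ℂ}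
    {G G₂ : Site d → Site d → ℂ} (h : IsGreen Ω v z G) (h₂ : IsGreen Ω v₂ z G₂)
    {x x' y : Site d} {r : ℕ} (hΩ : ↑(siteBall x r) ⊆ Ω)
    (hx : x' ∈ siteBall x r) (hy : y ∉ siteBall x r) {K : ℝ} (hK : ∀ a, |v a - v₂ a| ≤ K)
    (hres : G x' y = G₂ x' y +
      ∑ a ∈ siteBall x (r + 1), G x' a * ((v₂ a - v a : ℝ) : ℂ) * G₂ a y)
    {s : ℝ} (hs : 0 < s) (hs1 : s ≤ 1) :
    ‖G x' y‖ₑ ^ s ≤ (2 + ENNReal.ofReal K) ^ s *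
      ∑ p ∈ shellPairs x r, ‖G x' p.1‖ₑ ^ s * ‖G₂ p.2 y‖ₑ ^ s := by
  classical
  have h0 := h₂.sum_siteBall h hΩ hΩ hx hy
  set c : Site d → ℝ := fun a => if a ∈ siteBall x r then 0 else v₂ a - v a with hc
  have hsub : siteBall x r ⊆ siteBall x (r + 1) := fun a ha => by
    rw [mem_siteBall] at ha ⊢
    omega
  have h1 : ∑ a ∈ siteBall x (r + 1), G x' a * ((v₂ a - v a : ℝ) : ℂ) * G₂ a y =
      ∑ a ∈ siteBall x r, ((v₂ a - v a : ℝ) : ℂ) * (G x' a * G₂ a y) +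
        ∑ a ∈ shell x r, (c a : ℂ) * (G x' a * G₂ a y) := by
    rw [← Finset.sum_sdiff hsub, add_comm]
    congr 1
    · exact Finset.sum_congr rfl fun a _ => by ring
    · rw [← Finset.sum_subset (s₁ := siteBall x (r + 1) \ siteBall x r) (s₂ := shell x r)]
      · refine Finset.sum_congr rfl fun a ha => ?_
        simp only [hc, (Finset.mem_sdiff.1 ha).2, if_false]
        ring
      · intro a ha
        simp only [Finset.mem_sdiff, mem_siteBall] at ha
        exact mem_shell.2 ⟨by omega, by omega⟩
      · intro a ha ha'
        have : a ∈ siteBall x r := by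
          by_contra hcon
          exact ha' (Finset.mem_sdiff.2 ⟨mem_siteBall.2 (mem_shell.1 ha).2, hcon⟩)
        simp [hc, this]
  have h2 : G x' y = bdryTerm x r (fun a => G x' a) (fun a => G₂ a y) +
      ∑ a ∈ shell x r, (c a : ℂ) * (G x' a * G₂ a y) := by
    rw [h1] at hres
    linear_combination hres + h0
  rw [h2]
  refine enorm_bdryTerm_add_rpow_le x r _ _ c (fun a => ?_) hs hs1
  simp only [hc]
  split_ifs
  · simpa using (abs_nonneg _).trans (hK a)
  · rw [abs_sub_comm]
    exact hK a

/-! ### Families of Green functions of bounded potentials -/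

/-- The potential `v`, truncated to `[-K, K]`. -/
noncomputable def clampPot {d : ℕ} (K : ℝ) (v : Site d → ℝ) (x : Site d) : ℝ :=
  max (-K) (min K (v x))

theorem abs_clampPot_le {d : ℕ} {K : ℝ} (hK : 0 ≤ K) (v : Site d → ℝ) (x : Site d) :
    |clampPot K v x| ≤ K :=
  abs_le.2 ⟨le_max_left _ _, max_le (by linarith) (min_le_left _ _)⟩

theorem clampPot_eq_self {d : ℕ} {K : ℝ} {v : Site d → ℝ} (h : ∀ x, |v x| ≤ K) :
    clampPot K v = v := by
  funext x
  obtain ⟨h1, h2⟩ := abs_le.1 (h x)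
  simp [clampPot, h1, h2]

theorem abs_clampPot_sub_le {d : ℕ} {K : ℝ} (hK : 0 ≤ K) (v w : Site d → ℝ) (x : Site d) :
    |clampPot K v x - clampPot K w x| ≤ 2 * K := by
  have h1 := abs_le.1 (abs_clampPot_le hK v x)
  have h2 := abs_le.1 (abs_clampPot_le hK w x)
  exact abs_le.2 ⟨by linarith, by linarith⟩

theorem measurable_clampPot {d : ℕ} (K : ℝ) (x : Site d) :
    Measurable fun v : Site d → ℝ => clampPot K v x := by
  unfold clampPot
  fun_prop

/-- The Green functions on `Ω` at energy `z`, for all potentials truncated to `[-K, K]`. -/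
structure GreenFamily {d : ℕ} (Ω : Set (Site d)) (K : ℝ) (z : ℂ)
    (G : (Site d → ℝ) → Site d → Site d → ℂ) : Prop where
  meas : ∀ x y, Measurable fun v => G v x y
  green : ∀ v, IsGreen Ω (clampPot K v) z (G v)
  resolvent : ∀ (v w : Site d → ℝ) (F : Finset (Site d)), (∀ a ∉ F, v a = w a) → ∀ x y,
    G v x y = G w x y +
      ∑ a ∈ F, G v x a * ((clampPot K w a - clampPot K v a : ℝ) : ℂ) * G w a y

/-- On a finite domain the resolvent identity follows from the defining equation. -/
theorem IsGreen.resolvent_of_finite {d : ℕ} {Λ : Finset (Site d)} {v w : Site d → ℝ} {z : ℂ}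
    {G G' : Site d → Site d → ℂ} (h : IsGreen (↑Λ) v z G) (h' : IsGreen (↑Λ) w z G')
    (F : Finset (Site d)) (hF : ∀ a ∉ F, v a = w a) (x y : Site d) :
    G x y = G' x y + ∑ a ∈ F, G x a * ((w a - v a : ℝ) : ℂ) * G' a y := by
  classical
  by_cases hx : x ∈ Λ
  swap
  · have : ∀ a, G x a = 0 := fun a => h.zero x a hx
    simp [this, h'.zero x y hx]
  by_cases hy : y ∈ Λ
  swap
  · have : ∀ a, G' a y = 0 := fun a => by rw [h'.symm, h'.zero y a hy]
    simp [this, h.symm x y, h.zero y x hy]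
  have h0 := sum_hamAt_sub Λ w v z (fun a => G a x) (fun a => G' a y)
  have h1 : ∑ a ∈ Λ, (G a x * hamAt w z (fun a => G' a y) a -
      hamAt v z (fun a => G a x) a * G' a y) = G y x - G' x y := by
    rw [Finset.sum_congr rfl fun a ha => by rw [h'.eq a y ha, h.eq a x ha]]
    simp [Finset.sum_sub_distrib, hx, hy]
  have h2 : (∑ a ∈ Λ, ∑ i : Dir d, if a + unitVec i ∈ Λ then 0 else
      (G a x * G' (a + unitVec i) y - G (a + unitVec i) x * G' a y)) = 0 := by
    refine Finset.sum_eq_zero fun a _ => Finset.sum_eq_zero fun i _ => ?_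
    split_ifs with hi
    · rfl
    · rw [h'.zero _ _ hi, h.zero _ _ hi]
      ring
  rw [h1, h2, sub_zero] at h0
  have h3 : ∑ a ∈ Λ, ((w a - v a : ℝ) : ℂ) * (G a x * G' a y) =
      ∑ a ∈ F, G x a * ((w a - v a : ℝ) : ℂ) * G' a y := by
    rw [← Finset.sum_subset (Finset.inter_subset_left (s₁ := Λ) (s₂ := F)),
      ← Finset.sum_subset (Finset.inter_subset_right (s₁ := Λ) (s₂ := F))]
    · refine Finset.sum_congr rfl fun a _ => ?_
      rw [h.symm a x]
      ring
    · intro a ha ha'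
      have : a ∉ Λ := fun hb => ha' (Finset.mem_inter.2 ⟨hb, ha⟩)
      rw [h'.zero a y this, mul_zero]
    · intro a ha ha'
      have : a ∉ F := fun hb => ha' (Finset.mem_inter.2 ⟨ha, hb⟩)
      rw [hF a this]
      simp
  rw [← h3, ← h0, h.symm x y]
  ring

/-! ### The Schrödinger operator in infinite volume -/

theorem potentialOp_apply {d : ℕ} {v : Site d → ℝ} {K : ℝ} (hK : 0 ≤ K) (hv : ∀ x, |v x| ≤ K)
    (f : ℓ²(Site d, ℂ)) (x : Site d) : potentialOp v f x = v x * f x := by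
  have h : ∃ K : ℝ, 0 ≤ K ∧ ∀ x, |v x| ≤ K := ⟨K, hK, hv⟩
  rw [potentialOp, dif_pos h]
  simp

theorem norm_potentialOp_le {d : ℕ} {v : Site d → ℝ} {K : ℝ} (hK : 0 ≤ K)
    (hv : ∀ x, |v x| ≤ K) : ‖potentialOp v‖ ≤ K := by
  have h : potentialOp v = lp.mapCLM 2 (fun x => (v x : ℂ) • ContinuousLinearMap.id ℂ ℂ) hK
      (fun x => by simpa [norm_smul] using hv x) := by
    ext f x
    rw [potentialOp_apply hK hv]
    simp
  rw [h]
  exact lp.norm_mapCLM_le _ _ _ _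

theorem latShift_apply {d : ℕ} (a : Site d) (f : ℓ²(Site d, ℂ)) (x : Site d) :
    latShift a f x = f (x + a) := rfl

theorem norm_latShift_le {d : ℕ} (a : Site d) : ‖latShift a‖ ≤ 1 :=
  LinearMap.mkContinuous_norm_le _ zero_le_one _

theorem sum_dir {d : ℕ} {M : Type*} [AddCommMonoid M] (F : Site d → M) :
    ∑ i : Dir d, F (unitVec i) = ∑ j : Fin d, (F (Pi.single j 1) + F (-Pi.single j 1)) := by
  rw [Fintype.sum_prod_type]
  refine Finset.sum_congr rfl fun j _ => ?_
  have : (Finset.univ : Finset ℤˣ) = {1, -1} := by decide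
  rw [this, Finset.sum_pair (by decide)]
  simp [unitVec, Pi.single_neg]

theorem negLaplacian_eq {d : ℕ} : negLaplacian d =
    ((2 * d : ℝ) : ℂ) • ContinuousLinearMap.id ℂ _ - ∑ i : Dir d, latShift (unitVec i) := by
  rw [sum_dir (fun a => latShift a), negLaplacian]

theorem coe_lp_sum {d : ℕ} {ι : Type*} (t : Finset ι) (f : ι → ℓ²(Site d, ℂ)) (x : Site d) :
    (∑ i ∈ t, f i : ℓ²(Site d, ℂ)) x = ∑ i ∈ t, f i x := by
  rw [lp.coeFn_sum, Finset.sum_apply]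

theorem ham_apply {d : ℕ} {v : Site d → ℝ} {K : ℝ} (hK : 0 ≤ K) (hv : ∀ x, |v x| ≤ K)
    (f : ℓ²(Site d, ℂ)) (x : Site d) :
    ham v f x = ((2 * d + v x : ℝ) : ℂ) * f x - ∑ i : Dir d, f (x + unitVec i) := by
  have h1 : ham v f = ((2 * d : ℝ) : ℂ) • f - ∑ i : Dir d, latShift (unitVec i) f +
      potentialOp v f := by
    simp [ham, negLaplacian_eq]
  rw [h1, lp.coeFn_add, Pi.add_apply, lp.coeFn_sub, Pi.sub_apply, coe_lp_sum,
    potentialOp_apply hK hv, lp.coeFn_smul, Pi.smul_apply]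
  simp only [latShift_apply, smul_eq_mul]
  push_cast
  ring

theorem ham_sub_smul_apply {d : ℕ} {v : Site d → ℝ} {K : ℝ} (hK : 0 ≤ K)
    (hv : ∀ x, |v x| ≤ K) (z : ℂ) (f : ℓ²(Site d, ℂ)) (x : Site d) :
    (ham v - z • (1 : ℓ²(Site d, ℂ) →L[ℂ] ℓ²(Site d, ℂ))) f x = hamAt v z f x := by
  have h1 : (ham v - z • (1 : ℓ²(Site d, ℂ) →L[ℂ] ℓ²(Site d, ℂ))) f = ham v f - z • f := rfl
  rw [h1, lp.coeFn_sub, Pi.sub_apply, ham_apply hK hv, lp.coeFn_smul, Pi.smul_apply, hamAt,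
    smul_eq_mul]
  ring

theorem norm_ham_le {d : ℕ} {v : Site d → ℝ} {K : ℝ} (hK : 0 ≤ K) (hv : ∀ x, |v x| ≤ K) :
    ‖ham v‖ ≤ 4 * d + K := by
  have h1 : ‖((2 * d : ℝ) : ℂ) • ContinuousLinearMap.id ℂ (ℓ²(Site d, ℂ))‖ ≤ 2 * d := by
    rw [norm_smul]
    have : ‖((2 * d : ℝ) : ℂ)‖ = 2 * d := by
      rw [Complex.norm_real, Real.norm_of_nonneg (by positivity)]
    rw [this]
    exact mul_le_of_le_one_right (by positivity) ContinuousLinearMap.norm_id_le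
  have h2 : ‖∑ i : Dir d, latShift (unitVec i)‖ ≤ 2 * d := by
    refine (norm_sum_le_of_le _ fun i _ => norm_latShift_le (unitVec i)).trans_eq ?_
    simp [mul_comm]
  rw [ham, negLaplacian_eq]
  refine (norm_add_le _ _).trans ?_
  have := norm_sub_le (((2 * d : ℝ) : ℂ) • ContinuousLinearMap.id ℂ (ℓ²(Site d, ℂ)))
    (∑ i : Dir d, latShift (unitVec i))
  linarith [norm_potentialOp_le hK hv]

theorem inner_latShift_left {d : ℕ} (a : Site d) (f g : ℓ²(Site d, ℂ)) :
    inner ℂ (latShift a f) g = inner ℂ f (latShift (-a) g) := by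
  rw [lp.inner_eq_tsum, lp.inner_eq_tsum,
    ← (Equiv.addRight a).tsum_eq fun x => inner ℂ (f x) (latShift (-a) g x)]
  simp [latShift_apply]

theorem inner_ham_left {d : ℕ} {v : Site d → ℝ} {K : ℝ} (hK : 0 ≤ K) (hv : ∀ x, |v x| ≤ K)
    (f g : ℓ²(Site d, ℂ)) : inner ℂ (ham v f) g = inner ℂ f (ham v g) := by
  have hp : inner ℂ (potentialOp v f) g = inner ℂ f (potentialOp v g) := by
    rw [lp.inner_eq_tsum, lp.inner_eq_tsum]
    refine tsum_congr fun x => ?_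
    simp only [potentialOp_apply hK hv, RCLike.inner_apply, map_mul, Complex.conj_ofReal]
    ring
  have h1 : ∀ f : ℓ²(Site d, ℂ), ham v f = ((2 * d : ℝ) : ℂ) • f -
      ∑ i : Dir d, latShift (unitVec i) f + potentialOp v f := fun f => by
    simp [ham, negLaplacian_eq]
  have h2 : ∑ i : Dir d, inner ℂ f (latShift (-unitVec i) g) =
      ∑ i : Dir d, inner ℂ f (latShift (unitVec i) g) := by
    rw [sum_dir fun a => inner ℂ f (latShift (-a) g), sum_dir fun a => inner ℂ f (latShift a g)]
    exact Finset.sum_congr rfl fun j _ => by rw [neg_neg, add_comm]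
  rw [h1, h1, inner_add_left, inner_add_right, inner_sub_left, inner_sub_right, hp,
    inner_smul_left, inner_smul_right, sum_inner, inner_sum, Complex.conj_ofReal]
  simp only [inner_latShift_left]
  rw [h2]

theorem isSelfAdjoint_ham {d : ℕ} {v : Site d → ℝ} {K : ℝ} (hK : 0 ≤ K) (hv : ∀ x, |v x| ≤ K) :
    IsSelfAdjoint (ham v) :=
  ContinuousLinearMap.isSelfAdjoint_iff_isSymmetric.2 fun f g => inner_ham_left hK hv f g

theorem isUnit_ham_sub {d : ℕ} {v : Site d → ℝ} {K : ℝ} (hK : 0 ≤ K) (hv : ∀ x, |v x| ≤ K)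
    {z : ℂ} (hz : z.im ≠ 0) :
    IsUnit (ham v - z • (1 : ℓ²(Site d, ℂ) →L[ℂ] ℓ²(Site d, ℂ))) := by
  have h : z ∉ spectrum ℂ (ham v) := fun hmem => hz <| by
    rw [(isSelfAdjoint_ham hK hv).mem_spectrum_eq_re hmem]
    simp
  rw [spectrum.notMem_iff] at h
  rw [← IsUnit.neg_iff, neg_sub]
  simpa [Algebra.algebraMap_eq_smul_one] using h

theorem green_eq_apply {d : ℕ} (v : Site d → ℝ) (z : ℂ) (x y : Site d) :
    green v z x y = resolventOp v z (lp.single 2 y (1 : ℂ)) x := by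
  rw [green, lp.inner_single_left]
  simp

theorem ham_sub_resolventOp {d : ℕ} {v : Site d → ℝ} {K : ℝ} (hK : 0 ≤ K)
    (hv : ∀ x, |v x| ≤ K) {z : ℂ} (hz : z.im ≠ 0) (f : ℓ²(Site d, ℂ)) :
    (ham v - z • (1 : ℓ²(Site d, ℂ) →L[ℂ] ℓ²(Site d, ℂ))) (resolventOp v z f) = f := by
  have := Ring.mul_inverse_cancel _ (isUnit_ham_sub hK hv hz)
  exact DFunLike.congr_fun this f

theorem resolventOp_ham_sub {d : ℕ} {v : Site d → ℝ} {K : ℝ} (hK : 0 ≤ K)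
    (hv : ∀ x, |v x| ≤ K) {z : ℂ} (hz : z.im ≠ 0) (f : ℓ²(Site d, ℂ)) :
    resolventOp v z ((ham v - z • (1 : ℓ²(Site d, ℂ) →L[ℂ] ℓ²(Site d, ℂ))) f) = f := by
  have := Ring.inverse_mul_cancel _ (isUnit_ham_sub hK hv hz)
  exact DFunLike.congr_fun this f

theorem star_ham {d : ℕ} {v : Site d → ℝ} {K : ℝ} (hK : 0 ≤ K) (hv : ∀ x, |v x| ≤ K)
    (f : ℓ²(Site d, ℂ)) : ham v (star f) = star (ham v f) := by
  ext x
  simp only [lp.star_apply, ham_apply hK hv]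
  simp

/-- `H` is self-adjoint and commutes with complex conjugation, so pairing the conjugate of one
resolvent column with the other yields symmetry without conjugation. -/
theorem green_symm {d : ℕ} {v : Site d → ℝ} {K : ℝ} (hK : 0 ≤ K) (hv : ∀ x, |v x| ≤ K)
    {z : ℂ} (hz : z.im ≠ 0) (x y : Site d) : green v z x y = green v z y x := by
  set u : ℓ²(Site d, ℂ) := resolventOp v z (lp.single 2 y (1 : ℂ)) with hu
  set w : ℓ²(Site d, ℂ) := resolventOp v z (lp.single 2 x (1 : ℂ)) with hw
  have hu' : ham v u = lp.single 2 y (1 : ℂ) + z • u := by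
    have := ham_sub_resolventOp hK hv hz (lp.single 2 y (1 : ℂ))
    rw [← hu] at this
    rw [← this]
    simp
  have hw' : ham v w = lp.single 2 x (1 : ℂ) + z • w := by
    have := ham_sub_resolventOp hK hv hz (lp.single 2 x (1 : ℂ))
    rw [← hw] at this
    rw [← this]
    simp
  have h0 := inner_ham_left hK hv (star w) u
  have hs : star (lp.single 2 x (1 : ℂ) : ℓ²(Site d, ℂ)) = lp.single 2 x (1 : ℂ) := by
    ext a
    rw [lp.star_apply]
    by_cases h : a = x
    · subst h
      simp
    · simp [h]
  rw [star_ham hK hv, hw', hu', star_add, star_smul, hs, inner_add_left, inner_add_right,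
    inner_smul_left, inner_smul_right, lp.inner_single_left, lp.inner_single_right,
    lp.star_apply] at h0
  rw [green_eq_apply, green_eq_apply, ← hu, ← hw]
  simp only [RCLike.inner_apply, map_one, mul_one, one_mul, starRingEnd_apply, star_star] at h0
  linear_combination h0

theorem isGreen_green {d : ℕ} {v : Site d → ℝ} {K : ℝ} (hK : 0 ≤ K) (hv : ∀ x, |v x| ≤ K)
    {z : ℂ} (hz : z.im ≠ 0) : IsGreen Set.univ v z (green v z) where
  zero x y hx := absurd (Set.mem_univ x) hx
  symm x y := green_symm hK hv hz x y
  eq x y _ := by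
    have h := ham_sub_resolventOp hK hv hz (lp.single 2 y (1 : ℂ))
    have h1 := ham_sub_smul_apply hK hv z (resolventOp v z (lp.single 2 y (1 : ℂ))) x
    rw [h] at h1
    have h2 : (fun a => green v z a y) = resolventOp v z (lp.single 2 y (1 : ℂ)) :=
      funext fun a => green_eq_apply v z a y
    rw [h2, ← h1]
    by_cases hxy : x = y
    · subst hxy
      simp
    · simp [hxy]

/-- The two operators differ by a finitely supported multiplication. Apply the resolvent for `v` to
the column of the resolvent for `w` after `H_w - z` is rewritten in terms of `H_v - z`. -/
theorem green_resolvent {d : ℕ} {v w : Site d → ℝ} {K : ℝ} (hK : 0 ≤ K) (hv : ∀ x, |v x| ≤ K)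
    (hw : ∀ x, |w x| ≤ K) {z : ℂ} (hz : z.im ≠ 0) (F : Finset (Site d))
    (hF : ∀ a ∉ F, v a = w a) (x y : Site d) :
    green v z x y = green w z x y +
      ∑ a ∈ F, green v z x a * ((w a - v a : ℝ) : ℂ) * green w z a y := by
  set u : ℓ²(Site d, ℂ) := resolventOp w z (lp.single 2 y (1 : ℂ)) with hu
  have h1 : (ham w - z • (1 : ℓ²(Site d, ℂ) →L[ℂ] ℓ²(Site d, ℂ))) u =
      (ham v - z • (1 : ℓ²(Site d, ℂ) →L[ℂ] ℓ²(Site d, ℂ))) u +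
        ∑ a ∈ F, (((w a - v a : ℝ) : ℂ) * u a) • (lp.single 2 a (1 : ℂ) : ℓ²(Site d, ℂ)) := by
    ext b
    rw [lp.coeFn_add, Pi.add_apply, ham_sub_smul_apply hK hw, ham_sub_smul_apply hK hv,
      coe_lp_sum]
    have h2 : ∑ a ∈ F, ((((w a - v a : ℝ) : ℂ) * u a) •
        (lp.single 2 a (1 : ℂ) : ℓ²(Site d, ℂ))) b = ((w b - v b : ℝ) : ℂ) * u b := by
      by_cases hb : b ∈ F
      · rw [Finset.sum_eq_single b]
        · simp
        · intro a _ hab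
          simp [Ne.symm hab]
        · exact fun h => absurd hb h
      · rw [Finset.sum_eq_zero, hF b hb]
        · simp
        · intro a ha
          have : b ≠ a := fun h => hb (h ▸ ha)
          simp [this]
    rw [h2]
    simp only [hamAt]
    push_cast
    ring
  have h3 := congrArg (resolventOp v z) h1
  rw [map_add, resolventOp_ham_sub hK hv hz, hu, ham_sub_resolventOp hK hw hz, map_sum] at h3
  rw [green_eq_apply v z x y, h3, lp.coeFn_add, Pi.add_apply, coe_lp_sum, ← green_eq_apply]
  congr 1
  refine Finset.sum_congr rfl fun a _ => ?_
  rw [map_smul, lp.coeFn_smul, Pi.smul_apply, ← green_eq_apply, ← green_eq_apply, smul_eq_mul]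
  ring

/-! ### Decay and measurability of the Green function off the real axis -/

/-- The cross term is proportional to the imaginary part of `⟨g, f⟩`, which vanishes. For `g = (H -
E) f` this gives both the resolvent bound `1/|t|` and a sharp bound on `‖H - E + iτ‖`. -/
theorem norm_sub_smul_I_sq {V : Type*} [NormedAddCommGroup V] [InnerProductSpace ℂ V] {f g : V}
    (h : inner ℂ g f = inner ℂ f g) (t : ℝ) :
    ‖g - (t * Complex.I : ℂ) • f‖ ^ 2 = ‖g‖ ^ 2 + t ^ 2 * ‖f‖ ^ 2 := by
  have h1 : (inner ℂ g f : ℂ).im = 0 := by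
    have h2 := congrArg Complex.im (inner_conj_symm (𝕜 := ℂ) g f)
    rw [Complex.conj_im, ← h] at h2
    linarith
  rw [norm_sub_sq (𝕜 := ℂ), inner_smul_right, norm_smul, mul_pow]
  simp [h1]

theorem norm_ham_sub_smul_sq {d : ℕ} {v : Site d → ℝ} {K : ℝ} (hK : 0 ≤ K)
    (hv : ∀ x, |v x| ≤ K) (E t : ℝ) (f : ℓ²(Site d, ℂ)) :
    ‖(ham v - (E + t * Complex.I : ℂ) • (1 : ℓ²(Site d, ℂ) →L[ℂ] ℓ²(Site d, ℂ))) f‖ ^ 2 =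
      ‖ham v f - (E : ℂ) • f‖ ^ 2 + t ^ 2 * ‖f‖ ^ 2 := by
  rw [← norm_sub_smul_I_sq]
  · have h1 : (ham v - (E + t * Complex.I : ℂ) • (1 : ℓ²(Site d, ℂ) →L[ℂ] ℓ²(Site d, ℂ))) f =
        ham v f - (E + t * Complex.I : ℂ) • f := rfl
    rw [h1, add_smul, sub_sub]
  · rw [inner_sub_left, inner_sub_right, inner_ham_left hK hv, inner_smul_left,
      inner_smul_right, Complex.conj_ofReal]

theorem norm_resolventOp_le {d : ℕ} {v : Site d → ℝ} {K : ℝ} (hK : 0 ≤ K)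
    (hv : ∀ x, |v x| ≤ K) (E : ℝ) {t : ℝ} (ht : t ≠ 0) (f : ℓ²(Site d, ℂ)) :
    ‖resolventOp v (E + t * Complex.I) f‖ ≤ |t|⁻¹ * ‖f‖ := by
  set u : ℓ²(Site d, ℂ) := resolventOp v (E + t * Complex.I) f with hu
  have h1 := norm_ham_sub_smul_sq hK hv E t u
  rw [hu, ham_sub_resolventOp hK hv (by simpa using ht), ← hu] at h1
  have h2 : (|t| * ‖u‖) ^ 2 ≤ ‖f‖ ^ 2 := by
    rw [mul_pow, sq_abs, h1]
    nlinarith [sq_nonneg ‖ham v u - (E : ℂ) • u‖]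
  have h3 : |t| * ‖u‖ ≤ ‖f‖ := le_of_sq_le_sq h2 (norm_nonneg _)
  rw [inv_mul_eq_div, le_div_iff₀ (abs_pos.2 ht)]
  linarith

/-- The matrix elements of the powers of `-Δ + v - z` applied to the unit vector at `y`. -/
noncomputable def hamIter {d : ℕ} (v : Site d → ℝ) (z : ℂ) (y : Site d) : ℕ → Site d → ℂ
  | 0 => fun x => if x = y then 1 else 0
  | k + 1 => fun x => hamAt v z (hamIter v z y k) x

theorem hamIter_eq_zero {d : ℕ} (v : Site d → ℝ) (z : ℂ) (y : Site d) (k : ℕ) (x : Site d)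
    (h : k < siteNorm (x - y)) : hamIter v z y k x = 0 := by
  induction k generalizing x with
  | zero =>
    have : x ≠ y := fun hxy => by simp [hxy, siteNorm_zero] at h
    simp [hamIter, this]
  | succ k ih =>
    simp only [hamIter, hamAt]
    rw [ih x (by omega), Finset.sum_eq_zero]
    · simp
    · intro i _
      refine ih _ ?_
      have := siteNorm_sub_le x (x + unitVec i) y
      rw [sub_add_cancel_left, siteNorm_neg, siteNorm_unitVec] at this
      omega

theorem measurable_hamIter {d : ℕ} (K : ℝ) (z : ℂ) (y : Site d) (k : ℕ) (x : Site d) :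
    Measurable fun v : Site d → ℝ => hamIter (clampPot K v) z y k x := by
  induction k generalizing x with
  | zero =>
    simp only [hamIter]
    exact measurable_const
  | succ k ih =>
    simp only [hamIter, hamAt]
    have := measurable_clampPot K x
    have h2 := ih x
    refine Measurable.sub (Measurable.mul ?_ h2) (Finset.measurable_sum _ fun i _ => ih _)
    fun_prop

theorem pow_ham_sub_apply {d : ℕ} {v : Site d → ℝ} {K : ℝ} (hK : 0 ≤ K)
    (hv : ∀ x, |v x| ≤ K) (z : ℂ) (y : Site d) (k : ℕ) :
    (((ham v - z • (1 : ℓ²(Site d, ℂ) →L[ℂ] ℓ²(Site d, ℂ))) ^ k) (lp.single 2 y (1 : ℂ)) :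
      Site d → ℂ) = hamIter v z y k := by
  induction k with
  | zero =>
    funext x
    by_cases h : x = y
    · subst h
      simp [hamIter]
    · simp [hamIter, h]
  | succ k ih =>
    funext x
    rw [pow_succ', mul_apply_eq_comp, ham_sub_smul_apply hK hv, ih]
    rfl

/-- The truncated Neumann series of the resolvent at `E + i t` around `E - i τ`. -/
theorem norm_green_add_sum_le {d : ℕ} {v : Site d → ℝ} {K : ℝ} (hK : 0 ≤ K)
    (hv : ∀ x, |v x| ≤ K) {E t τ R : ℝ} (ht : t ≠ 0) (htτ : 0 ≤ t * τ)
    (hR : 4 * d + K + |E| ≤ R) (x y : Site d) (n : ℕ) :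
    ‖green v (E + t * Complex.I) x y + ∑ k ∈ Finset.range n,
        (((t + τ : ℝ) : ℂ) * Complex.I)⁻¹ ^ (k + 1) *
          hamIter v (E - τ * Complex.I) y k x‖ ≤
      |t|⁻¹ * (Real.sqrt (R ^ 2 + τ ^ 2) / (|t| + |τ|)) ^ n := by
  -- With `X = H - E + iτ` one has `H - z = X - c`, so the resolvent satisfies `R X = 1 + c R`.
  -- Iterating this `n` times leaves the remainder `c⁻ⁿ R Xⁿ`. As `t` and `τ` have the same sign,
  -- `|c| = |t| + |τ|`.
  set c : ℂ := ((t + τ : ℝ) : ℂ) * Complex.I with hc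
  set z : ℂ := E + t * Complex.I with hz
  set X := ham v - (E - τ * Complex.I : ℂ) • (1 : ℓ²(Site d, ℂ) →L[ℂ] ℓ²(Site d, ℂ)) with hX
  set δ : ℓ²(Site d, ℂ) := lp.single 2 y (1 : ℂ) with hδ
  have hnc : ‖c‖ = |t| + |τ| := by
    rw [hc, norm_mul, Complex.norm_I, mul_one, Complex.norm_real, Real.norm_eq_abs]
    rcases mul_nonneg_iff.1 htτ with ⟨h1, h2⟩ | ⟨h1, h2⟩
    · rw [abs_of_nonneg h1, abs_of_nonneg h2, abs_of_nonneg (by linarith)]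
    · rw [abs_of_nonpos h1, abs_of_nonpos h2, abs_of_nonpos (by linarith)]
      ring
  have hc0 : c ≠ 0 := by
    rw [← norm_ne_zero_iff, hnc]
    have := abs_pos.2 ht
    positivity
  have hzim : z.im ≠ 0 := by simpa [hz] using ht
  have hXc : ∀ f, resolventOp v z (X f) = f + c • resolventOp v z f := by
    intro f
    have h1 : X f = (ham v - z • (1 : ℓ²(Site d, ℂ) →L[ℂ] ℓ²(Site d, ℂ))) f + c • f := by
      simp only [hX, hz, hc, sub_apply, smul_apply,
        one_apply_eq_self]
      push_cast
      module
    rw [h1, map_add, resolventOp_ham_sub hK hv hzim, map_smul]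
  have hexp : ∀ n, resolventOp v z δ + ∑ k ∈ Finset.range n, c⁻¹ ^ (k + 1) • (X ^ k) δ =
      c⁻¹ ^ n • resolventOp v z ((X ^ n) δ) := by
    intro n
    induction n with
    | zero => simp
    | succ n ih =>
      rw [Finset.sum_range_succ, ← add_assoc, ih, pow_succ' X, mul_apply_eq_comp,
        hXc, smul_add, smul_smul, pow_succ, mul_assoc, inv_mul_cancel₀ hc0, mul_one, add_comm]
  have hXn : ∀ f, ‖X f‖ ≤ Real.sqrt (R ^ 2 + τ ^ 2) * ‖f‖ := by
    intro f
    have h1 := norm_ham_sub_smul_sq hK hv E (-τ) f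
    have h2 : (E + ((-τ : ℝ) : ℂ) * Complex.I : ℂ) = E - τ * Complex.I := by
      push_cast
      ring
    rw [h2, ← hX] at h1
    have h3 : ‖ham v f - (E : ℂ) • f‖ ≤ R * ‖f‖ := by
      calc _ ≤ ‖ham v f‖ + ‖(E : ℂ) • f‖ := norm_sub_le _ _
        _ ≤ (4 * d + K) * ‖f‖ + |E| * ‖f‖ := by
          refine add_le_add ((ham v).le_of_opNorm_le (norm_ham_le hK hv) f) ?_
          rw [norm_smul, Complex.norm_real, Real.norm_eq_abs]
        _ ≤ R * ‖f‖ := by nlinarith [norm_nonneg f]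
    have h4 : ‖X f‖ ^ 2 ≤ (Real.sqrt (R ^ 2 + τ ^ 2) * ‖f‖) ^ 2 := by
      rw [mul_pow, Real.sq_sqrt (by positivity), h1]
      nlinarith [pow_le_pow_left₀ (norm_nonneg _) h3 2]
    exact le_of_sq_le_sq h4 (by positivity)
  have hXpow : ∀ n, ‖(X ^ n) δ‖ ≤ Real.sqrt (R ^ 2 + τ ^ 2) ^ n := by
    intro n
    induction n with
    | zero => simp [hδ, lp.norm_single]
    | succ n ih =>
      rw [pow_succ' X, mul_apply_eq_comp, pow_succ']
      exact (hXn _).trans (by gcongr)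
  have hval : green v z x y + ∑ k ∈ Finset.range n,
      c⁻¹ ^ (k + 1) * hamIter v (E - τ * Complex.I) y k x =
        (c⁻¹ ^ n • resolventOp v z ((X ^ n) δ) : ℓ²(Site d, ℂ)) x := by
    rw [← hexp n, lp.coeFn_add, Pi.add_apply, coe_lp_sum, green_eq_apply]
    congr 1
    refine Finset.sum_congr rfl fun k _ => ?_
    rw [lp.coeFn_smul, Pi.smul_apply, smul_eq_mul, hX, hδ, pow_ham_sub_apply hK hv]
  rw [hval]
  refine (lp.norm_apply_le_norm (by norm_num) _ x).trans ?_
  rw [norm_smul, norm_pow, norm_inv, hnc, div_pow, hz]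
  calc _ ≤ (|t| + |τ|)⁻¹ ^ n * (|t|⁻¹ * Real.sqrt (R ^ 2 + τ ^ 2) ^ n) := by
        gcongr
        exact (norm_resolventOp_le hK hv E ht _).trans (by gcongr; exact hXpow n)
    _ = _ := by
        rw [inv_pow]
        field_simp

/-- The decay rate in the Combes–Thomas type estimate. -/
noncomputable def ctRate (R δ : ℝ) : ℝ :=
  Real.sqrt (R ^ 2 + (R ^ 2 / δ) ^ 2) / (δ + R ^ 2 / δ)

theorem ctRate_nonneg {R δ : ℝ} (hδ : 0 < δ) : 0 ≤ ctRate R δ := by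
  unfold ctRate
  positivity

/-- The shift `τ = R² / δ` makes `(δ + τ)² - (R² + τ²) = δ² + R²`, which is positive: moving the
expansion point far to the other side of the real axis makes the series converge. -/
theorem ctRate_lt_one {R δ : ℝ} (hδ : 0 < δ) : ctRate R δ < 1 := by
  unfold ctRate
  rw [div_lt_one (by positivity), Real.sqrt_lt' (by positivity)]
  have h : (δ + R ^ 2 / δ) ^ 2 = δ ^ 2 + 2 * R ^ 2 + (R ^ 2 / δ) ^ 2 := by
    field_simp
    ring
  rw [h]
  nlinarith [sq_nonneg R, sq_pos_of_pos hδ]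

theorem norm_green_add_sum_le_ctRate {d : ℕ} {v : Site d → ℝ} {K : ℝ} (hK : 0 ≤ K)
    (hv : ∀ x, |v x| ≤ K) {E t δ R : ℝ} (hδ : 0 < δ) (ht : δ ≤ |t|)
    (hR : 4 * d + K + |E| ≤ R) (x y : Site d) (n : ℕ) :
    ‖green v (E + t * Complex.I) x y + ∑ k ∈ Finset.range n,
        (((t + SignType.sign t * (R ^ 2 / δ) : ℝ) : ℂ) * Complex.I)⁻¹ ^ (k + 1) *
          hamIter v (E - (SignType.sign t * (R ^ 2 / δ) : ℝ) * Complex.I) y k x‖ ≤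
      δ⁻¹ * ctRate R δ ^ n := by
  have ht0 : t ≠ 0 := abs_pos.1 (hδ.trans_le ht)
  have h1 : 0 ≤ t * (SignType.sign t * (R ^ 2 / δ)) := by
    rw [← mul_assoc, self_mul_sign]
    positivity
  have h2 : |(SignType.sign t : ℝ) * (R ^ 2 / δ)| = R ^ 2 / δ := by
    have h3 : 0 ≤ R ^ 2 / δ := by positivity
    rcases lt_or_gt_of_ne ht0 with h | h
    · simpa [sign_neg h] using h3
    · simpa [sign_pos h] using h3
  refine (norm_green_add_sum_le hK hv ht0 h1 hR x y n).trans ?_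
  rw [← sq_abs (_ * _), h2]
  unfold ctRate
  gcongr

/-- Powers of `H - E + iτ` below `siteNorm (x - y)` have no matrix element between `x` and `y`, so
stopping the series at that order leaves only the remainder. -/
theorem norm_green_le {d : ℕ} {v : Site d → ℝ} {K : ℝ} (hK : 0 ≤ K)
    (hv : ∀ x, |v x| ≤ K) {E t δ R : ℝ} (hδ : 0 < δ) (ht : δ ≤ |t|)
    (hR : 4 * d + K + |E| ≤ R) (x y : Site d) :
    ‖green v (E + t * Complex.I) x y‖ ≤ δ⁻¹ * ctRate R δ ^ siteNorm (x - y) := by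
  have h := norm_green_add_sum_le_ctRate hK hv hδ ht hR x y (siteNorm (x - y))
  rwa [Finset.sum_eq_zero, add_zero] at h
  intro k hk
  rw [hamIter_eq_zero _ _ _ _ _ (Finset.mem_range.1 hk), mul_zero]

/-- The partial sums of the same Neumann series are polynomials in finitely many values of the
truncated potential, and they converge pointwise. -/
theorem measurable_green {d : ℕ} {K : ℝ} (hK : 0 ≤ K) {z : ℂ} (hz : z.im ≠ 0) (x y : Site d) :
    Measurable fun v : Site d → ℝ => green (clampPot K v) z x y := by
  have hz' : z = (z.re : ℂ) + z.im * Complex.I := (Complex.re_add_im z).symm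
  have hδ : 0 < |z.im| := abs_pos.2 hz
  set R : ℝ := 4 * d + K + |z.re|
  refine measurable_of_tendsto_metrizable (f := fun n (v : Site d → ℝ) =>
    -∑ k ∈ Finset.range n,
        (((z.im + SignType.sign z.im * (R ^ 2 / |z.im|) : ℝ) : ℂ) * Complex.I)⁻¹ ^ (k + 1) *
          hamIter (clampPot K v) (z.re - (SignType.sign z.im * (R ^ 2 / |z.im|) : ℝ) *
            Complex.I) y k x) (fun n => ?_) ?_
  · refine (Finset.measurable_sum _ fun k _ => ?_).neg
    exact (measurable_hamIter K _ y k x).const_mul _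
  · rw [tendsto_pi_nhds]
    intro v
    rw [tendsto_iff_norm_sub_tendsto_zero]
    refine squeeze_zero (fun _ => norm_nonneg _) (fun n => ?_)
      (g := fun n => |z.im|⁻¹ * ctRate R |z.im| ^ n) ?_
    · have h := norm_green_add_sum_le_ctRate hK (abs_clampPot_le hK v) hδ le_rfl
        (le_refl R) x y n
      rw [← hz'] at h
      rw [norm_sub_rev, sub_neg_eq_add]
      exact h
    · have := (tendsto_pow_atTop_nhds_zero_of_lt_one (ctRate_nonneg (R := R) hδ)
        (ctRate_lt_one hδ)).const_mul |z.im|⁻¹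
      simpa using this

theorem greenFamily_green {d : ℕ} {K : ℝ} (hK : 0 ≤ K) {z : ℂ} (hz : z.im ≠ 0) :
    GreenFamily (d := d) Set.univ K z fun v => green (clampPot K v) z where
  meas x y := measurable_green hK hz x y
  green v := isGreen_green hK (abs_clampPot_le hK v) hz
  resolvent v w F hF x y :=
    green_resolvent hK (abs_clampPot_le hK v) (abs_clampPot_le hK w) hz F
      (fun a ha => by simp [clampPot, hF a ha]) x y

/-! ### Finite volume Green functions -/

/-- The matrix `H_Λ - z`. -/
noncomputable def finHamSub {d : ℕ} (Λ : Finset (Site d)) (v : Site d → ℝ) (z : ℂ) :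
    Matrix Λ Λ ℂ :=
  open Classical in finHam Λ v - z • (1 : Matrix Λ Λ ℂ)

theorem hamEntry_symm {d : ℕ} (v : Site d → ℝ) (x y : Site d) :
    hamEntry v x y = hamEntry v y x := by
  unfold hamEntry
  simp only [latNorm_eq_siteNorm, siteNorm_sub_comm x y, eq_comm (a := x)]
  split_ifs with h
  · rw [h]
  · rfl
  · rfl

theorem conj_hamEntry {d : ℕ} (v : Site d → ℝ) (x y : Site d) :
    starRingEnd ℂ (hamEntry v x y) = hamEntry v x y := by
  unfold hamEntry
  split_ifs
  · exact Complex.conj_ofReal _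
  · simp
  · simp

theorem sum_hamEntry_mul {d : ℕ} (Λ : Finset (Site d)) (v : Site d → ℝ) (u : Site d → ℂ)
    (hu : ∀ a ∉ Λ, u a = 0) {x : Site d} (hx : x ∈ Λ) :
    ∑ y ∈ Λ, hamEntry v x y * u y =
      ((2 * d + v x : ℝ) : ℂ) * u x - ∑ i : Dir d, u (x + unitVec i) := by
  classical
  have h1 : ∀ y, hamEntry v x y * u y =
      (if x = y then ((2 * d + v x : ℝ) : ℂ) * u y else 0) -
        if siteNorm (y - x) = 1 then u y else 0 := by
    intro y
    unfold hamEntry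
    simp only [latNorm_eq_siteNorm, siteNorm_sub_comm x y, Nat.cast_eq_one]
    by_cases hxy : x = y
    · subst hxy
      simp [siteNorm_zero]
    · by_cases h : siteNorm (y - x) = 1 <;> simp [hxy, h]
  have h2 : ∑ i : Dir d, u (x + unitVec i) =
      ∑ y ∈ Λ, if siteNorm (y - x) = 1 then u y else 0 := by
    rw [← Finset.sum_filter, ← Finset.sum_image (s := (Finset.univ : Finset (Dir d)))
      (g := fun i => x + unitVec i) (f := u)
      fun i _ j _ h => unitVec_injective (add_left_cancel h)]
    symm
    refine Finset.sum_subset ?_ ?_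
    · intro y hy
      obtain ⟨i, hi⟩ := exists_unitVec_of_siteNorm_eq_one (Finset.mem_filter.1 hy).2
      exact Finset.mem_image.2 ⟨i, Finset.mem_univ _, by simp [← hi]⟩
    · intro y hy hy'
      obtain ⟨i, -, rfl⟩ := Finset.mem_image.1 hy
      refine hu _ fun hmem => hy' ?_
      simp [hmem, siteNorm_unitVec]
  rw [Finset.sum_congr rfl fun y _ => h1 y, Finset.sum_sub_distrib, ← h2]
  simp [hx]

theorem sum_finHamSub_mul {d : ℕ} (Λ : Finset (Site d)) (v : Site d → ℝ) (z : ℂ)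
    (u : Site d → ℂ) (hu : ∀ a ∉ Λ, u a = 0) (x : Λ) :
    ∑ y : Λ, finHamSub Λ v z x y * u y = hamAt v z u x := by
  classical
  have h1 := sum_hamEntry_mul Λ v u hu x.2
  rw [← Finset.sum_coe_sort] at h1
  have h2 : ∀ y : Λ, finHamSub Λ v z x y * u y =
      hamEntry v x y * u y - if x = y then z * u y else 0 := by
    intro y
    simp only [finHamSub, finHam, Matrix.sub_apply, Matrix.of_apply, Matrix.smul_apply,
      Matrix.one_apply, smul_eq_mul]
    split_ifs <;> ring
  rw [Finset.sum_congr rfl fun y _ => h2 y, Finset.sum_sub_distrib, h1]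
  simp only [Finset.sum_ite_eq, Finset.mem_univ, if_true, hamAt]
  ring

theorem finHamSub_transpose {d : ℕ} (Λ : Finset (Site d)) (v : Site d → ℝ) (z : ℂ) :
    (finHamSub Λ v z).transpose = finHamSub Λ v z := by
  classical
  ext x y
  simp [finHamSub, finHam, hamEntry_symm v y x, Matrix.one_apply, eq_comm]

theorem finGreen_of_mem {d : ℕ} {Λ : Finset (Site d)} (v : Site d → ℝ) (z : ℂ) {x y : Site d}
    (hx : x ∈ Λ) (hy : y ∈ Λ) :
    finGreen Λ v z x y = (open Classical in (finHamSub Λ v z)⁻¹ ⟨x, hx⟩ ⟨y, hy⟩) := by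
  rw [finGreen, dif_pos ⟨hx, hy⟩]
  rfl

theorem finGreen_of_notMem_left {d : ℕ} {Λ : Finset (Site d)} (v : Site d → ℝ) (z : ℂ)
    {x y : Site d} (hx : x ∉ Λ) : finGreen Λ v z x y = 0 := by
  rw [finGreen, dif_neg fun h => hx h.1]

theorem finGreen_of_notMem_right {d : ℕ} {Λ : Finset (Site d)} (v : Site d → ℝ) (z : ℂ)
    {x y : Site d} (hy : y ∉ Λ) : finGreen Λ v z x y = 0 := by
  rw [finGreen, dif_neg fun h => hy h.2]

open Classical in
theorem isGreen_finGreen {d : ℕ} {Λ : Finset (Site d)} {v : Site d → ℝ} {z : ℂ}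
    (h : (finHamSub Λ v z).det ≠ 0) : IsGreen (↑Λ) v z (finGreen Λ v z) where
  zero x y hx := finGreen_of_notMem_left v z hx
  symm x y := by
    by_cases hx : x ∈ Λ
    swap
    · rw [finGreen_of_notMem_left v z hx, finGreen_of_notMem_right v z hx]
    by_cases hy : y ∈ Λ
    swap
    · rw [finGreen_of_notMem_left v z hy, finGreen_of_notMem_right v z hy]
    rw [finGreen_of_mem v z hx hy, finGreen_of_mem v z hy hx]
    conv_lhs => rw [← finHamSub_transpose, ← Matrix.transpose_nonsing_inv]
    rfl
  eq x y hx := by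
    by_cases hy : y ∈ Λ
    swap
    · have h1 : (fun a => finGreen Λ v z a y) = fun _ => 0 :=
        funext fun a => finGreen_of_notMem_right v z hy
      have h2 : x ≠ y := fun hxy => hy (hxy ▸ hx)
      rw [h1, if_neg h2]
      simp [hamAt]
    rw [← sum_finHamSub_mul Λ v z (fun a => finGreen Λ v z a y)
      (fun a ha => finGreen_of_notMem_left v z ha) ⟨x, hx⟩]
    have h1 : ∀ a : Λ, finGreen Λ v z a y = (finHamSub Λ v z)⁻¹ a ⟨y, hy⟩ :=
      fun a => finGreen_of_mem v z a.2 hy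
    simp only [h1]
    rw [← Matrix.mul_apply, Matrix.mul_nonsing_inv _ h.isUnit, Matrix.one_apply]
    simp

-- The matrix is Hermitian, so for a null vector `ψ` of `H_Λ - z` the form `⟨ψ, H_Λ ψ⟩ = z ‖ψ‖²` is
-- real, which forces `ψ = 0`.
open Classical in
theorem det_finHamSub_ne_zero {d : ℕ} (Λ : Finset (Site d)) (v : Site d → ℝ) {z : ℂ}
    (hz : z.im ≠ 0) : (finHamSub Λ v z).det ≠ 0 := by
  intro h
  obtain ⟨ψ, hψ, h0⟩ := Matrix.exists_mulVec_eq_zero_iff.2 h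
  have h1 : ∀ x : Λ, ∑ y : Λ, hamEntry v x y * ψ y = z * ψ x := by
    intro x
    have h2 := congrFun h0 x
    simp only [Matrix.mulVec, dotProduct, finHamSub, finHam, Matrix.sub_apply, Matrix.of_apply,
      Matrix.smul_apply, Matrix.one_apply, smul_eq_mul, Pi.zero_apply, sub_mul,
      Finset.sum_sub_distrib] at h2
    simpa [sub_eq_zero] using h2
  set Q : ℂ := ∑ x : Λ, ∑ y : Λ, starRingEnd ℂ (ψ x) * (hamEntry v x y * ψ y) with hQ
  have h2 : Q = z * ((∑ x, ‖ψ x‖ ^ 2 : ℝ) : ℂ) := by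
    rw [hQ]
    simp only [← Finset.mul_sum, h1]
    push_cast
    rw [Finset.mul_sum]
    refine Finset.sum_congr rfl fun x _ => ?_
    rw [← Complex.conj_mul']
    ring
  have h3 : starRingEnd ℂ Q = Q := by
    rw [hQ]
    simp only [map_sum, map_mul, Complex.conj_conj, conj_hamEntry]
    rw [Finset.sum_comm]
    refine Finset.sum_congr rfl fun x _ => Finset.sum_congr rfl fun y _ => ?_
    rw [hamEntry_symm]
    ring
  have h4 : Q.im = 0 := Complex.conj_eq_iff_im.1 h3
  rw [h2, Complex.im_mul_ofReal] at h4
  rcases mul_eq_zero.1 h4 with h5 | h5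
  · exact hz h5
  · refine hψ (funext fun x => ?_)
    have := (Finset.sum_eq_zero_iff_of_nonneg fun x _ => by positivity).1 h5 x
      (Finset.mem_univ x)
    simpa using this

theorem measurable_finGreen {d : ℕ} (Λ : Finset (Site d)) (z : ℂ) (x y : Site d) :
    Measurable fun v : Site d → ℝ => finGreen Λ v z x y := by
  classical
  by_cases hx : x ∈ Λ
  swap
  · simp only [finGreen_of_notMem_left _ z hx, measurable_const]
  by_cases hy : y ∈ Λ
  swap
  · simp only [finGreen_of_notMem_right _ z hy, measurable_const]
  simp only [finGreen_of_mem _ z hx hy, Matrix.inv_def, Ring.inverse_eq_inv', Matrix.smul_apply,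
    smul_eq_mul]
  have hM : ∀ a b : Λ, Continuous fun v : Site d → ℝ => finHamSub Λ v z a b := by
    intro a b
    simp only [finHamSub, finHam, Matrix.sub_apply, Matrix.of_apply, hamEntry]
    split_ifs <;> fun_prop
  have hM' : Continuous fun v : Site d → ℝ => finHamSub Λ v z := continuous_matrix hM
  have h1 : Continuous fun v : Site d → ℝ => (finHamSub Λ v z).adjugate ⟨x, hx⟩ ⟨y, hy⟩ :=
    (hM'.matrix_adjugate).matrix_elem _ _
  exact (hM'.matrix_det.measurable.inv).mul h1.measurable

theorem tendsto_finGreen {d : ℕ} (Λ : Finset (Site d)) (v : Site d → ℝ) (x y : Site d) {z : ℂ}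
    (h : (open Classical in (finHamSub Λ v z).det) ≠ 0) :
    Tendsto (fun w => finGreen Λ v w x y) (𝓝 z) (𝓝 (finGreen Λ v z x y)) := by
  classical
  by_cases hx : x ∈ Λ
  swap
  · simp only [finGreen_of_notMem_left v _ hx, tendsto_const_nhds]
  by_cases hy : y ∈ Λ
  swap
  · simp only [finGreen_of_notMem_right v _ hy, tendsto_const_nhds]
  simp only [finGreen_of_mem v _ hx hy, Matrix.inv_def, Ring.inverse_eq_inv', Matrix.smul_apply,
    smul_eq_mul]
  have hM : Continuous fun w : ℂ => finHamSub Λ v w := by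
    unfold finHamSub
    fun_prop
  have h1 : Continuous fun w : ℂ => (finHamSub Λ v w).adjugate ⟨x, hx⟩ ⟨y, hy⟩ :=
    (hM.matrix_adjugate).matrix_elem _ _
  exact ((hM.matrix_det.tendsto z).inv₀ (by convert h)).mul (h1.tendsto z)

/-- An eigenvector `ψ` at `E` satisfies `ψ = -it (H_Λ - E - it)⁻¹ ψ`; evaluate at a site where `|ψ|`
is maximal. This blow-up as `t → 0` is what excludes `E` as an eigenvalue almost surely. -/
theorem one_le_sum_finGreen {d : ℕ} (Λ : Finset (Site d)) (v : Site d → ℝ) {E : ℝ}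
    (h : (open Classical in (finHamSub Λ v E).det) = 0) {t : ℝ} (ht : t ≠ 0) :
    1 ≤ |t| * ∑ x ∈ Λ, ∑ y ∈ Λ, ‖finGreen Λ v (E + t * Complex.I) x y‖ := by
  classical
  obtain ⟨ψ, hψ, h0⟩ := Matrix.exists_mulVec_eq_zero_iff.2 (by convert h :
    (finHamSub Λ v E).det = 0)
  set z : ℂ := E + t * Complex.I with hz
  have hzim : z.im ≠ 0 := by simpa [hz] using ht
  have h1 : (finHamSub Λ v z).mulVec ψ = -(t * Complex.I : ℂ) • ψ := by
    have : finHamSub Λ v z = finHamSub Λ v E - (t * Complex.I : ℂ) • 1 := by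
      simp only [finHamSub, hz, add_smul]
      abel
    rw [this, Matrix.sub_mulVec, h0, Matrix.smul_mulVec, Matrix.one_mulVec]
    simp
  have h2 : ψ = -(t * Complex.I : ℂ) • ((finHamSub Λ v z)⁻¹.mulVec ψ) := by
    rw [← Matrix.mulVec_smul, ← h1, Matrix.mulVec_mulVec,
      Matrix.nonsing_inv_mul _ (det_finHamSub_ne_zero Λ v hzim).isUnit, Matrix.one_mulVec]
  obtain ⟨b, hb⟩ : ∃ b, ψ b ≠ 0 := by
    by_contra hcon
    push Not at hcon
    exact hψ (funext hcon)
  obtain ⟨x, -, hmax⟩ := Finset.exists_max_image Finset.univ (fun x => ‖ψ x‖)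
    ⟨b, Finset.mem_univ b⟩
  have hpos : 0 < ‖ψ x‖ := (norm_pos_iff.2 hb).trans_le (hmax b (Finset.mem_univ b))
  have h3 : ‖ψ x‖ ≤ |t| * ((∑ y : Λ, ‖(finHamSub Λ v z)⁻¹ x y‖) * ‖ψ x‖) := by
    have h4 := congrArg norm (congrFun h2 x)
    rw [Pi.smul_apply, norm_smul, norm_neg, norm_mul, Complex.norm_I, mul_one,
      Complex.norm_real, Real.norm_eq_abs] at h4
    refine h4.le.trans ?_
    gcongr
    rw [Finset.sum_mul]
    refine (norm_sum_le _ _).trans (Finset.sum_le_sum fun y _ => ?_)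
    rw [norm_mul]
    gcongr
    exact hmax y (Finset.mem_univ y)
  have h5 : 1 ≤ |t| * ∑ y : Λ, ‖(finHamSub Λ v z)⁻¹ x y‖ := by
    rw [← mul_assoc] at h3
    exact (le_mul_iff_one_le_left hpos).1 h3
  refine h5.trans ?_
  gcongr
  have h6 : ∑ y : Λ, ‖(finHamSub Λ v z)⁻¹ x y‖ = ∑ y ∈ Λ, ‖finGreen Λ v z x y‖ := by
    rw [← Finset.sum_coe_sort Λ fun y => ‖finGreen Λ v z x y‖]
    exact Finset.sum_congr rfl fun y _ => by rw [finGreen_of_mem v z x.2 y.2]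
  rw [h6]
  exact Finset.single_le_sum (f := fun x => ∑ y ∈ Λ, ‖finGreen Λ v z x y‖)
    (fun _ _ => by positivity) x.2

theorem greenFamily_finGreen {d : ℕ} (Λ : Finset (Site d)) (K : ℝ) {z : ℂ} (hz : z.im ≠ 0) :
    GreenFamily (d := d) (↑Λ) K z fun v => finGreen Λ (clampPot K v) z where
  meas x y := (measurable_finGreen Λ z x y).comp (measurable_pi_lambda _ (measurable_clampPot K))
  green v := isGreen_finGreen (det_finHamSub_ne_zero Λ _ hz)
  resolvent v w F hF x y :=
    (isGreen_finGreen (det_finHamSub_ne_zero Λ _ hz)).resolvent_of_finite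
      (isGreen_finGreen (det_finHamSub_ne_zero Λ _ hz)) F
      (fun a ha => by simp [clampPot, hF a ha]) x y

/-- Translates of Green functions are Green functions of the translated potential. -/
theorem IsGreen.translate {d : ℕ} {Ω : Set (Site d)} {v : Site d → ℝ} {z : ℂ} (x : Site d)
    {G : Site d → Site d → ℂ} (h : IsGreen Ω (fun a => v (a + x)) z G) :
    IsGreen {a | a - x ∈ Ω} v z fun a b => G (a - x) (b - x) where
  zero a b ha := h.zero _ _ ha
  symm a b := h.symm _ _
  eq a b ha := by
    have h1 := h.eq (a - x) (b - x) ha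
    simp only [hamAt, sub_add_cancel, sub_left_inj] at h1 ⊢
    simpa only [add_sub_right_comm] using h1

/-! ### Independent copies of the random potential -/

instance isProbabilityMeasure_potentialLaw (d : ℕ) (ν : Measure ℝ) [IsProbabilityMeasure ν] :
    IsProbabilityMeasure (potentialLaw d ν) := by
  unfold potentialLaw
  infer_instance

/-- The potential which equals `V` on `S` and `W` off `S`. -/
noncomputable def gluePot {d : ℕ} (S : Set (Site d)) (V W : Site d → ℝ) (x : Site d) : ℝ :=
  open Classical in if x ∈ S then V x else W x

theorem gluePot_of_mem {d : ℕ} {S : Set (Site d)} (V W : Site d → ℝ) {x : Site d} (h : x ∈ S) :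
    gluePot S V W x = V x := by
  rw [gluePot, if_pos h]

theorem gluePot_of_notMem {d : ℕ} {S : Set (Site d)} (V W : Site d → ℝ) {x : Site d}
    (h : x ∉ S) : gluePot S V W x = W x := by
  rw [gluePot, if_neg h]

theorem measurable_gluePot {d : ℕ} (S : Set (Site d)) :
    Measurable fun p : (Site d → ℝ) × (Site d → ℝ) => gluePot S p.1 p.2 := by
  refine measurable_pi_lambda _ fun x => ?_
  unfold gluePot
  split_ifs
  · exact (measurable_pi_apply x).comp measurable_fst
  · exact (measurable_pi_apply x).comp measurable_snd

/-- On a cylinder set the two copies constrain disjoint sets of sites, so the probability factors as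
under the product law. This is the only form of independence that the expansions use. -/
theorem measurePreserving_gluePot {d : ℕ} (ν : Measure ℝ) [IsProbabilityMeasure ν]
    (S : Set (Site d)) :
    MeasurePreserving (fun p : (Site d → ℝ) × (Site d → ℝ) => gluePot S p.1 p.2)
      ((potentialLaw d ν).prod (potentialLaw d ν)) (potentialLaw d ν) := by
  classical
  refine ⟨measurable_gluePot S, Measure.eq_infinitePi _ fun F t ht => ?_⟩
  rw [Measure.map_apply (measurable_gluePot S)
    (MeasurableSet.pi F.countable_toSet fun i _ => ht i)]
  have h : (fun p : (Site d → ℝ) × (Site d → ℝ) => gluePot S p.1 p.2) ⁻¹' (↑F : Set _).pi t =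
      ((↑(F.filter (· ∈ S)) : Set _).pi t) ×ˢ ((↑(F.filter (· ∉ S)) : Set _).pi t) := by
    ext p
    simp only [Set.mem_preimage, Set.mem_pi, Set.mem_prod, Finset.coe_filter, Set.mem_ofPred_eq,
      Finset.mem_coe]
    refine ⟨fun h => ⟨fun i hi => ?_, fun i hi => ?_⟩, fun h i hi => ?_⟩
    · simpa only [gluePot_of_mem _ _ hi.2] using h i hi.1
    · simpa only [gluePot_of_notMem _ _ hi.2] using h i hi.1
    · by_cases hS : i ∈ S
      · rw [gluePot_of_mem _ _ hS]
        exact h.1 i ⟨hi, hS⟩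
      · rw [gluePot_of_notMem _ _ hS]
        exact h.2 i ⟨hi, hS⟩
  rw [h, Measure.prod_prod, potentialLaw, Measure.infinitePi_pi _ fun i _ => ht i,
    Measure.infinitePi_pi _ fun i _ => ht i, Finset.prod_filter_mul_prod_filter_not]

theorem lintegral_gluePot {d : ℕ} (ν : Measure ℝ) [IsProbabilityMeasure ν]
    (S : Set (Site d)) {F : (Site d → ℝ) → ℝ≥0∞} (hF : Measurable F) :
    ∫⁻ V, F V ∂(potentialLaw d ν) =
      ∫⁻ V, ∫⁻ W, F (gluePot S V W) ∂(potentialLaw d ν) ∂(potentialLaw d ν) := by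
  rw [← (measurePreserving_gluePot ν S).lintegral_comp hF, lintegral_prod]
  exact (hF.comp (measurable_gluePot S)).aemeasurable

theorem measurable_updatePot {d : ℕ} (a : Site d) :
    Measurable fun p : (Site d → ℝ) × ℝ => Function.update p.1 a p.2 := by
  refine measurable_pi_lambda _ fun x => ?_
  by_cases h : x = a
  · subst h
    simpa using measurable_snd
  · simp only [Function.update_of_ne h]
    exact (measurable_pi_apply x).comp measurable_fst

theorem measurePreserving_updatePot {d : ℕ} (ν : Measure ℝ) [IsProbabilityMeasure ν]
    (a : Site d) :
    MeasurePreserving (fun p : (Site d → ℝ) × ℝ => Function.update p.1 a p.2)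
      ((potentialLaw d ν).prod ν) (potentialLaw d ν) := by
  classical
  refine ⟨measurable_updatePot a, Measure.eq_infinitePi _ fun F t ht => ?_⟩
  rw [Measure.map_apply (measurable_updatePot a)
    (MeasurableSet.pi F.countable_toSet fun i _ => ht i)]
  have h : (fun p : (Site d → ℝ) × ℝ => Function.update p.1 a p.2) ⁻¹' (↑F : Set _).pi t =
      ((↑(F.erase a) : Set _).pi t) ×ˢ (if a ∈ F then t a else Set.univ) := by
    ext p
    simp only [Set.mem_preimage, Set.mem_pi, Set.mem_prod, Finset.coe_erase, Set.mem_sdiff,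
      Finset.mem_coe, Set.mem_singleton_iff]
    refine ⟨fun h => ⟨fun i hi => ?_, ?_⟩, fun h i hi => ?_⟩
    · simpa [Function.update_of_ne hi.2] using h i hi.1
    · split_ifs with ha
      · simpa using h a ha
      · trivial
    · by_cases hia : i = a
      · subst hia
        simpa [hi] using h.2
      · rw [Function.update_of_ne hia]
        exact h.1 i ⟨hi, hia⟩
  rw [h, Measure.prod_prod, potentialLaw, Measure.infinitePi_pi _ fun i _ => ht i]
  split_ifs with ha
  · rw [mul_comm, Finset.mul_prod_erase F (fun i => ν (t i)) ha]
  · rw [measure_univ, mul_one, Finset.erase_eq_of_notMem ha]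

theorem lintegral_updatePot {d : ℕ} (ν : Measure ℝ) [IsProbabilityMeasure ν]
    (a : Site d) {F : (Site d → ℝ) → ℝ≥0∞} (hF : Measurable F) :
    ∫⁻ V, F V ∂(potentialLaw d ν) =
      ∫⁻ V, ∫⁻ t, F (Function.update V a t) ∂ν ∂(potentialLaw d ν) := by
  rw [← (measurePreserving_updatePot ν a).lintegral_comp hF, lintegral_prod]
  exact (hF.comp (measurable_updatePot a)).aemeasurable

theorem measurePreserving_translatePot {d : ℕ} (ν : Measure ℝ) [IsProbabilityMeasure ν]
    (x : Site d) :
    MeasurePreserving (fun (V : Site d → ℝ) a => V (a + x))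
      (potentialLaw d ν) (potentialLaw d ν) := by
  classical
  have hm : Measurable (fun (V : Site d → ℝ) a => V (a + x)) :=
    measurable_pi_lambda _ fun a => measurable_pi_apply _
  refine ⟨hm, Measure.eq_infinitePi _ fun F t ht => ?_⟩
  rw [Measure.map_apply hm (MeasurableSet.pi F.countable_toSet fun i _ => ht i)]
  have h : (fun (V : Site d → ℝ) a => V (a + x)) ⁻¹' (↑F : Set _).pi t =
      (↑(F.map (addRightEmbedding x)) : Set _).pi fun i => t (i - x) := by
    ext V
    simp only [Set.mem_preimage, Set.mem_pi, Finset.mem_coe, Finset.mem_map,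
      addRightEmbedding_apply]
    constructor
    · rintro h _ ⟨i, hi, rfl⟩
      simpa using h i hi
    · intro h i hi
      simpa using h (i + x) ⟨i, hi, rfl⟩
  rw [h, potentialLaw, Measure.infinitePi_pi _ fun i _ => ht _, Finset.prod_map]
  simp

theorem ae_abs_le_potentialLaw {d : ℕ} (ν : Measure ℝ) [IsProbabilityMeasure ν] {K : ℝ}
    (h : ∀ᵐ t ∂ν, |t| ≤ K) : ∀ᵐ V ∂(potentialLaw d ν), ∀ x, |V x| ≤ K := by
  rw [ae_all_iff]
  intro x
  have h1 : Measure.map (fun V : Site d → ℝ => V x) (potentialLaw d ν) = ν :=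
    Measure.infinitePi_map_eval (fun _ => ν) x
  rw [← h1] at h
  exact ae_of_ae_map (measurable_pi_apply x).aemeasurable h

/-! ### A priori bounds on fractional moments -/

theorem lintegral_enorm_rpow_neg_ne_top {s : ℝ} (hs1 : s < 1) :
    ∫⁻ t in Set.Ioo (-1 : ℝ) 1, ‖t‖ₑ ^ (-s) ≠ ∞ := by
  set g : ℝ → ℝ≥0∞ := (Set.Ioo (0 : ℝ) 1).indicator fun t => ‖t‖ₑ ^ (-s) with hg
  have hgm : Measurable g := by
    refine Measurable.indicator ?_ measurableSet_Ioo
    fun_prop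
  have h1 : ∫⁻ t, g t ≠ ∞ := by
    rw [hg, lintegral_indicator measurableSet_Ioo]
    have h2 := (intervalIntegral.intervalIntegrable_rpow' (a := 0) (b := 1)
      (show -1 < -s by linarith)).1
    have h3 : IntegrableOn (fun t : ℝ => t ^ (-s)) (Set.Ioo 0 1) :=
      h2.mono_set Set.Ioo_subset_Ioc_self
    have h4 := h3.2
    rw [HasFiniteIntegral] at h4
    refine ne_top_of_le_ne_top h4.ne ?_
    refine setLIntegral_mono' measurableSet_Ioo fun t ht => ?_
    rw [Real.enorm_eq_ofReal ht.1.le, Real.enorm_eq_ofReal (Real.rpow_nonneg ht.1.le _),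
      ENNReal.ofReal_rpow_of_pos ht.1]
  have h2 : ∫⁻ t in Set.Ioo (-1 : ℝ) 1, ‖t‖ₑ ^ (-s) ≤ ∫⁻ t, (g t + g (-t)) := by
    rw [← lintegral_indicator measurableSet_Ioo]
    refine lintegral_mono_ae ?_
    have h0 : ∀ᵐ t : ℝ, t ≠ 0 := by
      rw [ae_iff]
      simp
    filter_upwards [h0] with t ht
    by_cases hmem : t ∈ Set.Ioo (-1 : ℝ) 1
    · rw [Set.indicator_of_mem hmem]
      rcases lt_or_gt_of_ne ht with h | h
      · have : -t ∈ Set.Ioo (0 : ℝ) 1 := ⟨by linarith, by linarith [hmem.1]⟩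
        refine le_add_left ?_
        rw [hg, Set.indicator_of_mem this, enorm_neg]
      · have : t ∈ Set.Ioo (0 : ℝ) 1 := ⟨h, hmem.2⟩
        refine le_add_right ?_
        rw [hg, Set.indicator_of_mem this]
    · rw [Set.indicator_of_notMem hmem]
      exact zero_le
  refine ne_top_of_le_ne_top ?_ h2
  rw [lintegral_add_left hgm, lintegral_neg_eq_self]
  exact ENNReal.add_ne_top.2 ⟨h1, h1⟩

/-- Uniform bound on the fractional moments of a simple pole. -/
theorem exists_lintegral_enorm_add_rpow_neg_le {ν : Measure ℝ} [IsProbabilityMeasure ν]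
    (hν : IsRegularLaw ν) {s : ℝ} (hs : 0 < s) (hs1 : s < 1) :
    ∃ C : ℝ≥0∞, C ≠ ∞ ∧ ∀ ζ : ℂ, ∫⁻ t, ‖(t : ℂ) + ζ‖ₑ ^ (-s) ∂ν ≤ C := by
  obtain ⟨ρ, hρ, -, ⟨M, hM, hρM⟩, rfl⟩ := hν
  refine ⟨1 + M * ∫⁻ t in Set.Ioo (-1 : ℝ) 1, ‖t‖ₑ ^ (-s),
    ENNReal.add_ne_top.2 ⟨ENNReal.one_ne_top,
      ENNReal.mul_ne_top hM (lintegral_enorm_rpow_neg_ne_top hs1)⟩, fun ζ => ?_⟩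
  set h : ℝ → ℝ≥0∞ := (Set.Ioo (-1 : ℝ) 1).indicator fun t => ‖t‖ₑ ^ (-s) with hh
  have hhm : Measurable h := by
    refine Measurable.indicator ?_ measurableSet_Ioo
    fun_prop
  -- Dropping the imaginary part increases the pole. Away from it the power is at most 1; near it,
  -- Lebesgue measure times the density bound is translation invariant, hence the uniformity in `ζ`.
  have h1 : ∀ t : ℝ, ‖(t : ℂ) + ζ‖ₑ ^ (-s) ≤ 1 + h (t + ζ.re) := by
    intro t
    have h2 : ‖t + ζ.re‖ₑ ≤ ‖(t : ℂ) + ζ‖ₑ := by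
      have := Complex.abs_re_le_norm ((t : ℂ) + ζ)
      rw [enorm_le_iff_norm_le]
      simpa using this
    have h3 : ‖(t : ℂ) + ζ‖ₑ ^ (-s) ≤ ‖t + ζ.re‖ₑ ^ (-s) := by
      rw [ENNReal.rpow_neg, ENNReal.rpow_neg, ENNReal.inv_le_inv]
      gcongr
    refine h3.trans ?_
    by_cases hmem : t + ζ.re ∈ Set.Ioo (-1 : ℝ) 1
    · rw [hh, Set.indicator_of_mem hmem]
      exact le_add_self
    · refine le_add_right ?_
      rw [ENNReal.rpow_neg]
      refine ENNReal.inv_le_one.2 (ENNReal.one_le_rpow ?_ hs)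
      rw [← enorm_one (G := ℝ), enorm_le_iff_norm_le, norm_one, Real.norm_eq_abs]
      by_contra hcon
      exact hmem (abs_lt.1 (not_le.1 hcon))
  calc _ ≤ ∫⁻ t, (1 + h (t + ζ.re)) ∂(volume.withDensity ρ) := lintegral_mono h1
    _ = 1 + ∫⁻ t, h (t + ζ.re) ∂(volume.withDensity ρ) := by
        rw [lintegral_add_left measurable_const, lintegral_const, measure_univ, mul_one]
    _ ≤ 1 + ∫⁻ t, M * h (t + ζ.re) := by
        refine add_le_add le_rfl ?_
        rw [lintegral_withDensity_eq_lintegral_mul _ hρ (by fun_prop)]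
        refine lintegral_mono fun t => ?_
        simp only [Pi.mul_apply]
        gcongr
        exact hρM t
    _ = _ := by
        rw [lintegral_const_mul _ (by fun_prop), lintegral_add_right_eq_self (fun t => h t),
          hh, lintegral_indicator measurableSet_Ioo]

/-! ### Perturbations of rank one and two, and domination by simple poles. -/

theorem ENNReal.rpow_le_of_mul_le {g y : ℂ} (h : ‖g‖ * ‖y‖ ≤ 2) {s : ℝ} (hs : 0 < s) :
    ‖g‖ₑ ^ s ≤ 2 ^ s * ‖y‖ₑ ^ (-s) := by
  by_cases hy : y = 0
  · rw [hy, enorm_zero, ENNReal.zero_rpow_of_neg (by linarith), ENNReal.mul_top]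
    · exact le_top
    · simp
  have h1 : ‖g‖ₑ ≤ 2 * ‖y‖ₑ⁻¹ := by
    rw [← div_eq_mul_inv, ENNReal.le_div_iff_mul_le (by simp [hy]) (by simp), ← enorm_mul,
      ← ofReal_norm, norm_mul]
    exact (ENNReal.ofReal_le_ofReal h).trans_eq (by simp)
  calc ‖g‖ₑ ^ s ≤ (2 * ‖y‖ₑ⁻¹) ^ s := by gcongr
    _ = _ := by
      rw [ENNReal.mul_rpow_of_nonneg _ _ hs.le, ENNReal.inv_rpow, ENNReal.rpow_neg]

theorem one_site_bound {g p u : ℂ} (h : g = p - g * u * p) : ‖g‖ * ‖u + p⁻¹‖ ≤ 2 := by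
  by_cases hp : p = 0
  · have : g = 0 := by rw [h, hp]; ring
    simp [this]
  · have h1 : p * (g * (u + p⁻¹)) = p := by
      have : p * p⁻¹ = 1 := mul_inv_cancel₀ hp
      linear_combination h + g * this
    have h2 : g * (u + p⁻¹) = 1 := by
      apply mul_left_cancel₀ hp
      rw [h1, mul_one]
    rw [← norm_mul, h2, norm_one]
    norm_num

/-- The off-diagonal entry of a rank two perturbation is dominated by one of three poles. -/
theorem two_site_bound {g₁ g g₂ p q r u v : ℂ} (h₁ : g₁ = p - g₁ * u * p - g * v * q)
    (h : g = q - g₁ * u * q - g * v * r) (h₂ : g₂ = r - g * u * q - g₂ * v * r) :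
    ‖g‖ * ‖u + (r * v + 1) / ((p * r - q ^ 2) * v + p)‖ ≤ 2 ∨
      ‖g‖ * ‖v + (p * u + 1) / ((p * r - q ^ 2) * u + r)‖ ≤ 2 ∨
      ‖g‖ * ‖u + r / (p * r - q ^ 2)‖ ≤ 2 := by
  by_cases hq : q = 0
  · subst hq
    have h3 : g * (1 + v * r) = 0 := by linear_combination h
    rcases mul_eq_zero.1 h3 with h4 | h4
    · left
      simp [h4]
    · have h5 : r = 0 := by linear_combination -h₂ + g₂ * h4
      simp [h5] at h4
  have hqn : 0 < ‖q‖ := norm_pos_iff.2 hq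
  set Δ := p * r - q ^ 2 with hΔ
  -- `D` is the determinant of the identity plus the two-by-two Green matrix times the diagonal
  -- matrix of `u` and `v`; Cramer's rule gives `g = q / D`.
  set D := Δ * u * v + p * u + r * v + 1 with hD
  have hgD : g * D = q := by
    rw [hD, hΔ]
    linear_combination (1 + u * p) * h - u * q * h₁
  have hgDn : ‖g‖ * ‖D‖ = ‖q‖ := by rw [← norm_mul, hgD]
  -- `D` is affine in `u` with slope `Δ v + p` and affine in `v` with slope `Δ u + r`. A slope of
  -- size at least `|q| / 2` bounds `g = q / D` by a pole in that variable.
  by_cases c1 : ‖q‖ / 2 ≤ ‖Δ * v + p‖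
  · left
    have h0 : Δ * v + p ≠ 0 := norm_pos_iff.1 (by linarith)
    have h3 : D = (Δ * v + p) * (u + (r * v + 1) / (Δ * v + p)) := by
      field_simp
      rw [hD]
      ring
    rw [h3, norm_mul] at hgDn
    have h4 : 0 ≤ ‖g‖ * ‖u + (r * v + 1) / (Δ * v + p)‖ := by positivity
    nlinarith
  by_cases c2 : ‖q‖ / 2 ≤ ‖Δ * u + r‖
  · right; left
    have h0 : Δ * u + r ≠ 0 := norm_pos_iff.1 (by linarith)
    have h3 : D = (Δ * u + r) * (v + (p * u + 1) / (Δ * u + r)) := by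
      field_simp
      rw [hD]
      ring
    rw [h3, norm_mul] at hgDn
    have h4 : 0 ≤ ‖g‖ * ‖v + (p * u + 1) / (Δ * u + r)‖ := by positivity
    nlinarith
  right; right
  push Not at c1 c2
  -- If both slopes are small, this identity forces `|Δ| |D| ≥ 3/4 |q|²`, hence `|g| |q| ≤ 4/3 |Δ|`.
  -- Together with `|Δ u + r| < |q| / 2` this bounds `g` by the pole in `u` at `-r / Δ`.
  have h3 : q ^ 2 = (Δ * u + r) * (Δ * v + p) - Δ * D := by
    rw [hD]
    linear_combination (-1 : ℂ) * hΔ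
  have h4 : ‖q‖ ^ 2 ≤ ‖Δ * u + r‖ * ‖Δ * v + p‖ + ‖Δ‖ * ‖D‖ := by
    rw [← norm_pow, h3, ← norm_mul, ← norm_mul]
    exact norm_sub_le _ _
  have h5 : 3 / 4 * ‖q‖ ^ 2 ≤ ‖Δ‖ * ‖D‖ := by
    have : ‖Δ * u + r‖ * ‖Δ * v + p‖ ≤ (‖q‖ / 2) * (‖q‖ / 2) :=
      mul_le_mul c2.le c1.le (norm_nonneg _) (by positivity)
    nlinarith
  have h6 : 0 < ‖Δ‖ := by
    by_contra hcon
    have : ‖Δ‖ = 0 := le_antisymm (not_lt.1 hcon) (norm_nonneg _)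
    rw [this, zero_mul] at h5
    nlinarith [sq_pos_of_pos hqn]
  have h7 : ‖g‖ * ‖q‖ ≤ 4 / 3 * ‖Δ‖ := by
    have h8 : ‖g‖ * (3 / 4 * ‖q‖ ^ 2) ≤ ‖Δ‖ * ‖q‖ := by
      calc _ ≤ ‖g‖ * (‖Δ‖ * ‖D‖) := by gcongr
        _ = ‖Δ‖ * (‖g‖ * ‖D‖) := by ring
        _ = _ := by rw [hgDn]
    have h9 : (‖g‖ * ‖q‖) * ‖q‖ ≤ (4 / 3 * ‖Δ‖) * ‖q‖ := by nlinarith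
    exact le_of_mul_le_mul_right h9 hqn
  have h8 : ‖u + r / Δ‖ * ‖Δ‖ = ‖Δ * u + r‖ := by
    rw [← norm_mul]
    congr 1
    field_simp [norm_pos_iff.1 h6]
  have h9 : (‖g‖ * ‖u + r / Δ‖) * ‖Δ‖ ≤ 2 * ‖Δ‖ := by
    rw [mul_assoc, h8]
    nlinarith [mul_le_mul_of_nonneg_left c2.le (norm_nonneg g)]
  exact le_of_mul_le_mul_right h9 h6

/-- The data of the single-site law which enter the estimates: it is supported in `[-K, K]`, and
its fractional moments of simple poles are bounded by `C`. -/
structure PoleBound (ν : Measure ℝ) (s K : ℝ) (C : ℝ≥0∞) : Prop where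
  nonneg : 0 ≤ K
  ae_le : ∀ᵐ t ∂ν, |t| ≤ K
  pole : ∀ ζ : ℂ, ∫⁻ t, ‖(t : ℂ) + ζ‖ₑ ^ (-s) ∂ν ≤ C

theorem IsRegularLaw.exists_support_bound {ν : Measure ℝ} (hν : IsRegularLaw ν) :
    ∃ K : ℝ, 0 ≤ K ∧ ∀ᵐ t ∂ν, |t| ≤ K := by
  obtain ⟨ρ, hρ, hc, -, rfl⟩ := hν
  obtain ⟨K, hK⟩ := hc.isCompact.isBounded.exists_norm_le
  refine ⟨max K 0, le_max_right _ _, ?_⟩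
  rw [ae_withDensity_iff hρ]
  refine ae_of_all _ fun t ht => ?_
  exact (hK t (subset_tsupport ρ ht)).trans (le_max_left _ _)

theorem PoleBound.pole_clamp {ν : Measure ℝ} {s K : ℝ} {C : ℝ≥0∞} (h : PoleBound ν s K C)
    (ζ : ℂ) : ∫⁻ t, ‖((max (-K) (min K t) : ℝ) : ℂ) + ζ‖ₑ ^ (-s) ∂ν ≤ C := by
  refine le_trans (le_of_eq (lintegral_congr_ae ?_)) (h.pole ζ)
  filter_upwards [h.ae_le] with t ht
  obtain ⟨h1, h2⟩ := abs_le.1 ht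
  rw [min_eq_right h2, max_eq_right h1]

theorem clampPot_update_self {d : ℕ} (K : ℝ) (w : Site d → ℝ) (a : Site d) (t : ℝ) :
    clampPot K (Function.update w a t) a = max (-K) (min K t) := by
  simp [clampPot]

theorem clampPot_update_of_ne {d : ℕ} (K : ℝ) (w : Site d → ℝ) {a b : Site d} (h : b ≠ a)
    (t : ℝ) : clampPot K (Function.update w a t) b = clampPot K w b := by
  simp [clampPot, h]

/-- If `p` is the diagonal entry with the potential at `a` set to zero, and `p ≠ 0`, the entry at
value `u` is `1 / (u + p⁻¹)`: a simple pole whose position does not depend on `u`. -/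
theorem GreenFamily.lintegral_one_site_le {d : ℕ} {Ω : Set (Site d)} {z : ℂ}
    {G : (Site d → ℝ) → Site d → Site d → ℂ} {ν : Measure ℝ} {s K : ℝ} {C : ℝ≥0∞}
    (h : GreenFamily Ω K z G) (hC : PoleBound ν s K C) (hs : 0 < s)
    (w : Site d → ℝ) (a : Site d) :
    ∫⁻ t, ‖G (Function.update w a t) a a‖ₑ ^ s ∂ν ≤ 2 ^ s * C := by
  classical
  set p := G (Function.update w a 0) a a with hp
  have hpt : ∀ t : ℝ, ‖G (Function.update w a t) a a‖ₑ ^ s ≤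
      2 ^ s * ‖((max (-K) (min K t) : ℝ) : ℂ) + p⁻¹‖ₑ ^ (-s) := by
    intro t
    refine ENNReal.rpow_le_of_mul_le (one_site_bound ?_) hs
    have h1 := h.resolvent (Function.update w a t) (Function.update w a 0) {a}
      (fun b hb => by
        rw [Finset.mem_singleton] at hb
        simp [hb]) a a
    rw [Finset.sum_singleton, clampPot_update_self, clampPot_update_self, ← hp] at h1
    have h0 : max (-K) (min K 0) = 0 := by simp [hC.nonneg]
    rw [h0, zero_sub] at h1
    rw [Complex.ofReal_neg] at h1
    linear_combination h1
  calc _ ≤ ∫⁻ t, 2 ^ s * ‖((max (-K) (min K t) : ℝ) : ℂ) + p⁻¹‖ₑ ^ (-s) ∂ν :=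
        lintegral_mono hpt
    _ = 2 ^ s * ∫⁻ t, ‖((max (-K) (min K t) : ℝ) : ℂ) + p⁻¹‖ₑ ^ (-s) ∂ν :=
        lintegral_const_mul _ (by fun_prop)
    _ ≤ _ := by
        gcongr
        exact hC.pole_clamp _

theorem GreenFamily.lintegral_two_site_le {d : ℕ} {Ω : Set (Site d)} {z : ℂ}
    {G : (Site d → ℝ) → Site d → Site d → ℂ} {ν : Measure ℝ} [IsProbabilityMeasure ν]
    {s K : ℝ} {C : ℝ≥0∞} (h : GreenFamily Ω K z G) (hC : PoleBound ν s K C) (hs : 0 < s)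
    (w : Site d → ℝ) {a b : Site d} (hab : a ≠ b) :
    ∫⁻ u, ∫⁻ t, ‖G (Function.update (Function.update w a u) b t) a b‖ₑ ^ s ∂ν ∂ν ≤
      3 * (2 ^ s * C) := by
  classical
  set w₀ := Function.update (Function.update w a 0) b 0 with hw₀
  set p := G w₀ a a with hp
  set q := G w₀ a b with hq
  set r := G w₀ b b with hr
  set cl : ℝ → ℂ := fun t => ((max (-K) (min K t) : ℝ) : ℂ) with hcl
  have hclm : Measurable cl := by
    rw [hcl]
    fun_prop
  have h0 : max (-K) (min K 0) = 0 := by simp [hC.nonneg]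
  set P : ℂ → ℝ≥0∞ := fun y => 2 ^ s * ‖y‖ₑ ^ (-s) with hP
  have hPm : Measurable P := by
    rw [hP]
    fun_prop
  have hpole : ∀ ζ, ∫⁻ t, P (cl t + ζ) ∂ν ≤ 2 ^ s * C := by
    intro ζ
    rw [hP, hcl, lintegral_const_mul _ (by fun_prop)]
    gcongr
    exact hC.pole_clamp ζ
  set F₁ : ℝ → ℝ → ℝ≥0∞ := fun u t =>
    P (cl u + (r * cl t + 1) / ((p * r - q ^ 2) * cl t + p)) with hF₁
  set F₂ : ℝ → ℝ → ℝ≥0∞ := fun u t =>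
    P (cl t + (p * cl u + 1) / ((p * r - q ^ 2) * cl u + r)) with hF₂
  set F₃ : ℝ → ℝ≥0∞ := fun u => P (cl u + r / (p * r - q ^ 2)) with hF₃
  have hF₁m : Measurable (Function.uncurry F₁) := by
    refine hPm.comp ?_
    fun_prop
  have hF₃m : Measurable F₃ := hPm.comp (by fun_prop)
  have hpt : ∀ u t : ℝ, ‖G (Function.update (Function.update w a u) b t) a b‖ₑ ^ s ≤
      F₁ u t + (F₃ u + F₂ u t) := by
    intro u t
    set V := Function.update (Function.update w a u) b t with hV
    have hVa : clampPot K V a = max (-K) (min K u) := by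
      rw [hV, clampPot_update_of_ne K _ hab, clampPot_update_self]
    have hVb : clampPot K V b = max (-K) (min K t) := by rw [hV, clampPot_update_self]
    have hwa : clampPot K w₀ a = 0 := by
      rw [hw₀, clampPot_update_of_ne K _ hab, clampPot_update_self, h0]
    have hwb : clampPot K w₀ b = 0 := by rw [hw₀, clampPot_update_self, h0]
    have hR : ∀ x y, G V x y = G w₀ x y -
        (G V x a * cl u * G w₀ a y + G V x b * cl t * G w₀ b y) := by
      intro x y
      have h1 := h.resolvent V w₀ {a, b} (fun c hc => by
        simp only [Finset.mem_insert, Finset.mem_singleton, not_or] at hc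
        simp [hV, hw₀, hc.1, hc.2]) x y
      rw [Finset.sum_pair hab, hVa, hVb, hwa, hwb, zero_sub, zero_sub, Complex.ofReal_neg,
        Complex.ofReal_neg] at h1
      rw [h1]
      simp only [hcl]
      ring
    have hsV := (h.green V).symm b a
    have hs0 := (h.green w₀).symm b a
    have e1 := hR a a
    have e2 := hR a b
    have e3 := hR b b
    rw [hs0] at e1
    rw [hsV] at e3
    rcases two_site_bound (g₁ := G V a a) (g := G V a b) (g₂ := G V b b) (p := p) (q := q)
      (r := r) (u := cl u) (v := cl t) (by linear_combination e1)
      (by linear_combination e2) (by linear_combination e3) with hb | hb | hb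
    · exact le_add_right (ENNReal.rpow_le_of_mul_le hb hs)
    · exact le_add_left (le_add_left (ENNReal.rpow_le_of_mul_le hb hs))
    · exact le_add_left (le_add_right (ENNReal.rpow_le_of_mul_le hb hs))
  have hF₁u : ∀ u, Measurable fun t => F₁ u t := fun u => hF₁m.of_uncurry_left
  calc _ ≤ ∫⁻ u, ∫⁻ t, (F₁ u t + (F₃ u + F₂ u t)) ∂ν ∂ν :=
        lintegral_mono fun u => lintegral_mono fun t => hpt u t
    _ = ∫⁻ u, (∫⁻ t, F₁ u t ∂ν + (F₃ u + ∫⁻ t, F₂ u t ∂ν)) ∂ν := by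
        refine lintegral_congr fun u => ?_
        rw [lintegral_add_left (hF₁u u), lintegral_add_left measurable_const, lintegral_const,
          measure_univ, mul_one]
    _ = ∫⁻ u, ∫⁻ t, F₁ u t ∂ν ∂ν + (∫⁻ u, F₃ u ∂ν + ∫⁻ u, ∫⁻ t, F₂ u t ∂ν ∂ν) := by
        rw [lintegral_add_left hF₁m.lintegral_prod_right, lintegral_add_left hF₃m]
    _ ≤ 2 ^ s * C + (2 ^ s * C + 2 ^ s * C) := by
        refine add_le_add ?_ (add_le_add (hpole _) ?_)
        -- The position of this pole in `u` depends on `t`, so the integral over `u` has to come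
        -- first.
        · rw [lintegral_lintegral_swap hF₁m.aemeasurable]
          calc _ ≤ ∫⁻ _ : ℝ, 2 ^ s * C ∂ν := lintegral_mono fun t => hpole _
            _ = _ := by simp
        · calc _ ≤ ∫⁻ _ : ℝ, 2 ^ s * C ∂ν := lintegral_mono fun u => hpole _
            _ = _ := by simp
    _ = _ := by ring

/-- The a priori bound: averaging over the potential at `a` and `b`, for an arbitrary potential
`w` off `S`. -/
theorem GreenFamily.lintegral_gluePot_le {d : ℕ} {Ω : Set (Site d)} {z : ℂ}
    {G : (Site d → ℝ) → Site d → Site d → ℂ} {ν : Measure ℝ} [IsProbabilityMeasure ν]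
    {s K : ℝ} {C : ℝ≥0∞} (h : GreenFamily Ω K z G) (hC : PoleBound ν s K C) (hs : 0 < s)
    (S : Set (Site d)) (w : Site d → ℝ) {a b : Site d} (ha : a ∈ S) (hb : b ∈ S) :
    ∫⁻ V, ‖G (gluePot S V w) a b‖ₑ ^ s ∂(potentialLaw d ν) ≤ 3 * (2 ^ s * C) := by
  classical
  have hm : Measurable fun V => ‖G (gluePot S V w) a b‖ₑ ^ s := by
    have := (h.meas a b).comp ((measurable_gluePot S).comp (measurable_prodMk_right (y := w)))
    exact this.enorm.pow_const s
  have hupd : ∀ (V : Site d → ℝ) (c : Site d) (t : ℝ), c ∈ S →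
      gluePot S (Function.update V c t) w = Function.update (gluePot S V w) c t := by
    intro V c t hc
    funext x
    by_cases hx : x = c
    · subst hx
      simp [gluePot_of_mem _ _ hc]
    · by_cases hxS : x ∈ S
      · simp [gluePot_of_mem _ _ hxS, hx]
      · simp [gluePot_of_notMem _ _ hxS, hx]
  by_cases hab : a = b
  · subst hab
    rw [lintegral_updatePot ν a hm]
    calc _ ≤ ∫⁻ _, 2 ^ s * C ∂(potentialLaw d ν) := by
          refine lintegral_mono fun V => ?_
          simp only [hupd V a _ ha]
          exact h.lintegral_one_site_le hC hs _ a
      _ = 1 * (2 ^ s * C) := by simp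
      _ ≤ _ := by
          gcongr
          norm_num
  · have hm' : Measurable fun V => ∫⁻ t, ‖G (gluePot S (Function.update V b t) w) a b‖ₑ ^ s ∂ν :=
      (hm.comp (measurable_updatePot b)).lintegral_prod_right'
    rw [lintegral_updatePot ν b hm, lintegral_updatePot ν a hm']
    calc _ ≤ ∫⁻ _, 3 * (2 ^ s * C) ∂(potentialLaw d ν) := by
          refine lintegral_mono fun V => ?_
          simp only [hupd _ _ _ ha, hupd _ _ _ hb]
          exact h.lintegral_two_site_le hC hs _ hab
      _ = _ := by simp

theorem GreenFamily.lintegral_le {d : ℕ} {Ω : Set (Site d)} {z : ℂ}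
    {G : (Site d → ℝ) → Site d → Site d → ℂ} {ν : Measure ℝ} [IsProbabilityMeasure ν]
    {s K : ℝ} {C : ℝ≥0∞} (h : GreenFamily Ω K z G) (hC : PoleBound ν s K C) (hs : 0 < s)
    (a b : Site d) : ∫⁻ V, ‖G V a b‖ₑ ^ s ∂(potentialLaw d ν) ≤ 3 * (2 ^ s * C) := by
  have := h.lintegral_gluePot_le hC hs Set.univ 0 (Set.mem_univ a) (Set.mem_univ b)
  have h1 : ∀ V : Site d → ℝ, gluePot Set.univ V 0 = V := fun V =>
    funext fun x => gluePot_of_mem _ _ (Set.mem_univ x)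
  simpa only [h1] using this

/-! ### Recursive bounds on fractional moments -/

/-- The fractional moment of a potential-dependent kernel. -/
noncomputable def fracMoment {d : ℕ} (ν : Measure ℝ) (s : ℝ)
    (G : (Site d → ℝ) → Site d → Site d → ℂ) (x y : Site d) : ℝ≥0∞ :=
  ∫⁻ V, ‖G V x y‖ₑ ^ s ∂(potentialLaw d ν)

/-- The constant in the geometric resolvent bounds for potentials truncated to `[-K, K]`. -/
noncomputable def geomConst (s K : ℝ) : ℝ≥0∞ := (2 + ENNReal.ofReal (2 * K)) ^ s

theorem geomConst_ne_top {s K : ℝ} (hs : 0 < s) : geomConst s K ≠ ∞ :=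
  ENNReal.rpow_ne_top_of_nonneg hs.le (ENNReal.add_ne_top.2 ⟨by simp, ENNReal.ofReal_ne_top⟩)

theorem clampPot_congr {d : ℕ} (K : ℝ) {v w : Site d → ℝ} {a : Site d} (h : v a = w a) :
    clampPot K v a = clampPot K w a := by
  simp [clampPot, h]

/-- One expansion around `x`: the kernel `G` between `x` and `y` is bounded by the kernel `G₁`
between `x` and a shell around `x`. -/
theorem GreenFamily.fracMoment_le_inner {d : ℕ} {Ω Ω₁ : Set (Site d)} {z : ℂ}
    {G G₁ : (Site d → ℝ) → Site d → Site d → ℂ} {ν : Measure ℝ} [IsProbabilityMeasure ν]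
    {s K : ℝ} {C : ℝ≥0∞} (h : GreenFamily Ω K z G) (hC : PoleBound ν s K C) (hs : 0 < s)
    (hs1 : s ≤ 1) {x y : Site d} {r : ℕ} (hm : ∀ a, Measurable fun V => G₁ V x a)
    (hg : ∀ V, IsGreen Ω₁ (clampPot K V) z (G₁ V)) (hΩ : ↑(siteBall x r) ⊆ Ω)
    (hΩ₁ : ↑(siteBall x r) ⊆ Ω₁) (hy : y ∉ siteBall x r) :
    fracMoment ν s G x y ≤ geomConst s K * (3 * (2 ^ s * C)) *
      ∑ p ∈ shellPairs x r, fracMoment ν s G₁ x p.1 := by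
  set D : Set (Site d) := {a | siteNorm (a - x) < r} with hD
  have hGm : ∀ a b, Measurable fun V => ‖G V a b‖ₑ ^ s := fun a b =>
    (h.meas a b).enorm.pow_const s
  have hG₁m : ∀ a, Measurable fun V => ‖G₁ V x a‖ₑ ^ s := fun a => (hm a).enorm.pow_const s
  have hglue : ∀ V W : Site d → ℝ, gluePot D V W = gluePot Dᶜ W V := fun V W => by
    funext a
    by_cases ha : a ∈ D
    · rw [gluePot_of_mem _ _ ha, gluePot_of_notMem _ _ (Set.notMem_compl_iff.2 ha)]
    · rw [gluePot_of_notMem _ _ ha, gluePot_of_mem _ _ (Set.mem_compl ha)]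
  have hyD : y ∈ Dᶜ := by
    rw [mem_siteBall] at hy
    simp only [hD, Set.mem_compl_iff, Set.mem_ofPred_eq]
    omega
  have hpt : ∀ V W : Site d → ℝ, ‖G (gluePot D V W) x y‖ₑ ^ s ≤ geomConst s K *
      ∑ p ∈ shellPairs x r, ‖G₁ V x p.1‖ₑ ^ s * ‖G (gluePot D V W) p.2 y‖ₑ ^ s := fun V W =>
    (h.green _).rpow_le_of_inner (hg V) hΩ hΩ₁ hy (abs_clampPot_sub_le hC.nonneg _ _)
      (fun a ha => clampPot_congr K (gluePot_of_mem _ _ ha)) hs hs1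
  unfold fracMoment
  rw [lintegral_gluePot ν D (hGm x y)]
  have hWm : ∀ (V : Site d → ℝ) (a b : Site d),
      Measurable fun W => ‖G (gluePot D V W) a b‖ₑ ^ s := fun V a b =>
    (hGm a b).comp ((measurable_gluePot D).comp measurable_prodMk_left)
  have hinner : ∀ V : Site d → ℝ, ∫⁻ W, ‖G (gluePot D V W) x y‖ₑ ^ s ∂(potentialLaw d ν) ≤
      geomConst s K * ∑ p ∈ shellPairs x r, ‖G₁ V x p.1‖ₑ ^ s * (3 * (2 ^ s * C)) := by
    intro V
    calc _ ≤ ∫⁻ W, geomConst s K * ∑ p ∈ shellPairs x r,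
          ‖G₁ V x p.1‖ₑ ^ s * ‖G (gluePot D V W) p.2 y‖ₑ ^ s ∂(potentialLaw d ν) :=
          lintegral_mono (hpt V)
      _ = geomConst s K * ∑ p ∈ shellPairs x r, ‖G₁ V x p.1‖ₑ ^ s *
          ∫⁻ W, ‖G (gluePot D V W) p.2 y‖ₑ ^ s ∂(potentialLaw d ν) := by
          rw [lintegral_const_mul _ (Finset.measurable_fun_sum _ fun p _ => (hWm V _ _).const_mul _),
            lintegral_finsetSum _ fun p _ => (hWm V _ _).const_mul _]
          congr 1
          exact Finset.sum_congr rfl fun p _ => lintegral_const_mul _ (hWm V _ _)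
      _ ≤ _ := by
          gcongr with p hp
          simp only [hglue]
          refine h.lintegral_gluePot_le hC hs _ _ ?_ hyD
          have := (mem_shell.1 (mem_shellPairs.1 hp).1.2).1
          simp only [hD, Set.mem_compl_iff, Set.mem_ofPred_eq]
          omega
  calc _ ≤ ∫⁻ V, geomConst s K * ∑ p ∈ shellPairs x r,
        ‖G₁ V x p.1‖ₑ ^ s * (3 * (2 ^ s * C)) ∂(potentialLaw d ν) := lintegral_mono hinner
    _ = _ := by
        rw [lintegral_const_mul _
            (Finset.measurable_fun_sum _ fun p _ => (hG₁m _).mul_const _),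
          lintegral_finsetSum _ fun p _ => (hG₁m _).mul_const _, mul_assoc,
          Finset.mul_sum (a := 3 * (2 ^ s * C))]
        congr 1
        refine Finset.sum_congr rfl fun p _ => ?_
        rw [lintegral_mul_const _ (hG₁m _), mul_comm]

/-- The full expansion around `x`, which returns to the kernel `G` itself. -/
theorem GreenFamily.fracMoment_le {d : ℕ} {Ω Ω₁ : Set (Site d)} {z : ℂ}
    {G G₁ : (Site d → ℝ) → Site d → Site d → ℂ} {ν : Measure ℝ} [IsProbabilityMeasure ν]
    {s K : ℝ} {C : ℝ≥0∞} (h : GreenFamily Ω K z G) (hC : PoleBound ν s K C) (hs : 0 < s)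
    (hs1 : s ≤ 1) {x y : Site d} {r : ℕ} (hm : ∀ a, Measurable fun V => G₁ V x a)
    (hg : ∀ V, IsGreen Ω₁ (clampPot K V) z (G₁ V)) (hΩ : ↑(siteBall x (r + 1)) ⊆ Ω)
    (hΩ₁ : ↑(siteBall x r) ⊆ Ω₁) (hy : y ∉ siteBall x (r + 1)) :
    fracMoment ν s G x y ≤ geomConst s K ^ 2 * (3 * (2 ^ s * C)) *
      ∑ p ∈ shellPairs x r, ∑ q ∈ shellPairs x (r + 1),
        fracMoment ν s G₁ x p.1 * fracMoment ν s G q.2 y := by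
  have hsub : siteBall x r ⊆ siteBall x (r + 1) := fun a ha => by
    rw [mem_siteBall] at ha ⊢
    omega
  set A₀ : ℝ≥0∞ := 3 * (2 ^ s * C) with hA₀
  set κ := geomConst s K with hκ
  set P := potentialLaw d ν with hP
  set D : Set (Site d) := {a | siteNorm (a - x) < r} with hD
  set S : Set (Site d) := {a | r ≤ siteNorm (a - x) ∧ siteNorm (a - x) ≤ r + 2} with hS
  have hGm : ∀ a b, Measurable fun V => ‖G V a b‖ₑ ^ s := fun a b =>
    (h.meas a b).enorm.pow_const s
  have hG₁m : ∀ a, Measurable fun V => ‖G₁ V x a‖ₑ ^ s := fun a => (hm a).enorm.pow_const s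
  set pot : (Site d → ℝ) → (Site d → ℝ) → (Site d → ℝ) → Site d → ℝ :=
    fun V₁ V₂ V₀ => gluePot D V₁ (gluePot Sᶜ V₂ V₀) with hpot
  -- The same potential regrouped so that only the values on `S` are resampled. The distances from
  -- `r` to `r + 2` in `S` cover both endpoints of the middle Green function, so the a priori bound
  -- applies for fixed `V₁` and `V₂`.
  have hpotS : ∀ V₁ V₂ V₀, pot V₁ V₂ V₀ = gluePot S V₀ (gluePot D V₁ V₂) := by
    intro V₁ V₂ V₀
    funext a
    simp only [hpot]
    by_cases ha : a ∈ S
    · have haD : a ∉ D := by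
        simp only [hD, hS, Set.mem_ofPred_eq] at ha ⊢
        omega
      rw [gluePot_of_notMem _ _ haD, gluePot_of_notMem _ _ (Set.notMem_compl_iff.2 ha),
        gluePot_of_mem _ _ ha]
    · rw [gluePot_of_notMem _ _ ha]
      by_cases haD : a ∈ D
      · rw [gluePot_of_mem _ _ haD, gluePot_of_mem _ _ haD]
      · rw [gluePot_of_notMem _ _ haD, gluePot_of_notMem _ _ haD,
          gluePot_of_mem _ _ (Set.mem_compl ha)]
  have hpot_in : ∀ V₁ V₂ V₀ a, siteNorm (a - x) < r → pot V₁ V₂ V₀ a = V₁ a :=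
    fun V₁ V₂ V₀ a ha => gluePot_of_mem _ _ ha
  have hpot_out : ∀ V₁ V₂ V₀, ∀ a ∉ siteBall x (r + 1 + 1), pot V₁ V₂ V₀ a = V₂ a := by
    intro V₁ V₂ V₀ a ha
    rw [mem_siteBall] at ha
    have h1 : a ∉ D := by
      simp only [hD, Set.mem_ofPred_eq]
      omega
    have h2 : a ∈ Sᶜ := by
      simp only [hS, Set.mem_compl_iff, Set.mem_ofPred_eq]
      omega
    simp only [hpot, gluePot_of_notMem _ _ h1, gluePot_of_mem _ _ h2]
  have hpt : ∀ V₁ V₂ V₀, ‖G (pot V₁ V₂ V₀) x y‖ₑ ^ s ≤ κ ^ 2 *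
      ∑ p ∈ shellPairs x r, ∑ q ∈ shellPairs x (r + 1),
        ‖G₁ V₁ x p.1‖ₑ ^ s * ‖G V₂ q.2 y‖ₑ ^ s * ‖G (pot V₁ V₂ V₀) p.2 q.1‖ₑ ^ s := by
    intro V₁ V₂ V₀
    have h1 := (h.green (pot V₁ V₂ V₀)).rpow_le_of_inner (hg V₁) (x := x) (y := y) (r := r)
      (fun a ha => hΩ (hsub ha)) hΩ₁ (fun hmem => hy (hsub hmem))
      (abs_clampPot_sub_le hC.nonneg _ _)
      (fun a ha => clampPot_congr K (hpot_in V₁ V₂ V₀ a ha)) hs hs1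
    refine h1.trans ?_
    rw [pow_two, mul_assoc]
    refine mul_le_mul' le_rfl ?_
    rw [Finset.mul_sum]
    refine Finset.sum_le_sum fun p hp => ?_
    have hp2 : p.2 ∈ siteBall x (r + 1) :=
      mem_siteBall.2 (mem_shell.1 (mem_shellPairs.1 hp).1.2).2
    have h2 := (h.green (pot V₁ V₂ V₀)).rpow_le_of_outer (h.green V₂) hΩ hp2 hy
      (abs_clampPot_sub_le hC.nonneg _ _)
      (h.resolvent (pot V₁ V₂ V₀) V₂ (siteBall x (r + 1 + 1)) (hpot_out V₁ V₂ V₀) p.2 y) hs hs1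
    calc _ ≤ ‖G₁ V₁ x p.1‖ₑ ^ s * (κ * ∑ q ∈ shellPairs x (r + 1),
          ‖G (pot V₁ V₂ V₀) p.2 q.1‖ₑ ^ s * ‖G V₂ q.2 y‖ₑ ^ s) := by
          gcongr
          exact h2
      _ = _ := by
          rw [mul_left_comm, Finset.mul_sum]
          congr 1
          exact Finset.sum_congr rfl fun q _ => by ring
  have hV₀m : ∀ V₁ V₂ a b, Measurable fun V₀ => ‖G (pot V₁ V₂ V₀) a b‖ₑ ^ s :=
    fun V₁ V₂ a b => (hGm a b).comp ((measurable_gluePot D).comp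
      (measurable_prodMk_left.comp ((measurable_gluePot Sᶜ).comp measurable_prodMk_left)))
  have hinner : ∀ V₁ V₂, ∫⁻ V₀, ‖G (pot V₁ V₂ V₀) x y‖ₑ ^ s ∂P ≤ κ ^ 2 *
      ∑ p ∈ shellPairs x r, ∑ q ∈ shellPairs x (r + 1),
        ‖G₁ V₁ x p.1‖ₑ ^ s * ‖G V₂ q.2 y‖ₑ ^ s * A₀ := by
    intro V₁ V₂
    calc _ ≤ ∫⁻ V₀, κ ^ 2 * ∑ p ∈ shellPairs x r, ∑ q ∈ shellPairs x (r + 1),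
          ‖G₁ V₁ x p.1‖ₑ ^ s * ‖G V₂ q.2 y‖ₑ ^ s * ‖G (pot V₁ V₂ V₀) p.2 q.1‖ₑ ^ s ∂P :=
          lintegral_mono (hpt V₁ V₂)
      _ = κ ^ 2 * ∑ p ∈ shellPairs x r, ∑ q ∈ shellPairs x (r + 1),
          ‖G₁ V₁ x p.1‖ₑ ^ s * ‖G V₂ q.2 y‖ₑ ^ s *
            ∫⁻ V₀, ‖G (pot V₁ V₂ V₀) p.2 q.1‖ₑ ^ s ∂P := by
          rw [lintegral_const_mul _ (Finset.measurable_fun_sum _ fun p _ =>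
              Finset.measurable_fun_sum _ fun q _ => (hV₀m _ _ _ _).const_mul _),
            lintegral_finsetSum _ fun p _ =>
              Finset.measurable_fun_sum _ fun q _ => (hV₀m _ _ _ _).const_mul _]
          congr 1
          refine Finset.sum_congr rfl fun p _ => ?_
          rw [lintegral_finsetSum _ fun q _ => (hV₀m _ _ _ _).const_mul _]
          exact Finset.sum_congr rfl fun q _ => lintegral_const_mul _ (hV₀m _ _ _ _)
      _ ≤ _ := by
          gcongr with p hp q hq
          simp only [hpotS]
          have h1 := mem_shell.1 (mem_shellPairs.1 hp).1.2
          have h2 := mem_shell.1 (mem_shellPairs.1 hq).1.1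
          refine h.lintegral_gluePot_le hC hs _ _ ?_ ?_
          · simp only [hS, Set.mem_ofPred_eq]
            omega
          · simp only [hS, Set.mem_ofPred_eq]
            omega
  have hV₂m : ∀ V₁ : Site d → ℝ, Measurable fun W => ‖G (gluePot D V₁ W) x y‖ₑ ^ s :=
    fun V₁ => (hGm x y).comp ((measurable_gluePot D).comp measurable_prodMk_left)
  have houter : ∀ V₁, ∫⁻ V₂, ∫⁻ V₀, ‖G (pot V₁ V₂ V₀) x y‖ₑ ^ s ∂P ∂P ≤ κ ^ 2 *
      ∑ p ∈ shellPairs x r, ∑ q ∈ shellPairs x (r + 1),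
        ‖G₁ V₁ x p.1‖ₑ ^ s * (fracMoment ν s G q.2 y * A₀) := by
    intro V₁
    have hm1 : ∀ (c : ℝ≥0∞) (b : Site d), Measurable fun V₂ => c * ‖G V₂ b y‖ₑ ^ s * A₀ :=
      fun c b => ((hGm b y).const_mul c).mul_const _
    calc _ ≤ ∫⁻ V₂, κ ^ 2 * ∑ p ∈ shellPairs x r, ∑ q ∈ shellPairs x (r + 1),
          ‖G₁ V₁ x p.1‖ₑ ^ s * ‖G V₂ q.2 y‖ₑ ^ s * A₀ ∂P := lintegral_mono (hinner V₁)
      _ = _ := by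
          rw [lintegral_const_mul _ (Finset.measurable_fun_sum _ fun p _ =>
              Finset.measurable_fun_sum _ fun q _ => hm1 _ _),
            lintegral_finsetSum _ fun p _ =>
              Finset.measurable_fun_sum _ fun q _ => hm1 _ _]
          congr 1
          refine Finset.sum_congr rfl fun p _ => ?_
          rw [lintegral_finsetSum _ fun q _ => hm1 _ _]
          refine Finset.sum_congr rfl fun q _ => ?_
          rw [lintegral_mul_const _ ((hGm _ _).const_mul _), lintegral_const_mul _ (hGm _ _),
            mul_assoc]
          rfl
  have hm2 : ∀ (c : ℝ≥0∞) (b : Site d), Measurable fun V₁ => ‖G₁ V₁ x b‖ₑ ^ s * c :=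
    fun c b => (hG₁m b).mul_const c
  calc fracMoment ν s G x y
      = ∫⁻ V₁, ∫⁻ W, ‖G (gluePot D V₁ W) x y‖ₑ ^ s ∂P ∂P := lintegral_gluePot ν D (hGm x y)
    _ = ∫⁻ V₁, ∫⁻ V₂, ∫⁻ V₀, ‖G (pot V₁ V₂ V₀) x y‖ₑ ^ s ∂P ∂P ∂P :=
        lintegral_congr fun V₁ => lintegral_gluePot ν Sᶜ (hV₂m V₁)
    _ ≤ ∫⁻ V₁, κ ^ 2 * ∑ p ∈ shellPairs x r, ∑ q ∈ shellPairs x (r + 1),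
          ‖G₁ V₁ x p.1‖ₑ ^ s * (fracMoment ν s G q.2 y * A₀) ∂P := lintegral_mono houter
    _ = _ := by
        rw [lintegral_const_mul _ (Finset.measurable_fun_sum _ fun p _ =>
            Finset.measurable_fun_sum _ fun q _ => hm2 _ _),
          lintegral_finsetSum _ fun p _ =>
            Finset.measurable_fun_sum _ fun q _ => hm2 _ _, mul_assoc, Finset.mul_sum (a := A₀)]
        congr 1
        refine Finset.sum_congr rfl fun p _ => ?_
        rw [lintegral_finsetSum _ fun q _ => hm2 _ _, Finset.mul_sum]
        refine Finset.sum_congr rfl fun q _ => ?_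
        rw [lintegral_mul_const _ (hG₁m _)]
        change fracMoment ν s G₁ x p.1 * _ = _
        ring

/-- Iterating a contractive bound gives exponential decay. -/
theorem le_pow_of_contraction {d : ℕ} {f : Site d → Site d → ℝ≥0∞} {A : ℝ≥0∞} {R : ℕ}
    (hA : ∀ x y, f x y ≤ A)
    (hf : ∀ x y, R ≤ siteNorm (x - y) → ∀ M, (∀ b, siteNorm (x - b) ≤ R → f b y ≤ M) →
      f x y ≤ 2⁻¹ * M) (n : ℕ) :
    ∀ x y, n * R ≤ siteNorm (x - y) → f x y ≤ 2⁻¹ ^ n * A := by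
  induction n with
  | zero => simpa using hA
  | succ n ih =>
    intro x y hxy
    rw [pow_succ', mul_assoc]
    rw [add_mul, one_mul] at hxy
    refine hf x y (by omega) _ fun b hb => ih b y ?_
    have := siteNorm_sub_le x b y
    omega

/-- If the finite volume moments between the center of `Λ` and a shell are small, the moments in
infinite volume decay exponentially. -/
theorem fracMoment_green_le_pow {d : ℕ} {ν : Measure ℝ} [IsProbabilityMeasure ν]
    {s K : ℝ} {C : ℝ≥0∞} (hC : PoleBound ν s K C) (hs : 0 < s) (hs1 : s ≤ 1) {z : ℂ}
    (hz : z.im ≠ 0) {Λ : Finset (Site d)} {r N : ℕ} (hΛ : siteBall 0 r ⊆ Λ)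
    (hN : ∀ x : Site d, (shellPairs x r).card ≤ N)
    (hN' : ∀ x : Site d, (shellPairs x (r + 1)).card ≤ N) {β : ℝ≥0∞}
    (hβ : geomConst s K ^ 2 * (3 * (2 ^ s * C)) * (N * N * β) ≤ 2⁻¹)
    (hsmall : ∀ a ∈ shell 0 r,
      fracMoment ν s (fun V => finGreen Λ (clampPot K V) z) 0 a ≤ β)
    (n : ℕ) (x y : Site d) (hxy : n * (r + 2) ≤ siteNorm (x - y)) :
    fracMoment ν s (fun V => green (clampPot K V) z) x y ≤ 2⁻¹ ^ n * (3 * (2 ^ s * C)) := by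
  have hG := greenFamily_green (d := d) hC.nonneg hz
  have hF := greenFamily_finGreen (d := d) Λ K hz
  refine le_pow_of_contraction (R := r + 2) (f := fracMoment ν s _)
    (fun x y => hG.lintegral_le hC hs x y) ?_ n x y hxy
  intro x y hxy M hM
  have hms : Measurable fun (V : Site d → ℝ) a => V (a + x) :=
    (measurePreserving_translatePot ν x).measurable
  have h1 := hG.fracMoment_le hC hs hs1 (x := x) (y := y) (r := r)
    -- The finite volume kernel is moved from the origin to `x` together with the potential;
    -- translation invariance of the law keeps its moments.
    (Ω₁ := {a | a - x ∈ (↑Λ : Set (Site d))})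
    (G₁ := fun V a b => finGreen Λ (clampPot K fun c => V (c + x)) z (a - x) (b - x))
    (fun a => (hF.meas _ _).comp hms)
    (fun V => IsGreen.translate (v := clampPot K V) x (hF.green fun c => V (c + x)))
    (Set.subset_univ _)
    (fun a ha => hΛ (by
      rw [Finset.mem_coe, mem_siteBall] at ha
      simpa [mem_siteBall] using ha))
    (fun hmem => by
      rw [mem_siteBall, siteNorm_sub_comm] at hmem
      omega)
  have h2 : ∀ a ∈ shell x r, fracMoment ν s (fun V a b =>
      finGreen Λ (clampPot K fun c => V (c + x)) z (a - x) (b - x)) x a ≤ β := by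
    intro a ha
    have h3 := hsmall (a - x) (by
      rw [mem_shell] at ha ⊢
      simpa using ha)
    refine le_trans (le_of_eq ?_) h3
    unfold fracMoment
    rw [← (measurePreserving_translatePot ν x).lintegral_comp
      ((hF.meas 0 (a - x)).enorm.pow_const s)]
    simp only [sub_self]
  refine h1.trans ?_
  calc _ ≤ geomConst s K ^ 2 * (3 * (2 ^ s * C)) *
        ∑ p ∈ shellPairs x r, ∑ q ∈ shellPairs x (r + 1), β * M := by
        gcongr with p hp q hq
        · exact h2 _ (mem_shellPairs.1 hp).1.1
        · refine hM _ ?_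
          have := (mem_shell.1 (mem_shellPairs.1 hq).1.2).2
          rwa [siteNorm_sub_comm] at this
    _ ≤ geomConst s K ^ 2 * (3 * (2 ^ s * C)) * (N * (N * (β * M))) := by
        simp only [Finset.sum_const, nsmul_eq_mul]
        gcongr
        · exact hN x
        · exact hN' x
    _ = geomConst s K ^ 2 * (3 * (2 ^ s * C)) * (N * N * β) * M := by ring
    _ ≤ _ := by gcongr

/-! ### Dependence of finite volume moments on the energy -/

-- By `one_le_sum_finGreen` a zero determinant makes the sum of the Green function entries at `E +
-- it` at least `1/t`. Markov's inequality for the `s`-th power and the a priori bound give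
-- probability at most a constant times `t^s`, for every `t > 0`.
open Classical in
theorem ae_det_finHamSub_ne_zero {d : ℕ} {ν : Measure ℝ} [IsProbabilityMeasure ν]
    {s K : ℝ} {C : ℝ≥0∞} (hC : PoleBound ν s K C) (hCtop : C ≠ ∞) (hs : 0 < s) (hs1 : s ≤ 1)
    (Λ : Finset (Site d)) (E : ℝ) :
    ∀ᵐ V ∂(potentialLaw d ν), (finHamSub Λ (clampPot K V) E).det ≠ 0 := by
  set c : ℝ≥0∞ := ∑ x ∈ Λ, ∑ y ∈ Λ, 3 * (2 ^ s * C) with hc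
  have hctop : c ≠ ∞ := by
    refine ENNReal.sum_ne_top.2 fun x _ => ENNReal.sum_ne_top.2 fun y _ => ?_
    exact ENNReal.mul_ne_top (by simp)
      (ENNReal.mul_ne_top (ENNReal.rpow_ne_top_of_nonneg hs.le (by simp)) hCtop)
  rw [ae_iff]
  simp only [ne_eq, not_not]
  have hbound : ∀ t : ℝ, 0 < t →
      potentialLaw d ν {V | (finHamSub Λ (clampPot K V) E).det = 0} ≤
        ENNReal.ofReal t ^ s * c := by
    intro t ht
    set z : ℂ := E + t * Complex.I with hz
    have hzim : z.im ≠ 0 := by simpa [hz] using ht.ne'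
    have hF := greenFamily_finGreen (d := d) Λ K hzim
    have hm : ∀ x y, Measurable fun V => ‖finGreen Λ (clampPot K V) z x y‖ₑ ^ s := fun x y =>
      (hF.meas x y).enorm.pow_const s
    have hm' : Measurable fun V => ENNReal.ofReal t ^ s *
        ∑ x ∈ Λ, ∑ y ∈ Λ, ‖finGreen Λ (clampPot K V) z x y‖ₑ ^ s :=
      (Finset.measurable_fun_sum _ fun x _ => Finset.measurable_fun_sum _ fun y _ =>
        hm x y).const_mul _
    have hsub : {V : Site d → ℝ | (finHamSub Λ (clampPot K V) E).det = 0} ⊆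
        {V | 1 ≤ ENNReal.ofReal t ^ s *
          ∑ x ∈ Λ, ∑ y ∈ Λ, ‖finGreen Λ (clampPot K V) z x y‖ₑ ^ s} := by
      intro V hV
      have h1 := one_le_sum_finGreen Λ (clampPot K V) hV ht.ne'
      rw [← hz, abs_of_pos ht] at h1
      have h2 : 1 ≤ ENNReal.ofReal t *
          ∑ x ∈ Λ, ∑ y ∈ Λ, ‖finGreen Λ (clampPot K V) z x y‖ₑ := by
        have h3 := ENNReal.ofReal_le_ofReal h1
        rw [ENNReal.ofReal_one, ENNReal.ofReal_mul ht.le,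
          ENNReal.ofReal_sum_of_nonneg fun _ _ => by positivity] at h3
        refine h3.trans_eq ?_
        congr 1
        refine Finset.sum_congr rfl fun x _ => ?_
        rw [ENNReal.ofReal_sum_of_nonneg fun _ _ => by positivity]
        exact Finset.sum_congr rfl fun y _ => ofReal_norm _
      calc (1 : ℝ≥0∞) ≤ (ENNReal.ofReal t *
            ∑ x ∈ Λ, ∑ y ∈ Λ, ‖finGreen Λ (clampPot K V) z x y‖ₑ) ^ s :=
            ENNReal.one_le_rpow h2 hs
        _ ≤ _ := by
            rw [ENNReal.mul_rpow_of_nonneg _ _ hs.le]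
            gcongr
            refine (ENNReal.sum_rpow_le_of_le_one _ _ hs hs1).trans ?_
            gcongr
            exact ENNReal.sum_rpow_le_of_le_one _ _ hs hs1
    refine (measure_mono hsub).trans ?_
    have h4 := mul_meas_ge_le_lintegral₀ (μ := potentialLaw d ν) hm'.aemeasurable 1
    rw [one_mul] at h4
    refine h4.trans ?_
    rw [lintegral_const_mul _ (Finset.measurable_fun_sum _ fun x _ =>
        Finset.measurable_fun_sum _ fun y _ => hm x y),
      lintegral_finsetSum _ fun x _ => Finset.measurable_fun_sum _ fun y _ => hm x y]
    refine mul_le_mul' le_rfl (Finset.sum_le_sum fun x _ => ?_)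
    rw [lintegral_finsetSum _ fun y _ => hm x y]
    refine Finset.sum_le_sum fun y _ => ?_
    exact hF.lintegral_le hC hs x y
  have hlim : Tendsto (fun t : ℝ => ENNReal.ofReal t ^ s * c) (𝓝[>] 0) (𝓝 0) := by
    have h1 : Tendsto (fun t : ℝ => ENNReal.ofReal t ^ s) (𝓝[>] 0) (𝓝 0) := by
      have h2 : Tendsto (fun t : ℝ => ENNReal.ofReal t ^ s) (𝓝 0) (𝓝 (ENNReal.ofReal 0 ^ s)) :=
        ((ENNReal.continuous_rpow_const (y := s)).comp ENNReal.continuous_ofReal).tendsto 0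
      rw [ENNReal.ofReal_zero, ENNReal.zero_rpow_of_pos hs] at h2
      exact h2.mono_left nhdsWithin_le_nhds
    simpa using ENNReal.Tendsto.mul_const h1 (Or.inr hctop)
  refine le_antisymm (ge_of_tendsto hlim ?_) zero_le
  filter_upwards [self_mem_nhdsWithin] with t ht using hbound t ht

/-- Above the level `M` the lower power is traded for the higher one, with a factor `M ^ (s - t)`
that is small for large `M`. This separates a bounded part, open to dominated convergence, from a
uniformly small tail. -/
theorem ENNReal.rpow_le_min_add {X M : ℝ≥0∞} (hM : M ≠ 0) (hX : X ≠ ∞) {s t : ℝ} (hs : 0 < s)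
    (hst : s < t) : X ^ s ≤ min (X ^ s) (M ^ s) + M ^ (s - t) * X ^ t := by
  rcases le_total X M with h | h
  · rw [min_eq_left (by gcongr)]
    exact le_self_add
  · refine le_add_left ?_
    have hX0 : X ≠ 0 := fun h0 => hM (le_antisymm (h0 ▸ h) zero_le)
    have h1 : X ^ s = X ^ (s - t) * X ^ t := by
      rw [← ENNReal.rpow_add _ _ hX0 hX]
      congr 1
      ring
    rw [h1]
    refine mul_le_mul' ?_ le_rfl
    rw [← neg_sub t s, ENNReal.rpow_neg, ENNReal.rpow_neg, ENNReal.inv_le_inv]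
    exact ENNReal.rpow_le_rpow h (by linarith)

/-- Upper semicontinuity of the finite volume moments at real energies. -/
theorem eventually_fracMoment_finGreen_le {d : ℕ} {ν : Measure ℝ} [IsProbabilityMeasure ν]
    {s t K : ℝ} {C C' : ℝ≥0∞} (hC : PoleBound ν s K C) (hCtop : C ≠ ∞)
    (hC' : PoleBound ν t K C') (hCtop' : C' ≠ ∞) (hs : 0 < s) (hst : s < t) (ht1 : t < 1)
    (Λ : Finset (Site d)) (E : ℝ) (x y : Site d) {β β' : ℝ≥0∞} (hββ' : β < β')
    (h : fracMoment ν s (fun V => finGreen Λ (clampPot K V) E) x y ≤ β) :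
    ∀ᶠ z in 𝓝[{z : ℂ | z.im ≠ 0}] (E : ℂ),
      fracMoment ν s (fun V => finGreen Λ (clampPot K V) z) x y ≤ β' := by
  have hs1 : s < 1 := hst.trans ht1
  set A : ℝ≥0∞ := 3 * (2 ^ t * C') with hA
  have hAtop : A ≠ ∞ := ENNReal.mul_ne_top (by simp)
    (ENNReal.mul_ne_top (ENNReal.rpow_ne_top_of_nonneg (hs.trans hst).le (by simp)) hCtop')
  obtain ⟨γ, hγ1, hγ2⟩ := exists_between hββ'
  have hε : 0 < β' - γ := tsub_pos_of_lt hγ2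
  -- the truncation level
  have hlim : Tendsto (fun n : ℕ => ((n : ℝ≥0∞)) ^ (s - t) * A) atTop (𝓝 0) := by
    have h1 : Tendsto (fun n : ℕ => ((n : ℝ≥0∞)) ^ (s - t)) atTop (𝓝 0) := by
      have h2 := (ENNReal.continuous_rpow_const (y := t - s)).tendsto 0
      rw [ENNReal.zero_rpow_of_pos (by linarith)] at h2
      refine (h2.comp ENNReal.tendsto_inv_nat_nhds_zero).congr fun n => ?_
      rw [Function.comp, ENNReal.inv_rpow, ← ENNReal.rpow_neg, neg_sub]
    simpa using ENNReal.Tendsto.mul_const h1 (Or.inr hAtop)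
  -- The room between `β` and `β'` is split at `γ`: the truncated moment stays below `γ` near `E`,
  -- and the level `n` is chosen so that the tail costs at most `β' - γ`.
  obtain ⟨n, hn, hn0⟩ := ((hlim.eventually (gt_mem_nhds hε)).and (eventually_gt_atTop 0)).exists
  set M : ℝ≥0∞ := (n : ℝ≥0∞) with hM
  have hM0 : M ≠ 0 := by simpa [hM] using hn0.ne'
  have hMtop : M ≠ ∞ := by simp [hM]
  have hm : ∀ z : ℂ, Measurable fun V => finGreen Λ (clampPot K V) z x y := fun z =>
    (measurable_finGreen Λ z x y).comp (measurable_pi_lambda _ (measurable_clampPot K))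
  have htr : Tendsto (fun z : ℂ => ∫⁻ V, min (‖finGreen Λ (clampPot K V) z x y‖ₑ ^ s) (M ^ s)
      ∂(potentialLaw d ν)) (𝓝[{z : ℂ | z.im ≠ 0}] (E : ℂ))
      (𝓝 (∫⁻ V, min (‖finGreen Λ (clampPot K V) E x y‖ₑ ^ s) (M ^ s) ∂(potentialLaw d ν))) := by
    refine tendsto_lintegral_filter_of_dominated_convergence (fun _ => M ^ s)
      (Eventually.of_forall fun z => ((hm z).enorm.pow_const s).min measurable_const)
      (Eventually.of_forall fun z => ae_of_all _ fun V => min_le_right _ _) ?_ ?_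
    · simpa using ENNReal.rpow_ne_top_of_nonneg hs.le hMtop
    · filter_upwards [ae_det_finHamSub_ne_zero hC hCtop hs hs1.le Λ E] with V hV
      have h1 := (tendsto_finGreen Λ (clampPot K V) x y hV).mono_left
        (nhdsWithin_le_nhds (s := {z : ℂ | z.im ≠ 0}))
      exact (((ENNReal.continuous_rpow_const (y := s)).tendsto _).comp h1.enorm).min
        tendsto_const_nhds
  have hlt : ∫⁻ V, min (‖finGreen Λ (clampPot K V) E x y‖ₑ ^ s) (M ^ s)
      ∂(potentialLaw d ν) < γ :=
    (lintegral_mono fun V => min_le_left _ _).trans_lt (h.trans_lt hγ1)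
  filter_upwards [htr.eventually (gt_mem_nhds hlt), self_mem_nhdsWithin] with z hz hzim
  calc _ ≤ ∫⁻ V, (min (‖finGreen Λ (clampPot K V) z x y‖ₑ ^ s) (M ^ s) +
        M ^ (s - t) * ‖finGreen Λ (clampPot K V) z x y‖ₑ ^ t) ∂(potentialLaw d ν) :=
        lintegral_mono fun V => ENNReal.rpow_le_min_add hM0 (by simp) hs hst
    _ = ∫⁻ V, min (‖finGreen Λ (clampPot K V) z x y‖ₑ ^ s) (M ^ s) ∂(potentialLaw d ν) +
        M ^ (s - t) * ∫⁻ V, ‖finGreen Λ (clampPot K V) z x y‖ₑ ^ t ∂(potentialLaw d ν) := by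
        rw [lintegral_add_left (((hm z).enorm.pow_const s).min measurable_const),
          lintegral_const_mul _ ((hm z).enorm.pow_const t)]
    _ ≤ γ + M ^ (s - t) * A := by
        gcongr
        exact (greenFamily_finGreen Λ K hzim).lintegral_le hC' (hs.trans hst) x y
    _ ≤ γ + (β' - γ) := by gcongr
    _ = β' := add_tsub_cancel_of_le hγ2.le

/-- Fatou's lemma for the finite volume moments at real energies. -/
theorem fracMoment_finGreen_le_of_eventually {d : ℕ} {ν : Measure ℝ} [IsProbabilityMeasure ν]
    {s K : ℝ} {C : ℝ≥0∞} (hC : PoleBound ν s K C) (hCtop : C ≠ ∞) (hs : 0 < s) (hs1 : s < 1)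
    (Λ : Finset (Site d)) (E : ℝ) (x y : Site d) {β : ℝ≥0∞}
    (h : ∀ᶠ η : ℝ in 𝓝[>] 0,
      fracMoment ν s (fun V => finGreen Λ (clampPot K V) (E + η * Complex.I)) x y ≤ β) :
    fracMoment ν s (fun V => finGreen Λ (clampPot K V) E) x y ≤ β := by
  obtain ⟨u, -, hu0, hu⟩ := exists_seq_strictAnti_tendsto (0 : ℝ)
  have hu' : Tendsto u atTop (𝓝[>] 0) :=
    tendsto_nhdsWithin_iff.2 ⟨hu, Eventually.of_forall hu0⟩
  have hm : ∀ z : ℂ, Measurable fun V => ‖finGreen Λ (clampPot K V) z x y‖ₑ ^ s := fun z =>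
    ((measurable_finGreen Λ z x y).comp
      (measurable_pi_lambda _ (measurable_clampPot K))).enorm.pow_const s
  have hz : Tendsto (fun n => (E : ℂ) + u n * Complex.I) atTop (𝓝 (E : ℂ)) := by
    have h1 : Tendsto (fun n => (u n : ℂ)) atTop (𝓝 ((0 : ℝ) : ℂ)) :=
      (Complex.continuous_ofReal.tendsto 0).comp hu
    simpa using (h1.mul_const Complex.I).const_add (E : ℂ)
  calc _ = ∫⁻ V, liminf (fun n =>
        ‖finGreen Λ (clampPot K V) (E + u n * Complex.I) x y‖ₑ ^ s) atTop
          ∂(potentialLaw d ν) := by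
        refine lintegral_congr_ae ?_
        filter_upwards [ae_det_finHamSub_ne_zero hC hCtop hs hs1.le Λ E] with V hV
        have h1 := (tendsto_finGreen Λ (clampPot K V) x y hV).comp hz
        exact ((((ENNReal.continuous_rpow_const (y := s)).tendsto _).comp h1.enorm).liminf_eq).symm
    _ ≤ liminf (fun n => ∫⁻ V, ‖finGreen Λ (clampPot K V) (E + u n * Complex.I) x y‖ₑ ^ s
          ∂(potentialLaw d ν)) atTop := lintegral_liminf_le fun n => hm _
    _ ≤ β := by
        refine liminf_le_of_le (by isBoundedDefault) fun b hb => ?_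
        obtain ⟨n, h1, h2⟩ := (hb.and (hu'.eventually h)).exists
        exact h1.trans h2

/-! ### Exponential decay -/

theorem PoleBound.offAxisMoment_eq {d : ℕ} {ν : Measure ℝ} [IsProbabilityMeasure ν]
    {s K : ℝ} {C : ℝ≥0∞} (hC : PoleBound ν s K C) (z : ℂ) (x y : Site d) :
    offAxisMoment ν s z x y = fracMoment ν s (fun V => green (clampPot K V) z) x y := by
  refine lintegral_congr_ae ?_
  filter_upwards [ae_abs_le_potentialLaw (d := d) ν hC.ae_le] with V hV
  simp only [clampPot_eq_self hV]

theorem PoleBound.finMoment_eq {d : ℕ} {ν : Measure ℝ} [IsProbabilityMeasure ν]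
    {s K : ℝ} {C : ℝ≥0∞} (hC : PoleBound ν s K C) (Λ : Finset (Site d)) (z : ℂ) (x y : Site d) :
    finMoment ν s Λ z x y = fracMoment ν s (fun V => finGreen Λ (clampPot K V) z) x y := by
  refine lintegral_congr_ae ?_
  filter_upwards [ae_abs_le_potentialLaw (d := d) ν hC.ae_le] with V hV
  simp only [clampPot_eq_self hV]

theorem moment_le_of_forall_ne_zero {d : ℕ} {ν : Measure ℝ} {s E : ℝ} {x y : Site d}
    {B : ℝ≥0∞} (h : ∀ η : ℝ, η ≠ 0 → offAxisMoment ν s (E + η * Complex.I) x y ≤ B) (η : ℝ) :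
    moment ν s E η x y ≤ B := by
  unfold moment
  split_ifs with hη
  · refine limsup_le_of_le (by isBoundedDefault) ?_
    filter_upwards [self_mem_nhdsWithin] with ε hε using h ε (ne_of_gt hε)
  · exact h η hη

/-- The decay of the moments away from the real axis. -/
theorem PoleBound.offAxisMoment_le {d : ℕ} {ν : Measure ℝ} [IsProbabilityMeasure ν]
    {s K : ℝ} {C : ℝ≥0∞} (hC : PoleBound ν s K C) (hs : 0 < s) {E η δ R : ℝ} (hδ : 0 < δ)
    (hη : δ ≤ |η|) (hR : 4 * d + K + |E| ≤ R) (x y : Site d) :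
    offAxisMoment ν s (E + η * Complex.I) x y ≤
      ENNReal.ofReal ((δ⁻¹ * ctRate R δ ^ siteNorm (x - y)) ^ s) := by
  rw [hC.offAxisMoment_eq]
  calc _ ≤ ∫⁻ _, ENNReal.ofReal ((δ⁻¹ * ctRate R δ ^ siteNorm (x - y)) ^ s)
        ∂(potentialLaw d ν) := by
        refine lintegral_mono fun V => ?_
        have h1 := norm_green_le hC.nonneg (abs_clampPot_le hC.nonneg V) hδ hη hR x y
        have h2 := ctRate_nonneg (R := R) hδ
        rw [← ENNReal.ofReal_rpow_of_nonneg (by positivity) hs.le]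
        gcongr
        rw [← ofReal_norm]
        exact ENNReal.ofReal_le_ofReal h1
    _ = _ := by simp

/-- Geometric decay near the real axis, together with the decay away from it, yields
exponential decay. -/
theorem expDecayOn_of_pow {d : ℕ} {ν : Measure ℝ} [IsProbabilityMeasure ν]
    {s K : ℝ} {C : ℝ≥0∞} (hC : PoleBound ν s K C) (hs : 0 < s) {E δ : ℝ} (hδ : 0 < δ)
    {A : ℝ≥0∞} (hA : A ≠ ∞) {R : ℕ} (hR : 0 < R)
    (h : ∀ E' η : ℝ, |E' - E| < δ → η ≠ 0 → |η| < δ → ∀ (n : ℕ) (x y : Site d),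
      n * R ≤ siteNorm (x - y) →
        offAxisMoment ν s (E' + η * Complex.I) x y ≤ 2⁻¹ ^ n * A) :
    ExpDecayOn d ν s (E - δ) (E + δ) := by
  set R' : ℝ := 4 * d + K + (|E| + δ) with hR'
  set q : ℝ := max (ctRate R' δ) 2⁻¹ with hq
  have hq0 : 0 < q := lt_max_of_lt_right (by norm_num)
  have hq1 : q < 1 := max_lt (ctRate_lt_one hδ) (by norm_num)
  have hlq : 0 < -Real.log q := neg_pos.2 (Real.log_neg hq0 hq1)
  have hl2 : 0 < Real.log 2 := Real.log_pos (by norm_num)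
  have hRpos : (0 : ℝ) < R := Nat.cast_pos.2 hR
  -- The first rate is that of the contraction by `1/2` per `R` steps, used for `|η| < δ`; the
  -- second is that of the Neumann series, used for `|η| ≥ δ`.
  set m : ℝ := min (Real.log 2 / R) (s * -Real.log q) with hm
  have hmpos : 0 < m := lt_min (by positivity) (by positivity)
  refine ⟨2 * A.toReal + δ⁻¹ ^ s, m, hmpos, fun E' hE' η x y => ?_⟩
  have hEE : |E' - E| < δ := abs_lt.2 ⟨by linarith [hE'.1], by linarith [hE'.2]⟩
  refine moment_le_of_forall_ne_zero (fun η hη => ?_) η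
  rw [latNorm_eq_siteNorm]
  set k := siteNorm (x - y) with hk
  by_cases hηδ : |η| < δ
  · have hdiv := Nat.div_add_mod k R
    have hmod := Nat.mod_lt k hR
    refine (h E' η hEE hη hηδ (k / R) x y (Nat.div_mul_le_self k R)).trans ?_
    have h2 : (2⁻¹ : ℝ≥0∞) ^ (k / R) = ENNReal.ofReal (2⁻¹ ^ (k / R)) := by
      rw [ENNReal.ofReal_pow (by norm_num), ENNReal.ofReal_inv_of_pos (by norm_num)]
      simp
    have hA' : 2⁻¹ ^ (k / R) * A = ENNReal.ofReal (2⁻¹ ^ (k / R) * A.toReal) := by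
      rw [ENNReal.ofReal_mul (by positivity), ENNReal.ofReal_toReal hA, h2]
    rw [hA']
    refine ENNReal.ofReal_le_ofReal ?_
    -- The factor 2 compensates for rounding `k / R` down to an integer.
    have h3 : (2⁻¹ : ℝ) ^ (k / R) ≤ 2 * Real.exp (-m * k) := by
      have h4 : (2⁻¹ : ℝ) ^ (k / R) = Real.exp (-Real.log 2 * (k / R : ℕ)) := by
        rw [mul_comm, Real.exp_nat_mul, Real.exp_neg, Real.exp_log (by norm_num)]
      have h5 : (2 : ℝ) = Real.exp (Real.log 2) := (Real.exp_log (by norm_num)).symm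
      rw [h4]
      conv_rhs => rw [h5]
      rw [← Real.exp_add]
      refine Real.exp_le_exp.2 ?_
      have h6 : (k : ℝ) / R ≤ (k / R : ℕ) + 1 := by
        rw [div_le_iff₀ hRpos]
        have : k ≤ (k / R + 1) * R := by
          rw [add_mul, one_mul]
          nlinarith
        exact_mod_cast this
      have h7 : m * k ≤ Real.log 2 * (k / R) := by
        calc m * k ≤ Real.log 2 / R * k := by
              gcongr
              exact min_le_left _ _
          _ = _ := by ring
      nlinarith
    have h8 := Real.exp_pos (-m * k)
    have h9 : 0 ≤ δ⁻¹ ^ s := by positivity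
    calc (2⁻¹ : ℝ) ^ (k / R) * A.toReal ≤ 2 * Real.exp (-m * k) * A.toReal := by gcongr
      _ = 2 * A.toReal * Real.exp (-m * k) := by ring
      _ ≤ _ := by
          gcongr
          linarith
  · refine (hC.offAxisMoment_le hs hδ (not_lt.1 hηδ) (R := R') ?_ x y).trans ?_
    · have : |E'| ≤ |E| + δ := by
        have := abs_sub_abs_le_abs_sub E' E
        linarith
      linarith
    refine ENNReal.ofReal_le_ofReal ?_
    have h1 := ctRate_nonneg (R := R') hδ
    calc (δ⁻¹ * ctRate R' δ ^ k) ^ s ≤ (δ⁻¹ * q ^ k) ^ s := by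
          gcongr
          exact le_max_left _ _
      _ = δ⁻¹ ^ s * Real.exp (-(s * -Real.log q) * k) := by
          rw [Real.mul_rpow (by positivity) (by positivity), ← Real.rpow_natCast,
            ← Real.rpow_mul hq0.le, Real.rpow_def_of_pos hq0]
          congr 2
          ring
      _ ≤ δ⁻¹ ^ s * Real.exp (-m * k) := by
          gcongr
          exact min_le_right _ _
      _ ≤ _ := by
          gcongr
          linarith [ENNReal.toReal_nonneg (a := A)]

/-- The finite volume criterion. -/
theorem expDecay_of_finGreen_small {d : ℕ} {ν : Measure ℝ} [IsProbabilityMeasure ν]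
    {s t K : ℝ} {C C' : ℝ≥0∞} (hC : PoleBound ν s K C) (hCtop : C ≠ ∞)
    (hC' : PoleBound ν t K C') (hCtop' : C' ≠ ∞) (hs : 0 < s) (hst : s < t) (ht1 : t < 1)
    {E : ℝ} {Λ : Finset (Site d)} {r N : ℕ} (hΛ : siteBall 0 r ⊆ Λ)
    (hN : ∀ x : Site d, (shellPairs x r).card ≤ N)
    (hN' : ∀ x : Site d, (shellPairs x (r + 1)).card ≤ N) {β β' : ℝ≥0∞} (hββ' : β < β')
    (hβ : geomConst s K ^ 2 * (3 * (2 ^ s * C)) * (N * N * β') ≤ 2⁻¹)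
    (hsmall : ∀ a ∈ shell 0 r,
      fracMoment ν s (fun V => finGreen Λ (clampPot K V) E) 0 a ≤ β) :
    ∃ a b : ℝ, E ∈ Set.Ioo a b ∧ ExpDecayOn d ν s a b := by
  have hev : ∀ᶠ z in 𝓝[{z : ℂ | z.im ≠ 0}] (E : ℂ), ∀ a ∈ shell 0 r,
      fracMoment ν s (fun V => finGreen Λ (clampPot K V) z) 0 a ≤ β' :=
    (Finset.eventually_all _).2 fun a ha => eventually_fracMoment_finGreen_le hC hCtop hC' hCtop' hs
      hst ht1 Λ E 0 a hββ' (hsmall a ha)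
  rw [eventually_nhdsWithin_iff, Metric.eventually_nhds_iff] at hev
  obtain ⟨ε, hε, hball⟩ := hev
  have hδ : 0 < ε / 2 := by positivity
  refine ⟨E - ε / 2, E + ε / 2, ⟨by linarith, by linarith⟩,
    expDecayOn_of_pow hC hs hδ (A := 3 * (2 ^ s * C)) ?_ (R := r + 2) (by omega) ?_⟩
  · exact ENNReal.mul_ne_top (by simp)
      (ENNReal.mul_ne_top (ENNReal.rpow_ne_top_of_nonneg hs.le (by simp)) hCtop)
  intro E' η hE' hη hηδ n x y hxy
  rw [hC.offAxisMoment_eq]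
  have hzim : (E' + η * Complex.I : ℂ).im ≠ 0 := by simpa using hη
  refine fracMoment_green_le_pow hC hs (hst.trans ht1).le hzim hΛ hN hN' hβ ?_ n x y hxy
  refine hball ?_ hzim
  rw [dist_eq_norm]
  have h1 : (E' + η * Complex.I - E : ℂ) = ((E' - E : ℝ) : ℂ) + (η : ℂ) * Complex.I := by
    push_cast
    ring
  rw [h1]
  refine (norm_add_le _ _).trans_lt ?_
  rw [norm_mul, Complex.norm_I, mul_one, Complex.norm_real, Complex.norm_real,
    Real.norm_eq_abs, Real.norm_eq_abs]
  linarith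

/-! ### Radii, counting and the choice of constants. -/

theorem siteBall_subset_latBox {d : ℕ} {L : ℝ} {r : ℕ} (hr : (r : ℝ) ≤ L) :
    siteBall (0 : Site d) r ⊆ latBox d L := by
  intro a ha
  rw [mem_siteBall, sub_zero] at ha
  rw [latBox, Fintype.mem_piFinset]
  intro j
  have h1 : (a j).natAbs ≤ siteNorm a :=
    Finset.single_le_sum (f := fun j => (a j).natAbs) (fun _ _ => Nat.zero_le _)
      (Finset.mem_univ j)
  have h2 : |(a j : ℝ)| ≤ L := by
    rw [← Int.cast_abs, ← Nat.cast_natAbs]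
    exact (Nat.cast_le.2 (h1.trans ha)).trans hr
  obtain ⟨h3, h4⟩ := abs_le.1 h2
  rw [Finset.mem_Icc, Int.ceil_le, Int.le_floor]
  exact ⟨h3, h4⟩

theorem card_shellPairs_le_pow {n r : ℕ} {L : ℝ} (hL : 1 ≤ L) (hr : (r : ℝ) ≤ L)
    (x : Site (n + 1)) :
    ((shellPairs x r).card : ℝ) ≤ (2 * n + 3) * 4 * 5 ^ n * L ^ n := by
  have h1 : ((shellPairs x r).card : ℝ) ≤ ((2 * n + 3) * (4 * (2 * r + 3) ^ n) : ℕ) :=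
    Nat.cast_le.2 (card_shellPairs_le x r)
  refine h1.trans ?_
  push_cast
  calc ((2 : ℝ) * n + 3) * (4 * (2 * r + 3) ^ n) ≤ (2 * n + 3) * (4 * (5 * L) ^ n) := by
        gcongr
        linarith
    _ = _ := by
        rw [mul_pow]
        ring

theorem mem_annulus_of_mem_shell {d : ℕ} {L : ℝ} {r : ℕ} (h1 : L / 2 ≤ r) (h2 : (r + 1 : ℝ) ≤ L)
    {a : Site d} (ha : a ∈ shell 0 r) : a ∈ annulus d L := by
  rw [mem_shell, sub_zero] at ha
  rw [annulus, Set.mem_ofPred_eq, latNorm_eq_siteNorm]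
  refine ⟨h1.trans (Nat.cast_le.2 ha.1), le_trans ?_ h2⟩
  exact_mod_cast ha.2

/-- Smallness of the infinite volume moments on a shell implies smallness of the finite volume
moments outside that shell. -/
theorem PoleBound.fracMoment_finGreen_le {d : ℕ} {ν : Measure ℝ} [IsProbabilityMeasure ν]
    {s K : ℝ} {C : ℝ≥0∞} (hC : PoleBound ν s K C) (hs : 0 < s) (hs1 : s ≤ 1) {z : ℂ}
    (hz : z.im ≠ 0) {Λ : Finset (Site d)} {ρ : ℕ} (hΛ : siteBall 0 ρ ⊆ Λ) {β : ℝ≥0∞}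
    (hβ : ∀ w ∈ shell (0 : Site d) ρ, offAxisMoment ν s z 0 w ≤ β) {a : Site d}
    (ha : a ∉ siteBall 0 ρ) :
    fracMoment ν s (fun V => finGreen Λ (clampPot K V) z) 0 a ≤
      geomConst s K * (3 * (2 ^ s * C)) * ((shellPairs (0 : Site d) ρ).card * β) := by
  have hG := greenFamily_green (d := d) hC.nonneg hz
  refine ((greenFamily_finGreen Λ K hz).fracMoment_le_inner hC hs hs1 (Ω₁ := Set.univ)
    (fun b => hG.meas 0 b) hG.green (Finset.coe_subset.2 hΛ) (Set.subset_univ _) ha).trans ?_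
  gcongr
  rw [← nsmul_eq_mul]
  refine Finset.sum_le_card_nsmul _ _ _ fun p hp => ?_
  rw [← hC.offAxisMoment_eq]
  exact hβ _ (mem_shellPairs.1 hp).1.1

/-- Fast power-law decay of the fractional moments implies exponential localization. -/
theorem theorem4 (d : ℕ) (hd : 1 ≤ d) (ν : Measure ℝ) [IsProbabilityMeasure ν]
    (hν : IsRegularLaw ν) (s : ℝ) (hs : 0 < s) (hs1 : s < 1) :
    ∃ L₀ B₁ B₂ : ℝ, 0 < B₁ ∧ 0 < B₂ ∧
      ∀ E L : ℝ, L₀ ≤ L →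
        ((⨆ y ∈ annulus d L, finMoment ν s (latBox d L) E 0 y)
              ≤ ENNReal.ofReal (B₁ / L ^ (3 * (d - 1))) ∨
          (⨆ y ∈ annulus d L, moment ν s E 0 0 y)
              ≤ ENNReal.ofReal (B₂ / L ^ (4 * (d - 1)))) →
        ∃ a b : ℝ, E ∈ Set.Ioo a b ∧ ExpDecayOn d ν s a b := by
  obtain ⟨n, rfl⟩ : ∃ n, d = n + 1 := ⟨d - 1, by omega⟩
  rw [Nat.add_sub_cancel]
  obtain ⟨K, hK, hKν⟩ := hν.exists_support_bound
  obtain ⟨C, hCtop, hpole⟩ := exists_lintegral_enorm_add_rpow_neg_le hν hs hs1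
  obtain ⟨t, hst, ht1⟩ := exists_between hs1
  obtain ⟨C', hCtop', hpole'⟩ := exists_lintegral_enorm_add_rpow_neg_le hν (hs.trans hst) ht1
  have hC : PoleBound ν s K C := ⟨hK, hKν, hpole⟩
  have hC' : PoleBound ν t K C' := ⟨hK, hKν, hpole'⟩
  have hA : 3 * (2 ^ s * C) ≠ ∞ := ENNReal.mul_ne_top (by simp)
    (ENNReal.mul_ne_top (ENNReal.rpow_ne_top_of_nonneg hs.le (by simp)) hCtop)
  have hκ := geomConst_ne_top (K := K) hs
  set Θ : ℝ := (geomConst s K ^ 2 * (3 * (2 ^ s * C))).toReal with hΘ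
  have hΘ' : geomConst s K ^ 2 * (3 * (2 ^ s * C)) = ENNReal.ofReal Θ :=
    (ENNReal.ofReal_toReal (ENNReal.mul_ne_top (ENNReal.pow_ne_top hκ) hA)).symm
  have hΘ0 : 0 ≤ Θ := ENNReal.toReal_nonneg
  set Ψ : ℝ := (geomConst s K * (3 * (2 ^ s * C))).toReal with hΨ
  have hΨ' : geomConst s K * (3 * (2 ^ s * C)) = ENNReal.ofReal Ψ :=
    (ENNReal.ofReal_toReal (ENNReal.mul_ne_top hκ hA)).symm
  have hΨ0 : 0 ≤ Ψ := ENNReal.toReal_nonneg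
  set c : ℝ := (2 * n + 3) * 4 * 5 ^ n with hc
  have hc0 : 0 < c := by positivity
  -- The contraction factor is `Θ (c Lⁿ)²` times twice the assumed bound, hence at most `1/2` even
  -- with a power `Lⁿ` to spare. The doubling leaves room for moving off the real axis; `Θ + 1`
  -- avoids division by zero.
  set B₁ : ℝ := 1 / (4 * c ^ 2 * (Θ + 1)) with hB₁
  have hB₁0 : 0 < B₁ := by positivity
  -- One inner expansion costs `Ψ c Lⁿ`, and the factor 2 pays for passing from the upper limit to
  -- small `η`; the result is at most `B₁ / L^(3n)`.
  set B₂ : ℝ := B₁ / (2 * c * (Ψ + 1)) with hB₂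
  have hB₂0 : 0 < B₂ := by positivity
  refine ⟨10, B₁, B₂, hB₁0, hB₂0, fun E L hL hyp => ?_⟩
  have hL0 : 0 < L := by linarith
  have hL1 : 1 ≤ L := by linarith
  -- `ρ = ⌊L⌋ - 2` leaves room for the shells of radii `ρ` and `ρ + 1`, which reach out to distance
  -- `ρ + 2 ≤ L`. Their inner distance exceeds `L - 3`, hence `L / 2`, since `L ≥ 10`.
  obtain ⟨ρ, hρ1, hρ2⟩ : ∃ ρ : ℕ, (ρ + 2 : ℝ) ≤ L ∧ L < ρ + 3 := by
    have h1 := Nat.floor_le hL0.le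
    have h2 := Nat.lt_floor_add_one L
    have h3 : 2 ≤ ⌊L⌋₊ := Nat.le_floor (by norm_num; linarith)
    refine ⟨⌊L⌋₊ - 2, ?_, ?_⟩
    · rw [Nat.cast_sub h3]
      push_cast
      linarith
    · rw [Nat.cast_sub h3]
      push_cast
      linarith
  have hcard : ∀ r : ℕ, (r : ℝ) ≤ L → ∀ x : Site (n + 1),
      (shellPairs x r).card ≤ ⌊c * L ^ n⌋₊ := fun r hr x =>
    Nat.le_floor (card_shellPairs_le_pow hL1 hr x)
  have hN : ((⌊c * L ^ n⌋₊ : ℕ) : ℝ≥0∞) ≤ ENNReal.ofReal (c * L ^ n) := by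
    rw [← ENNReal.ofReal_natCast]
    exact ENNReal.ofReal_le_ofReal (Nat.floor_le (by positivity))
  have hcL : 0 ≤ c * L ^ n := by positivity
  have hβpos : 0 < B₁ / L ^ (3 * n) := by positivity
  have hsub : ∀ r : ℕ, (r : ℝ) ≤ L → siteBall (0 : Site (n + 1)) r ⊆ latBox (n + 1) L :=
    fun r hr => siteBall_subset_latBox hr
  have key : (∀ a ∈ shell (0 : Site (n + 1)) (ρ + 1),
      fracMoment ν s (fun V => finGreen (latBox (n + 1) L) (clampPot K V) E) 0 a ≤
        ENNReal.ofReal (B₁ / L ^ (3 * n))) →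
      ∃ a b : ℝ, E ∈ Set.Ioo a b ∧ ExpDecayOn (n + 1) ν s a b := by
    intro hsmall
    refine expDecay_of_finGreen_small hC hCtop hC' hCtop' hs hst ht1 (Λ := latBox (n + 1) L)
      (r := ρ + 1) (N := ⌊c * L ^ n⌋₊) (β' := ENNReal.ofReal (2 * (B₁ / L ^ (3 * n))))
      (hsub _ (by push_cast; linarith)) (hcard _ (by push_cast; linarith))
      (hcard _ (by push_cast; linarith))
      ((ENNReal.ofReal_lt_ofReal_iff (by positivity)).2 (by linarith)) ?_ hsmall
    rw [hΘ']
    calc _ ≤ ENNReal.ofReal Θ * (ENNReal.ofReal (c * L ^ n) * ENNReal.ofReal (c * L ^ n) *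
          ENNReal.ofReal (2 * (B₁ / L ^ (3 * n)))) := by gcongr
      _ = ENNReal.ofReal (Θ * (c * L ^ n * (c * L ^ n) * (2 * (B₁ / L ^ (3 * n))))) := by
          rw [← ENNReal.ofReal_mul hcL, ← ENNReal.ofReal_mul (mul_nonneg hcL hcL),
            ← ENNReal.ofReal_mul hΘ0]
      _ ≤ ENNReal.ofReal 2⁻¹ := by
          refine ENNReal.ofReal_le_ofReal ?_
          have h1 : (1 : ℝ) ≤ L ^ n := one_le_pow₀ hL1
          have h2 : Θ * (c * L ^ n * (c * L ^ n) * (2 * (B₁ / L ^ (3 * n)))) =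
              2⁻¹ * (Θ / (Θ + 1)) * (1 / L ^ n) := by
            rw [hB₁, mul_comm 3 n, pow_mul]
            field_simp
            ring
          rw [h2]
          have h3 : Θ / (Θ + 1) ≤ 1 := (div_le_one (by linarith)).2 (by linarith)
          have h4 : 1 / L ^ n ≤ 1 := (div_le_one (by linarith)).2 h1
          have h5 : 0 ≤ Θ / (Θ + 1) := by positivity
          have h6 : 0 ≤ 1 / L ^ n := by positivity
          nlinarith [mul_le_mul h3 h4 h6 zero_le_one]
      _ = 2⁻¹ := by
          rw [ENNReal.ofReal_inv_of_pos (by norm_num)]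
          simp
  rcases hyp with hyp | hyp
  · refine key fun a ha => ?_
    rw [← hC.finMoment_eq]
    exact (le_iSup₂ (f := fun y _ => finMoment ν s (latBox (n + 1) L) E 0 y) a
      (mem_annulus_of_mem_shell (by push_cast; linarith) (by push_cast; linarith) ha)).trans hyp
  · refine key fun a ha => ?_
    have hβ₂ : 0 < B₂ / L ^ (4 * n) := by positivity
    have hev : ∀ᶠ η : ℝ in 𝓝[>] 0, ∀ w ∈ shell (0 : Site (n + 1)) ρ,
        offAxisMoment ν s (E + η * Complex.I) 0 w ≤
          ENNReal.ofReal (2 * (B₂ / L ^ (4 * n))) := by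
      refine (Finset.eventually_all _).2 fun w hw => ?_
      have h1 := (le_iSup₂ (f := fun y _ => moment ν s E 0 0 y) w
        (mem_annulus_of_mem_shell (by linarith) (by linarith) hw)).trans hyp
      rw [moment, if_pos rfl] at h1
      have h2 := h1.trans_lt ((ENNReal.ofReal_lt_ofReal_iff (q := 2 * (B₂ / L ^ (4 * n)))
        (by positivity)).2 (by linarith))
      exact (eventually_lt_of_limsup_lt h2).mono fun η hη => hη.le
    -- The expansion is made at `η > 0`, where the infinite volume resolvent exists, and Fatou's
    -- lemma then carries the finite volume bound to the real energy.
    refine fracMoment_finGreen_le_of_eventually hC hCtop hs hs1 _ E 0 a ?_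
    filter_upwards [hev, self_mem_nhdsWithin] with η hη hη0
    have hzim : (E + η * Complex.I : ℂ).im ≠ 0 := by simpa using (ne_of_gt hη0)
    refine (hC.fracMoment_finGreen_le hs hs1.le hzim (hsub ρ (by linarith)) hη
      (fun hmem => ?_)).trans ?_
    · have h1 := mem_siteBall.1 hmem
      have h2 := (mem_shell.1 ha).1
      omega
    rw [hΨ']
    calc _ ≤ ENNReal.ofReal Ψ * (ENNReal.ofReal (c * L ^ n) *
          ENNReal.ofReal (2 * (B₂ / L ^ (4 * n)))) := by
          gcongr
          exact (Nat.cast_le.2 (hcard ρ (by linarith) 0)).trans hN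
      _ = ENNReal.ofReal (Ψ * (c * L ^ n * (2 * (B₂ / L ^ (4 * n))))) := by
          rw [← ENNReal.ofReal_mul hcL, ← ENNReal.ofReal_mul hΨ0]
      _ ≤ _ := by
          refine ENNReal.ofReal_le_ofReal ?_
          have h2 : Ψ * (c * L ^ n * (2 * (B₂ / L ^ (4 * n)))) =
              Ψ / (Ψ + 1) * (B₁ / L ^ (3 * n)) := by
            rw [hB₂, mul_comm 4 n, pow_mul, mul_comm 3 n, pow_mul]
            field_simp
          rw [h2]
          have h3 : Ψ / (Ψ + 1) ≤ 1 := (div_le_one (by linarith)).2 (by linarith)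
          exact mul_le_of_le_one_left hβpos.le h3
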